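/- Let $\theta_i=z_i\,\partial/\partial z_i$ ($i=1,2$), and consider the Picard–Fuchs operators of the mirror family of the elliptic fibration $X_{18}(1,1,1,6,9)$ over $\mathbb P^2$, $$\mathcal L_1=\theta_1(\theta_1-3\theta_2)-12z_1(6\theta_1+1)(6\theta_1+5),\qquad \mathcal L_2=\theta_2^3+z_2\prod_{i=0}^{2}(3\theta_2-\theta_1+i),$$ with discriminants $$\Delta_1=(1-432z_1)^3-27z_2(432z_1)^3,\qquad \Delta_2=1+27z_2 .$$ Let $X_0=1+\cdots$, $X_1=X_0\log z_1+S_1$, $X_2=X_0\log z_2+S_2$ be the solutions of $\mathcal L_1X=\mathcal L_2X=0$ with $X_0,S_1,S_2\in\mathbb C[[z_1,z_2]]$, normalized by $X_0(0)=1$ and $S_1(0)=S_2(0)=0$ (they exist and are unique). Put $$q_E=\exp(X_1/X_0)=z_1+\cdots,\qquad q_B=\exp(X_2/X_0)=z_2+\cdots,$$ so that every power series in $z_1,z_2$ is uniquely a power series in $q_E,q_B$. For a rational function $f\in\mathbb C(z_1,z_2)$ let $\tilde f$ be the rational function obtained by the substitution $$(z_1,z_2)\mapsto\Big(\tfrac1{432}-z_1,\;-\frac{(432z_1)^3z_2}{(1-432z_1)^3}\Big).$$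 For integers $g\ge1$ and $m,n\ge0$ let $V_0^{(g,m,n)}$ be the space of all $$f=\frac{p(z_1)\,z_2^n}{(\Delta_1\Delta_2)^{2g-2}}$$ with $p\in\mathbb C[z_1]$ of degree at most $m$, and let $V_0^{(g,+\infty,n)}$ be the union of these spaces over all $m$. Let $$V_1^{(g,m,n)}=\{f\in V_0^{(g,m,n)}:\tilde f\in V_0^{(g,m,n)}\},\qquad V_2^{(g,m,n)}=\{f\in V_1^{(g,m,n)}:\tilde f=(-1)^{g-1}f\}.$$ With $\eta(q)^{24}=q\prod_{r\ge1}(1-q^r)^{24}$, every $f\in V_0^{(g,+\infty,n)}$ has an expansion $$X_0^{2g-2}f=\sum_{k\ge n}p_k(q_E)\Big(\frac{q_E}{\eta(q_E)^{24}}\Big)^{3k/2}q_B^k,\qquad p_k\in\mathbb C[[q_E]],$$ and $p_n\neq0$ if $f\ne0$. Let $W_0^{(g,n)}$ be the space of those $f\in V_0^{(g,+\infty,n)}$ for which $p_n$ is (the $q$-expansion of) a modular form of weight $18n+2g-2$ for $SL(2,\mathbb Z)$. Let $\mathcal M_w$ denote the space of (holomorphic) modular forms of weight $w$ for $SL(2,\mathbb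 Z)$; in particular $\mathcal M_w=0$ for $w<0$. **Proposition.** For all integers $g\ge1$ and $n\ge0$, $$W_0^{(g,n)}=V_2^{(g,\,[\frac{19}{3}(g-1)],\,n)} .$$ Moreover, if $n\le 2g-2$, then $f\mapsto p_n$ is a linear isomorphism $W_0^{(g,n)}\to\mathcal M_{18n+2g-2}$; and if $n>2g-2$, then $f\mapsto p_n/\eta^{72(n-2g+2)}$ is a linear isomorphism $W_0^{(g,n)}\to\mathcal M_{74(g-1)-18n}$. -/

import Mathlib

open scoped MatrixGroups

namespace X18

/-- Polynomials in the two complex structure coordinates. Index `0` is the fibre coordinate `z₁`,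
index `1` is the base coordinate `z₂`. -/
abbrev Poly : Type := MvPolynomial (Fin 2) ℂ
/-- Formal power series in `z₁, z₂` (expansions at the large volume point `z₁ = z₂ = 0`), and also
formal power series in the flat coordinates `q_E, q_B`. -/
abbrev Series : Type := MvPowerSeries (Fin 2) ℂ
/-- The field `ℂ(z₁, z₂)` of rational functions. -/
abbrev RatFun : Type := FractionRing Poly

noncomputable section

set_option linter.unusedSimpArgs false

/-- The logarithmic derivative `θ_i = z_i ∂/∂z_i` on power series. -/
def theta (i : Fin 2) : Series →ₗ[ℂ] Series :=
  LinearMap.mulLeft ℂ (MvPowerSeries.X i : Series) ∘ₗ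
    (MvPowerSeries.pderiv (R := ℂ) i : Series →ₗ[ℂ] Series)

lemma coeff_theta (i : Fin 2) (A : Series) (d : Fin 2 →₀ ℕ) :
    MvPowerSeries.coeff d (theta i A) = (d i : ℂ) * MvPowerSeries.coeff d A := by
  simp only [theta, LinearMap.coe_comp, Function.comp_apply, LinearMap.mulLeft_apply,
    Derivation.coeFn_coe,
    MvPowerSeries.X, MvPowerSeries.coeff_monomial_mul, one_mul, MvPowerSeries.coeff_pderiv]
  split_ifs with h
  · have h1 : 1 ≤ d i := by simpa using h i
    rw [tsub_add_cancel_of_le h]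
    simp [Nat.cast_sub h1]
    ring
  · have h1 : d i = 0 := by
      by_contra hne
      exact h (by simpa [Finsupp.single_le_iff] using Nat.one_le_iff_ne_zero.mpr hne)
    simp [h1]

/-- The pair `(A, B)` stands for `A + B₁ log z₁ + B₂ log z₂`. -/
abbrev LogSeries : Type := Series × (Fin 2 → Series)

/-- `θ_i` on `A + ∑_j B_j log z_j`, using `θ_i log z_j = δ_{ij}`. -/
def logTheta (i : Fin 2) : Module.End ℂ LogSeries where
  toFun w := (theta i w.1 + w.2 i, fun j => theta i (w.2 j))
  map_add' v w := by
    ext1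
    · simp; abel
    · funext j; simp
  map_smul' c w := by
    ext1
    · simp
    · funext j; simp

/-- Multiplication by `z_i`. -/
def mulZ (i : Fin 2) : Module.End ℂ LogSeries := Algebra.lsmul ℂ ℂ LogSeries (MvPowerSeries.X i : Series)

/-- The Picard-Fuchs operator `θ₁ (θ₁ - 3 θ₂) - 12 z₁ (6 θ₁ + 1) (6 θ₁ + 5)`. -/
def PF1 : Module.End ℂ LogSeries :=
  logTheta 0 * (logTheta 0 - 3 * logTheta 1)
    - 12 * mulZ 0 * (6 * logTheta 0 + 1) * (6 * logTheta 0 + 5)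

/-- The Picard-Fuchs operator
`θ₂³ + z₂ (3 θ₂ - θ₁) (3 θ₂ - θ₁ + 1) (3 θ₂ - θ₁ + 2)`. -/
def PF2 : Module.End ℂ LogSeries :=
  logTheta 1 ^ 3 + mulZ 1 * ((3 * logTheta 1 - logTheta 0) * (3 * logTheta 1 - logTheta 0 + 1)
    * (3 * logTheta 1 - logTheta 0 + 2))

/-- The power series solution `X₀ = 1 + ⋯` and the two single-logarithmic solutions
`X_i = X₀ log z_i + S_i`, `S_i = 0 + ⋯`, of the Picard-Fuchs system at the large volume point. -/
structure IsLargeVolumeBasis (X₀ S₁ S₂ : Series) : Prop where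
  pf_zero : PF1 (X₀, 0) = 0 ∧ PF2 (X₀, 0) = 0
  pf_one : PF1 (S₁, ![X₀, 0]) = 0 ∧ PF2 (S₁, ![X₀, 0]) = 0
  pf_two : PF1 (S₂, ![0, X₀]) = 0 ∧ PF2 (S₂, ![0, X₀]) = 0
  const_zero : MvPowerSeries.constantCoeff X₀ = 1
  const_one : MvPowerSeries.constantCoeff S₁ = 0
  const_two : MvPowerSeries.constantCoeff S₂ = 0

/-- `(6a)! / ((2a)! (3a)!)`. -/
def frobA (a : ℕ) : ℂ := (6 * a).factorial / ((2 * a).factorial * (3 * a).factorial)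
/-- The derivative of `Γ(1+6a) / (Γ(1+2a) Γ(1+3a))` at a natural number `a`, with its Euler
constant term left out. -/
def frobA' (a : ℕ) : ℂ :=
  frobA a * (6 * harmonic (6 * a) - 2 * harmonic (2 * a) - 3 * harmonic (3 * a) : ℚ)
/-- `1 / b!³`. -/
def frobB (b : ℕ) : ℂ := 1 / (b.factorial : ℂ) ^ 3
/-- The derivative of `1 / Γ(1+b)³` at a natural number `b`, with its Euler constant term left out.
The Euler constants cancel in the Frobenius series. -/
def frobB' (b : ℕ) : ℂ := frobB b * (-3 * harmonic b : ℚ)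
/-- `1 / Γ(1+m)` for an integer `m`. -/
def frobG : ℤ → ℂ
  | .ofNat m => 1 / m.factorial
  | .negSucc _ => 0
/-- The derivative of `1 / Γ(1+m)` at an integer `m`, with its Euler constant term left out. -/
def frobG' : ℤ → ℂ
  | .ofNat m => -(harmonic m : ℚ) / m.factorial
  | .negSucc k => (-1) ^ k * k.factorial

/-- The holomorphic period `X₀ = ∑ (6a)! / ((2a)! (3a)! b!³ (a-3b)!) z₁^a z₂^b`. That `X0`, `S1`, `S2`
are the normalized solutions of the Picard-Fuchs system, and the only ones, is
`isLargeVolumeBasis_iff` below. -/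
def X0 : Series := fun d => frobA (d 0) * frobB (d 1) * frobG (d 0 - 3 * d 1)
/-- The power series part of `X₁ = X₀ log z₁ + S₁`. -/
def S1 : Series := fun d => frobA' (d 0) * frobB (d 1) * frobG (d 0 - 3 * d 1)
    + frobA (d 0) * frobB (d 1) * frobG' (d 0 - 3 * d 1)
/-- The power series part of `X₂ = X₀ log z₂ + S₂`. -/
def S2 : Series := fun d => frobA (d 0) * frobB' (d 1) * frobG (d 0 - 3 * d 1)
    - 3 * (frobA (d 0) * frobB (d 1) * frobG' (d 0 - 3 * d 1))

lemma frobG_rec (m : ℤ) : frobG (m - 1) = m * frobG m := by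
  rcases m with (_ | m) | k
  · show frobG (-1) = _
    show (0 : ℂ) = _
    simp
  · have : (Int.ofNat (m + 1) - 1 : ℤ) = Int.ofNat m := by simp
    rw [this]
    simp [frobG, Nat.factorial_succ]
    field_simp
  · have : (Int.negSucc k - 1 : ℤ) = Int.negSucc (k + 1) := by lia
    rw [this]; simp [frobG]

lemma frobG'_rec (m : ℤ) : frobG' (m - 1) = m * frobG' m + frobG m := by
  rcases m with (_ | m) | k
  · show frobG' (Int.negSucc 0) = _
    simp [frobG, frobG']
  · have : (Int.ofNat (m + 1) - 1 : ℤ) = Int.ofNat m := by simp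
    rw [this]
    have : (m : ℂ) + 1 ≠ 0 := by exact_mod_cast Nat.succ_ne_zero m
    simp [frobG, frobG', Nat.factorial_succ, harmonic_succ]
    field_simp
    ring
  · have : (Int.negSucc k - 1 : ℤ) = Int.negSucc (k + 1) := by lia
    rw [this]; simp [frobG, frobG', Nat.factorial_succ, Int.negSucc_eq]; ring

lemma frobB_rec (b : ℕ) : (b + 1 : ℂ) ^ 3 * frobB (b + 1) = frobB b := by
  have : (b : ℂ) + 1 ≠ 0 := by exact_mod_cast Nat.succ_ne_zero b
  simp [frobB, Nat.factorial_succ]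
  field_simp

lemma frobB'_rec (b : ℕ) :
    (b + 1 : ℂ) ^ 3 * frobB' (b + 1) + 3 * (b + 1) ^ 2 * frobB (b + 1) = frobB' b := by
  have : (b : ℂ) + 1 ≠ 0 := by exact_mod_cast Nat.succ_ne_zero b
  have h := frobB_rec b
  simp only [frobB', harmonic_succ, ← h]
  push_cast
  field_simp
  ring

lemma frobA_rec (a : ℕ) :
    (a + 1 : ℂ) * frobA (a + 1) = 12 * (6 * a + 1) * (6 * a + 5) * frobA a := by
  have h6 : 6 * (a + 1) = 6 * a + 1 + 1 + 1 + 1 + 1 + 1 := by ring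
  have h2 : 2 * (a + 1) = 2 * a + 1 + 1 := by ring
  have h3 : 3 * (a + 1) = 3 * a + 1 + 1 + 1 := by ring
  have e1 : (2 * a + 1 : ℂ) ≠ 0 := by exact_mod_cast Nat.succ_ne_zero (2 * a)
  have e2 : (3 * a + 1 : ℂ) ≠ 0 := by exact_mod_cast Nat.succ_ne_zero (3 * a)
  have e3 : (3 * a + 2 : ℂ) ≠ 0 := by exact_mod_cast Nat.succ_ne_zero (3 * a + 1)
  have e4 : (a + 1 : ℂ) ≠ 0 := by exact_mod_cast Nat.succ_ne_zero a
  have f1 : ((2 * a).factorial : ℂ) ≠ 0 := by exact_mod_cast Nat.factorial_ne_zero _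
  have f2 : ((3 * a).factorial : ℂ) ≠ 0 := by exact_mod_cast Nat.factorial_ne_zero _
  have g1 : ((2 * (a + 1)).factorial : ℂ) = 2 * (a + 1) * (2 * a + 1) * (2 * a).factorial := by
    rw [h2]; push_cast [Nat.factorial_succ]; ring
  have g2 : ((3 * (a + 1)).factorial : ℂ)
      = 3 * (a + 1) * (3 * a + 2) * (3 * a + 1) * (3 * a).factorial := by
    rw [h3]; push_cast [Nat.factorial_succ]; ring
  have g3 : ((6 * (a + 1)).factorial : ℂ)
      = (6 * (a + 1)) * (6 * a + 5) * (2 * (3 * a + 2)) * (3 * (2 * a + 1)) * (2 * (3 * a + 1))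
        * (6 * a + 1) * (6 * a).factorial := by
    rw [h6]; push_cast [Nat.factorial_succ]; ring
  rw [frobA, frobA, g1, g2, g3, mul_div_assoc', mul_div_assoc', div_eq_div_iff
    (by simp only [ne_eq, mul_eq_zero, not_or, e1, e2, e3, e4, f1, f2]; norm_num)
    (mul_ne_zero f1 f2)]
  ring

lemma frobA'_rec (a : ℕ) :
    (a + 1 : ℂ) * frobA' (a + 1) + frobA (a + 1)
      = 12 * (6 * a + 1) * (6 * a + 5) * frobA' a + 12 * (72 * a + 36) * frobA a := by
  have h6 : 6 * (a + 1) = 6 * a + 1 + 1 + 1 + 1 + 1 + 1 := by ring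
  have h2 : 2 * (a + 1) = 2 * a + 1 + 1 := by ring
  have h3 : 3 * (a + 1) = 3 * a + 1 + 1 + 1 := by ring
  have e1 : (2 * a + 1 : ℂ) ≠ 0 := by exact_mod_cast Nat.succ_ne_zero (2 * a)
  have e2 : (3 * a + 1 : ℂ) ≠ 0 := by exact_mod_cast Nat.succ_ne_zero (3 * a)
  have e3 : (3 * a + 2 : ℂ) ≠ 0 := by exact_mod_cast Nat.succ_ne_zero (3 * a + 1)
  have e4 : (a + 1 : ℂ) ≠ 0 := by exact_mod_cast Nat.succ_ne_zero a
  have e5 : (6 * a + 1 : ℂ) ≠ 0 := by exact_mod_cast Nat.succ_ne_zero (6 * a)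
  have e6 : (6 * a + 5 : ℂ) ≠ 0 := by exact_mod_cast Nat.succ_ne_zero (6 * a + 4)
  have hh : ((6 * harmonic (6 * (a + 1)) - 2 * harmonic (2 * (a + 1))
      - 3 * harmonic (3 * (a + 1)) : ℚ) : ℂ)
      = (6 * harmonic (6 * a) - 2 * harmonic (2 * a) - 3 * harmonic (3 * a) : ℚ)
        + 6 / (6 * a + 1) + 6 / (6 * a + 5) - 1 / (a + 1) := by
    rw [h6, h2, h3]
    simp only [harmonic_succ]
    push_cast
    have t1 : (6 * a + 1 + 1 : ℂ)⁻¹ = 2⁻¹ * (3 * a + 1 : ℂ)⁻¹ := by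
      rw [← mul_inv]; congr 1; ring
    have t2 : (6 * a + 2 + 1 : ℂ)⁻¹ = 3⁻¹ * (2 * a + 1 : ℂ)⁻¹ := by
      rw [← mul_inv]; congr 1; ring
    have t3 : (6 * a + 3 + 1 : ℂ)⁻¹ = 2⁻¹ * (3 * a + 2 : ℂ)⁻¹ := by
      rw [← mul_inv]; congr 1; ring
    have t4 : (6 * a + 4 + 1 : ℂ)⁻¹ = (6 * a + 5 : ℂ)⁻¹ := by congr 1; ring
    have t5 : (6 * a + 5 + 1 : ℂ)⁻¹ = 6⁻¹ * (a + 1 : ℂ)⁻¹ := by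
      rw [← mul_inv]; congr 1; ring
    have t6 : (2 * a + 1 + 1 : ℂ)⁻¹ = 2⁻¹ * (a + 1 : ℂ)⁻¹ := by
      rw [← mul_inv]; congr 1; ring
    have t7 : (3 * a + 1 + 1 : ℂ)⁻¹ = (3 * a + 2 : ℂ)⁻¹ := by congr 1; ring
    have t8 : (3 * a + 2 + 1 : ℂ)⁻¹ = 3⁻¹ * (a + 1 : ℂ)⁻¹ := by
      rw [← mul_inv]; congr 1; ring
    rw [t1, t2, t3, t4, t5, t6, t7, t8]
    ring
  have h := frobA_rec a
  rw [frobA', frobA', hh]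
  linear_combination
    (((6 * harmonic (6 * a) - 2 * harmonic (2 * a) - 3 * harmonic (3 * a) : ℚ) : ℂ)
      + 6 * (6 * a + 1 : ℂ)⁻¹ + 6 * (6 * a + 5 : ℂ)⁻¹) * h
    + 72 * (6 * a + 5) * frobA a * mul_inv_cancel₀ e5
    + 72 * (6 * a + 1) * frobA a * mul_inv_cancel₀ e6
    - frobA (a + 1) * mul_inv_cancel₀ e4


lemma coeff_X_mul' (i : Fin 2) (A : Series) (d : Fin 2 →₀ ℕ) :
    MvPowerSeries.coeff d (MvPowerSeries.X i * A)
      = if 1 ≤ d i then MvPowerSeries.coeff (d - Finsupp.single i 1) A else 0 := by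
  simp only [MvPowerSeries.X, MvPowerSeries.coeff_monomial_mul, one_mul, Finsupp.single_le_iff]

lemma end_2 (w : LogSeries) : (2 : Module.End ℂ LogSeries) w = (2 : ℂ) • w := by
  rw [Module.End.ofNat_apply, ← Nat.cast_ofNat (R := ℂ), Nat.cast_smul_eq_nsmul]

lemma end_3 (w : LogSeries) : (3 : Module.End ℂ LogSeries) w = (3 : ℂ) • w := by
  rw [Module.End.ofNat_apply, ← Nat.cast_ofNat (R := ℂ), Nat.cast_smul_eq_nsmul]

lemma end_5 (w : LogSeries) : (5 : Module.End ℂ LogSeries) w = (5 : ℂ) • w := by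
  rw [Module.End.ofNat_apply, ← Nat.cast_ofNat (R := ℂ), Nat.cast_smul_eq_nsmul]

lemma end_6 (w : LogSeries) : (6 : Module.End ℂ LogSeries) w = (6 : ℂ) • w := by
  rw [Module.End.ofNat_apply, ← Nat.cast_ofNat (R := ℂ), Nat.cast_smul_eq_nsmul]

lemma end_12 (w : LogSeries) : (12 : Module.End ℂ LogSeries) w = (12 : ℂ) • w := by
  rw [Module.End.ofNat_apply, ← Nat.cast_ofNat (R := ℂ), Nat.cast_smul_eq_nsmul]

lemma PF1_apply_fst (A : Series) (B : Fin 2 → Series) (d : Fin 2 →₀ ℕ) :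
    MvPowerSeries.coeff d (PF1 (A, B)).1
      = (d 0 : ℂ) * (d 0 - 3 * d 1) * MvPowerSeries.coeff d A
        + (2 * d 0 - 3 * d 1) * MvPowerSeries.coeff d (B 0)
        - 3 * d 0 * MvPowerSeries.coeff d (B 1)
        - 12 * (if 1 ≤ d 0 then
            ((6 * (d 0 - 1 : ℂ) + 1) * (6 * (d 0 - 1 : ℂ) + 5)
                * MvPowerSeries.coeff (d - Finsupp.single 0 1) A
              + (72 * (d 0 - 1 : ℂ) + 36) * MvPowerSeries.coeff (d - Finsupp.single 0 1) (B 0))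
            else 0) := by
  simp only [PF1, logTheta, mulZ, end_2, end_3, end_5, end_6, end_12, Module.End.mul_apply, LinearMap.sub_apply,
    LinearMap.add_apply, Module.End.one_apply, LinearMap.coe_mk, AddHom.coe_mk,
    Algebra.lsmul_coe, Prod.fst_sub, Prod.fst_add, Prod.smul_fst, Prod.snd_sub, Prod.snd_add,
    Prod.smul_snd, map_add, map_sub, map_smul, Pi.add_apply, Pi.sub_apply, Pi.smul_apply,
    smul_eq_mul, coeff_theta, coeff_X_mul']
  split_ifs with h
  · simp [Nat.cast_sub h]
    ring
  · simp; ring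

lemma PF1_apply_snd (A : Series) (B : Fin 2 → Series) (j : Fin 2) (d : Fin 2 →₀ ℕ) :
    MvPowerSeries.coeff d ((PF1 (A, B)).2 j)
      = (d 0 : ℂ) * (d 0 - 3 * d 1) * MvPowerSeries.coeff d (B j)
        - 12 * (if 1 ≤ d 0 then
            (6 * (d 0 - 1 : ℂ) + 1) * (6 * (d 0 - 1 : ℂ) + 5)
                * MvPowerSeries.coeff (d - Finsupp.single 0 1) (B j)
            else 0) := by
  simp only [PF1, logTheta, mulZ, end_2, end_3, end_5, end_6, end_12, Module.End.mul_apply, LinearMap.sub_apply,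
    LinearMap.add_apply, Module.End.one_apply, LinearMap.coe_mk, AddHom.coe_mk,
    Algebra.lsmul_coe, Prod.fst_sub, Prod.fst_add, Prod.smul_fst, Prod.snd_sub, Prod.snd_add,
    Prod.smul_snd, map_add, map_sub, map_smul, Pi.add_apply, Pi.sub_apply, Pi.smul_apply,
    smul_eq_mul, coeff_theta, coeff_X_mul']
  split_ifs with h
  · simp [Nat.cast_sub h]
    ring
  · simp; ring

lemma PF2_apply_fst (A : Series) (B : Fin 2 → Series) (d : Fin 2 →₀ ℕ) :
    MvPowerSeries.coeff d (PF2 (A, B)).1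
      = (d 1 : ℂ) ^ 3 * MvPowerSeries.coeff d A
        + 3 * (d 1 : ℂ) ^ 2 * MvPowerSeries.coeff d (B 1)
        + (if 1 ≤ d 1 then
            (3 * (d 1 - 1 : ℂ) - d 0) * (3 * (d 1 - 1 : ℂ) - d 0 + 1)
                * (3 * (d 1 - 1 : ℂ) - d 0 + 2)
                * MvPowerSeries.coeff (d - Finsupp.single 1 1) A
              + (3 * (3 * (d 1 - 1 : ℂ) - d 0) ^ 2 + 6 * (3 * (d 1 - 1 : ℂ) - d 0) + 2)
                * (3 * MvPowerSeries.coeff (d - Finsupp.single 1 1) (B 1)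
                  - MvPowerSeries.coeff (d - Finsupp.single 1 1) (B 0))
            else 0) := by
  simp only [PF2, pow_succ, pow_zero, logTheta, mulZ, end_2, end_3, end_5, end_6, end_12, Module.End.mul_apply,
    LinearMap.sub_apply, one_mul,
    LinearMap.add_apply, Module.End.one_apply, LinearMap.coe_mk, AddHom.coe_mk,
    Algebra.lsmul_coe, Prod.fst_sub, Prod.fst_add, Prod.smul_fst, Prod.snd_sub, Prod.snd_add,
    Prod.smul_snd, map_add, map_sub, map_smul, Pi.add_apply, Pi.sub_apply, Pi.smul_apply,
    smul_eq_mul, coeff_theta, coeff_X_mul']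
  split_ifs with h
  · simp [Nat.cast_sub h]
    ring
  · simp; ring

lemma PF2_apply_snd (A : Series) (B : Fin 2 → Series) (j : Fin 2) (d : Fin 2 →₀ ℕ) :
    MvPowerSeries.coeff d ((PF2 (A, B)).2 j)
      = (d 1 : ℂ) ^ 3 * MvPowerSeries.coeff d (B j)
        + (if 1 ≤ d 1 then
            (3 * (d 1 - 1 : ℂ) - d 0) * (3 * (d 1 - 1 : ℂ) - d 0 + 1)
                * (3 * (d 1 - 1 : ℂ) - d 0 + 2)
                * MvPowerSeries.coeff (d - Finsupp.single 1 1) (B j)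
            else 0) := by
  simp only [PF2, pow_succ, pow_zero, logTheta, mulZ, end_2, end_3, end_5, end_6, end_12, Module.End.mul_apply,
    LinearMap.sub_apply, one_mul,
    LinearMap.add_apply, Module.End.one_apply, LinearMap.coe_mk, AddHom.coe_mk,
    Algebra.lsmul_coe, Prod.fst_sub, Prod.fst_add, Prod.smul_fst, Prod.snd_sub, Prod.snd_add,
    Prod.smul_snd, map_add, map_sub, map_smul, Pi.add_apply, Pi.sub_apply, Pi.smul_apply,
    smul_eq_mul, coeff_theta, coeff_X_mul']
  split_ifs with h
  · simp [Nat.cast_sub h]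
    ring
  · simp; ring

lemma coeff_X0 (d : Fin 2 →₀ ℕ) : MvPowerSeries.coeff d X0
    = frobA (d 0) * frobB (d 1) * frobG (d 0 - 3 * d 1) := rfl

lemma coeff_S1 (d : Fin 2 →₀ ℕ) : MvPowerSeries.coeff d S1
    = frobA' (d 0) * frobB (d 1) * frobG (d 0 - 3 * d 1)
      + frobA (d 0) * frobB (d 1) * frobG' (d 0 - 3 * d 1) := rfl

lemma coeff_S2 (d : Fin 2 →₀ ℕ) : MvPowerSeries.coeff d S2
    = frobA (d 0) * frobB' (d 1) * frobG (d 0 - 3 * d 1)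
      - 3 * (frobA (d 0) * frobB (d 1) * frobG' (d 0 - 3 * d 1)) := rfl

lemma frobG_neg {m : ℤ} (hm : m < 0) : frobG m = 0 := by
  rcases m with m | k
  · exact absurd hm (by simp)
  · rfl

lemma frobG_rec3 (m : ℤ) : frobG m = (m + 1) * (m + 2) * (m + 3) * frobG (m + 3) := by
  have h1 := frobG_rec (m + 1)
  have h2 := frobG_rec (m + 2)
  have h3 := frobG_rec (m + 3)
  rw [show m + 1 - 1 = m by ring] at h1
  rw [show m + 2 - 1 = m + 1 by ring] at h2
  rw [show m + 3 - 1 = m + 2 by ring] at h3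
  rw [h1, h2, h3]; push_cast; ring

lemma frobG'_rec3 (m : ℤ) : frobG' m = (m + 1) * (m + 2) * (m + 3) * frobG' (m + 3)
    + ((m + 2) * (m + 3) + (m + 1) * (m + 3) + (m + 1) * (m + 2)) * frobG (m + 3) := by
  have h1 := frobG'_rec (m + 1)
  have h2 := frobG'_rec (m + 2)
  have h3 := frobG'_rec (m + 3)
  have k2 := frobG_rec (m + 2)
  have k3 := frobG_rec (m + 3)
  rw [show m + 1 - 1 = m by ring] at h1
  rw [show m + 2 - 1 = m + 1 by ring] at h2 k2
  rw [show m + 3 - 1 = m + 2 by ring] at h3 k3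
  rw [h1, h2, h3, k2, k3]; push_cast; ring

lemma isLargeVolumeBasis_frobenius : IsLargeVolumeBasis X0 S1 S2 := by
  have z0 : ∀ d : Fin 2 →₀ ℕ, (d - (Finsupp.single 0 1 : Fin 2 →₀ ℕ)) 0 = d 0 - 1 := fun d => by simp
  have z1 : ∀ d : Fin 2 →₀ ℕ, (d - (Finsupp.single 0 1 : Fin 2 →₀ ℕ)) 1 = d 1 := fun d => by simp
  have y0 : ∀ d : Fin 2 →₀ ℕ, (d - (Finsupp.single 1 1 : Fin 2 →₀ ℕ)) 0 = d 0 := fun d => by simp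
  have y1 : ∀ d : Fin 2 →₀ ℕ, (d - (Finsupp.single 1 1 : Fin 2 →₀ ℕ)) 1 = d 1 - 1 := fun d => by simp
  have g0 : ∀ a b : ℕ, frobG (a - 3 * b) = (a + 1 - 3 * b) * frobG ((a + 1 : ℕ) - 3 * b) := by
    intro a b
    have := frobG_rec ((a + 1 : ℕ) - 3 * b)
    rw [show ((a + 1 : ℕ) - 3 * b - 1 : ℤ) = a - 3 * b by push_cast; ring] at this
    rw [this]; push_cast; ring
  have g1 : ∀ a b : ℕ, frobG' (a - 3 * b) = (a + 1 - 3 * b) * frobG' ((a + 1 : ℕ) - 3 * b)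
      + frobG ((a + 1 : ℕ) - 3 * b) := by
    intro a b
    have := frobG'_rec ((a + 1 : ℕ) - 3 * b)
    rw [show ((a + 1 : ℕ) - 3 * b - 1 : ℤ) = a - 3 * b by push_cast; ring] at this
    rw [this]; push_cast; ring
  have k0 : ∀ a b : ℕ, frobG (a - 3 * (b + 1 : ℕ))
      = -((3 * b - a) * (3 * b - a + 1) * (3 * b - a + 2)) * frobG (a - 3 * b) := by
    intro a b
    have := frobG_rec3 (a - 3 * (b + 1 : ℕ))
    rw [show ((a : ℤ) - 3 * (b + 1 : ℕ) + 3 : ℤ) = a - 3 * b by push_cast; ring] at this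
    rw [this]; push_cast; ring
  have k1 : ∀ a b : ℕ, frobG' (a - 3 * (b + 1 : ℕ))
      = -((3 * b - a) * (3 * b - a + 1) * (3 * b - a + 2)) * frobG' (a - 3 * b)
        + (3 * (3 * b - a) ^ 2 + 6 * (3 * b - a) + 2) * frobG (a - 3 * b) := by
    intro a b
    have := frobG'_rec3 (a - 3 * (b + 1 : ℕ))
    rw [show ((a : ℤ) - 3 * (b + 1 : ℕ) + 3 : ℤ) = a - 3 * b by push_cast; ring] at this
    rw [this]; push_cast; ring
  have e1 : ∀ d : Fin 2 →₀ ℕ, (d 0 : ℂ) * (d 0 - 3 * d 1) * MvPowerSeries.coeff d X0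
        - 12 * (if 1 ≤ d 0 then
            (6 * (d 0 - 1 : ℂ) + 1) * (6 * (d 0 - 1 : ℂ) + 5)
                * MvPowerSeries.coeff (d - Finsupp.single 0 1) X0
            else 0) = 0 := by
    intro d
    simp only [coeff_X0, z0, z1]
    rcases d 0 with _ | a
    · simp
    · simp only [le_add_iff_nonneg_left, zero_le, if_true, Nat.add_sub_cancel, g0 a (d 1)]
      push_cast
      linear_combination frobB (d 1) * (a + 1 - 3 * d 1) * frobG (a + 1 - 3 * d 1) * frobA_rec a
  have e2 : ∀ d : Fin 2 →₀ ℕ, (d 1 : ℂ) ^ 3 * MvPowerSeries.coeff d X0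
        + (if 1 ≤ d 1 then
            (3 * (d 1 - 1 : ℂ) - d 0) * (3 * (d 1 - 1 : ℂ) - d 0 + 1)
                * (3 * (d 1 - 1 : ℂ) - d 0 + 2)
                * MvPowerSeries.coeff (d - Finsupp.single 1 1) X0
            else 0) = 0 := by
    intro d
    simp only [coeff_X0, y0, y1]
    rcases d 1 with _ | b
    · simp
    · simp only [le_add_iff_nonneg_left, zero_le, if_true, Nat.add_sub_cancel, k0 (d 0) b]
      push_cast
      linear_combination -(frobA (d 0) * ((3 * b - d 0) * (3 * b - d 0 + 1) * (3 * b - d 0 + 2))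
        * frobG (d 0 - 3 * b)) * frobB_rec b
  refine ⟨⟨?_, ?_⟩, ⟨?_, ?_⟩, ⟨?_, ?_⟩, ?_, ?_, ?_⟩
  · ext1
    · ext d
      rw [PF1_apply_fst]
      simpa using e1 d
    · funext j; ext d
      rw [PF1_apply_snd]
      simp
  · ext1
    · ext d
      rw [PF2_apply_fst]
      simpa using e2 d
    · funext j; ext d
      rw [PF2_apply_snd]
      simp
  · ext1
    · ext d
      rw [PF1_apply_fst]
      simp only [Matrix.cons_val_zero, Matrix.cons_val_one, map_zero, Prod.fst_zero, coeff_X0, coeff_S1, z0, z1]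
      rcases d 0 with _ | a
      · rcases d 1 with _ | b
        · simp
        · simp [frobG_neg (show (-(3 * (b + 1 : ℤ))) < 0 by lia)]
      · simp only [le_add_iff_nonneg_left, zero_le, if_true, Nat.add_sub_cancel, g0 a (d 1), g1 a (d 1)]
        push_cast
        linear_combination frobB (d 1) * (a + 1 - 3 * d 1) * frobG (a + 1 - 3 * d 1) * frobA'_rec a
          + frobB (d 1) * ((a + 1 - 3 * d 1) * frobG' (a + 1 - 3 * d 1)
            + frobG (a + 1 - 3 * d 1)) * frobA_rec a
    · funext j; ext d
      rw [PF1_apply_snd]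
      fin_cases j
      · simpa using e1 d
      · simp
  · ext1
    · ext d
      rw [PF2_apply_fst]
      simp only [Matrix.cons_val_zero, Matrix.cons_val_one, map_zero, Prod.fst_zero, coeff_X0, coeff_S1, y0, y1]
      rcases d 1 with _ | b
      · simp
      · simp only [le_add_iff_nonneg_left, zero_le, if_true, Nat.add_sub_cancel, k0 (d 0) b, k1 (d 0) b]
        push_cast
        linear_combination (-(frobA' (d 0)
            * ((3 * b - d 0) * (3 * b - d 0 + 1) * (3 * b - d 0 + 2)) * frobG (d 0 - 3 * b))
          + frobA (d 0) * (-((3 * b - d 0) * (3 * b - d 0 + 1) * (3 * b - d 0 + 2))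
              * frobG' (d 0 - 3 * b)
            + (3 * (3 * b - d 0) ^ 2 + 6 * (3 * b - d 0) + 2) * frobG (d 0 - 3 * b)))
          * frobB_rec b
    · funext j; ext d
      rw [PF2_apply_snd]
      fin_cases j
      · simpa using e2 d
      · simp
  · ext1
    · ext d
      rw [PF1_apply_fst]
      simp only [Matrix.cons_val_zero, Matrix.cons_val_one, map_zero, Prod.fst_zero, coeff_X0, coeff_S2, z0, z1]
      rcases d 0 with _ | a
      · simp
      · simp only [le_add_iff_nonneg_left, zero_le, if_true, Nat.add_sub_cancel, g0 a (d 1), g1 a (d 1)]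
        push_cast
        linear_combination (frobB' (d 1) * (a + 1 - 3 * d 1) * frobG (a + 1 - 3 * d 1)
          - 3 * frobB (d 1) * ((a + 1 - 3 * d 1) * frobG' (a + 1 - 3 * d 1)
            + frobG (a + 1 - 3 * d 1))) * frobA_rec a
    · funext j; ext d
      rw [PF1_apply_snd]
      fin_cases j
      · simp
      · simpa using e1 d
  · ext1
    · ext d
      rw [PF2_apply_fst]
      simp only [Matrix.cons_val_zero, Matrix.cons_val_one, map_zero, Prod.fst_zero, coeff_X0, coeff_S2, y0, y1]
      rcases d 1 with _ | b
      · simp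
      · simp only [le_add_iff_nonneg_left, zero_le, if_true, Nat.add_sub_cancel, k0 (d 0) b, k1 (d 0) b]
        push_cast
        linear_combination -(frobA (d 0)
            * ((3 * b - d 0) * (3 * b - d 0 + 1) * (3 * b - d 0 + 2)) * frobG (d 0 - 3 * b))
            * frobB'_rec b
          - 3 * frobA (d 0) * (-((3 * b - d 0) * (3 * b - d 0 + 1) * (3 * b - d 0 + 2))
              * frobG' (d 0 - 3 * b)
            + (3 * (3 * b - d 0) ^ 2 + 6 * (3 * b - d 0) + 2) * frobG (d 0 - 3 * b))
          * frobB_rec b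
    · funext j; ext d
      rw [PF2_apply_snd]
      fin_cases j
      · simp
      · simpa using e2 d
  · rw [← MvPowerSeries.coeff_zero_eq_constantCoeff_apply, coeff_X0]
    simp [frobA, frobB, show frobG 0 = 1 by simp [show (0 : ℤ) = Int.ofNat 0 from rfl, frobG]]
  · rw [← MvPowerSeries.coeff_zero_eq_constantCoeff_apply, coeff_S1]
    simp [frobA, frobB, frobA', show frobG' 0 = 0 by
      rw [show (0 : ℤ) = Int.ofNat 0 from rfl]; simp only [frobG']; simp]
  · rw [← MvPowerSeries.coeff_zero_eq_constantCoeff_apply, coeff_S2]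
    simp [frobA, frobB, frobB', show frobG' 0 = 0 by
      rw [show (0 : ℤ) = Int.ofNat 0 from rfl]; simp only [frobG']; simp]

lemma eq_zero_of_PF (A : Series) (h1 : PF1 (A, 0) = 0) (h2 : PF2 (A, 0) = 0)
    (h0 : MvPowerSeries.constantCoeff A = 0) : A = 0 := by
  have e1 : ∀ d : Fin 2 →₀ ℕ, MvPowerSeries.coeff d (PF1 (A, 0)).1 = 0 := by simp [h1]
  have e2 : ∀ d : Fin 2 →₀ ℕ, MvPowerSeries.coeff d (PF2 (A, 0)).1 = 0 := by simp [h2]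
  simp only [PF1_apply_fst, PF2_apply_fst, Pi.zero_apply, map_zero] at e1 e2
  have key : ∀ a b : ℕ, ∀ d : Fin 2 →₀ ℕ, d 0 = a → d 1 = b → MvPowerSeries.coeff d A = 0 := by
    intro a b
    induction b generalizing a with
    | zero =>
      induction a with
      | zero =>
        intro d hd0 hd1
        have : d = 0 := by ext i; fin_cases i <;> simpa
        rw [this]; simpa using h0
      | succ a ih =>
        intro d hd0 hd1
        have h := e1 d
        rw [ih (d - (Finsupp.single 0 1 : Fin 2 →₀ ℕ)) (by simp [hd0]) (by simp [hd1])] at h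
        have ha : (a + 1 : ℂ) ≠ 0 := by exact_mod_cast Nat.succ_ne_zero a
        simpa [hd0, hd1, ha] using h
    | succ b ih =>
      intro d hd0 hd1
      have h := e2 d
      rw [ih a (d - (Finsupp.single 1 1 : Fin 2 →₀ ℕ)) (by simp [hd0]) (by simp [hd1])] at h
      have hb : (b + 1 : ℂ) ≠ 0 := by exact_mod_cast Nat.succ_ne_zero b
      simpa [hd0, hd1, hb] using h
  ext d
  simpa using key _ _ d rfl rfl

/-- `X0`, `S1`, `S2` are the unique normalized solutions of the Picard-Fuchs system. -/
theorem isLargeVolumeBasis_iff (A S T : Series) :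
    IsLargeVolumeBasis A S T ↔ A = X0 ∧ S = S1 ∧ T = S2 := by
  have hF := isLargeVolumeBasis_frobenius
  constructor
  · intro h
    have hA : A = X0 := by
      refine sub_eq_zero.mp (eq_zero_of_PF (A - X0) ?_ ?_ ?_)
      · rw [show ((A - X0, 0) : LogSeries) = (A, 0) - (X0, 0) by simp, map_sub, h.pf_zero.1,
          hF.pf_zero.1, sub_zero]
      · rw [show ((A - X0, 0) : LogSeries) = (A, 0) - (X0, 0) by simp, map_sub, h.pf_zero.2,
          hF.pf_zero.2, sub_zero]
      · rw [map_sub, h.const_zero, hF.const_zero, sub_self]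
    subst hA
    refine ⟨rfl, ?_, ?_⟩
    · refine sub_eq_zero.mp (eq_zero_of_PF (S - S1) ?_ ?_ ?_)
      · rw [show ((S - S1, 0) : LogSeries) = (S, ![X0, 0]) - (S1, ![X0, 0]) by simp, map_sub,
          h.pf_one.1, hF.pf_one.1, sub_zero]
      · rw [show ((S - S1, 0) : LogSeries) = (S, ![X0, 0]) - (S1, ![X0, 0]) by simp, map_sub,
          h.pf_one.2, hF.pf_one.2, sub_zero]
      · rw [map_sub, h.const_one, hF.const_one, sub_self]
    · refine sub_eq_zero.mp (eq_zero_of_PF (T - S2) ?_ ?_ ?_)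
      · rw [show ((T - S2, 0) : LogSeries) = (T, ![0, X0]) - (S2, ![0, X0]) by simp, map_sub,
          h.pf_two.1, hF.pf_two.1, sub_zero]
      · rw [show ((T - S2, 0) : LogSeries) = (T, ![0, X0]) - (S2, ![0, X0]) by simp, map_sub,
          h.pf_two.2, hF.pf_two.2, sub_zero]
      · rw [map_sub, h.const_two, hF.const_two, sub_self]
  · rintro ⟨rfl, rfl, rfl⟩
    exact hF

/-- `exp A` for a power series `A` without constant term. -/
def expSeries (A : Series) : Series := PowerSeries.subst A (PowerSeries.exp ℂ)

lemma constantCoeff_expSeries (A : Series) (hA : MvPowerSeries.constantCoeff A = 0) :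
    MvPowerSeries.constantCoeff (expSeries A) = 1 := by
  rw [expSeries, PowerSeries.constantCoeff_subst (PowerSeries.HasSubst.of_constantCoeff_zero hA),
    finsum_eq_single _ 0]
  · simp
  · intro n hn
    simp [hA, hn]

/-- The flat coordinates `q_E = exp (X₁ / X₀) = z₁ exp (S₁ / X₀)` and
`q_B = exp (X₂ / X₀) = z₂ exp (S₂ / X₀)` as power series in `z₁, z₂`. -/
def flatCoord : Fin 2 → Series :=
  ![MvPowerSeries.X 0 * expSeries (S1 * X0⁻¹), MvPowerSeries.X 1 * expSeries (S2 * X0⁻¹)]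

/-- The quotients `q_E / z₁` and `q_B / z₂`. -/
def flatUnit : Fin 2 → Series := ![expSeries (S1 * X0⁻¹), expSeries (S2 * X0⁻¹)]

lemma flatCoord_eq (i : Fin 2) : flatCoord i = MvPowerSeries.X i * flatUnit i := by
  fin_cases i <;> rfl

lemma constantCoeff_flatUnit (i : Fin 2) : MvPowerSeries.constantCoeff (flatUnit i) = 1 := by
  have h := isLargeVolumeBasis_frobenius
  fin_cases i
  · exact constantCoeff_expSeries _ (by simp [h.const_one])
  · exact constantCoeff_expSeries _ (by simp [h.const_two])

/-- The coefficient of `z^d` in the monomial `q^e`. -/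
def flatMat (e d : Fin 2 →₀ ℕ) : ℂ :=
  MvPowerSeries.coeff d (e.prod fun s k => flatCoord s ^ k)

lemma flatMat_eq (e d : Fin 2 →₀ ℕ) : flatMat e d = if e ≤ d then
    MvPowerSeries.coeff (d - e) (e.prod fun s k => flatUnit s ^ k) else 0 := by
  have : (e.prod fun s k => flatCoord s ^ k)
      = MvPowerSeries.monomial e (1 : ℂ) * (e.prod fun s k => flatUnit s ^ k) := by
    simp only [flatCoord_eq, mul_pow, Finsupp.prod_mul]
    rw [MvPowerSeries.monomial_one_eq]
  rw [flatMat, this, MvPowerSeries.coeff_monomial_mul]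
  simp

lemma flatMat_self (d : Fin 2 →₀ ℕ) : flatMat d d = 1 := by
  simp [flatMat_eq, Finsupp.prod, constantCoeff_flatUnit]

lemma hasSubst_flatCoord : MvPowerSeries.HasSubst flatCoord :=
  MvPowerSeries.hasSubst_of_constantCoeff_zero fun i => by simp [flatCoord_eq]

lemma coeff_subst_flatCoord (F : Series) (d : Fin 2 →₀ ℕ) :
    MvPowerSeries.coeff d (MvPowerSeries.subst flatCoord F)
      = MvPowerSeries.coeff d F + ∑ e ∈ Finset.Iio d, MvPowerSeries.coeff e F * flatMat e d := by
  rw [MvPowerSeries.coeff_subst hasSubst_flatCoord,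
    finsum_eq_sum_of_support_subset (s := Finset.Iic d)]
  · rw [← Finset.Iio_insert, Finset.sum_insert (by simp)]
    simp only [smul_eq_mul]
    change _ * flatMat d d + _ = _
    rw [flatMat_self, mul_one]
    rfl
  · intro e he
    by_contra hne
    have hle : ¬ e ≤ d := by simpa using hne
    apply he
    change _ • flatMat e d = 0
    simp [flatMat_eq, hle]

/-- Every power series in `z₁, z₂` is in a unique way a power series in `q_E, q_B`. -/
theorem existsUnique_flatExpansion (G : Series) :
    ∃! F : Series, MvPowerSeries.subst flatCoord F = G := by
  let F : Series := (wellFounded_lt (α := Fin 2 →₀ ℕ)).fix fun d ih =>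
    MvPowerSeries.coeff d G
      - ∑ e ∈ (Finset.Iio d).attach, ih e.1 (Finset.mem_Iio.mp e.2) * flatMat e.1 d
  have hF : ∀ d, MvPowerSeries.coeff d F = MvPowerSeries.coeff d G
      - ∑ e ∈ Finset.Iio d, MvPowerSeries.coeff e F * flatMat e d := by
    intro d
    rw [← Finset.sum_attach (Finset.Iio d)]
    exact (wellFounded_lt (α := Fin 2 →₀ ℕ)).fix_eq _ d
  refine ⟨F, ?_, ?_⟩
  · ext d
    rw [coeff_subst_flatCoord, hF d]
    ring
  · intro F' hF'
    ext d
    induction d using WellFoundedLT.induction with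
    | ind d ih =>
      have h1 := coeff_subst_flatCoord F' d
      rw [hF', Finset.sum_congr rfl fun e he => by rw [ih e (Finset.mem_Iio.mp he)]] at h1
      rw [hF d, h1]
      ring

/-- The expansion in `q_E, q_B` of a power series in `z₁, z₂`. -/
def flatExpansion (G : Series) : Series := (existsUnique_flatExpansion G).choose

lemma subst_flatExpansion (G : Series) :
    MvPowerSeries.subst flatCoord (flatExpansion G) = G :=
  (existsUnique_flatExpansion G).choose_spec.1

lemma flatExpansion_unique {F G : Series} (h : MvPowerSeries.subst flatCoord F = G) :
    F = flatExpansion G :=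
  (existsUnique_flatExpansion G).choose_spec.2 F h

lemma flatExpansion_add (G H : Series) :
    flatExpansion (G + H) = flatExpansion G + flatExpansion H := by
  refine (flatExpansion_unique ?_).symm
  rw [MvPowerSeries.subst_add hasSubst_flatCoord, subst_flatExpansion, subst_flatExpansion]

lemma flatExpansion_smul (c : ℂ) (G : Series) :
    flatExpansion (c • G) = c • flatExpansion G := by
  refine (flatExpansion_unique ?_).symm
  rw [MvPowerSeries.subst_smul hasSubst_flatCoord, subst_flatExpansion]

/-- The discriminant `Δ₁ = (1 - 432 z₁)³ - 27 z₂ (432 z₁)³`. -/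
def disc1 : Poly := (1 - 432 * MvPolynomial.X 0) ^ 3
  - 27 * MvPolynomial.X 1 * (432 * MvPolynomial.X 0) ^ 3
/-- The discriminant `Δ₂ = 1 + 27 z₂`. -/
def disc2 : Poly := 1 + 27 * MvPolynomial.X 1

/-- The coordinates `z₁`, `z₂` as rational functions. -/
def z (i : Fin 2) : RatFun := algebraMap Poly RatFun (MvPolynomial.X i)

/-- The images `1/432 - z₁` and `-(432 z₁)³ z₂ / (1 - 432 z₁)³` of `z₁` and `z₂` under the involution. -/
def involutionPoint : Fin 2 → RatFun :=
  ![1 / 432 - z 0, -((432 * z 0) ^ 3 * z 1 / (1 - 432 * z 0) ^ 3)]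

lemma one_sub_ne_zero : (1 - 432 * MvPolynomial.X 0 : Poly) ≠ 0 := by
  intro h
  have := congrArg MvPolynomial.constantCoeff h
  simp at this

lemma algebraMap_432 : algebraMap Poly RatFun 432 = 432 := by
  exact_mod_cast map_natCast (algebraMap Poly RatFun) 432

lemma involution_injective : Function.Injective
    (MvPolynomial.aeval involutionPoint : Poly →ₐ[ℂ] RatFun) := by
  let s : Poly := MvPolynomial.X 0 * (1 - 432 * MvPolynomial.X 0)
  have hs : s ≠ 0 := mul_ne_zero (MvPolynomial.X_ne_zero _) one_sub_ne_zero
  have key : ∀ P : Poly, ∃ (N : ℕ) (Q : Poly),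
      algebraMap Poly RatFun Q
        = algebraMap Poly RatFun ((1 - 432 * MvPolynomial.X 0) ^ N)
          * MvPolynomial.aeval involutionPoint P
      ∧ ∀ a b : ℂ, 1 - 432 * a ≠ 0 → MvPolynomial.eval ![a, b] Q
        = (1 - 432 * a) ^ N * MvPolynomial.eval
          ![1 / 432 - a, -((432 * a) ^ 3 * b / (1 - 432 * a) ^ 3)] P := by
    intro P
    induction P using MvPolynomial.induction_on with
    | C c => exact ⟨0, MvPolynomial.C c, by simp [MvPolynomial.algebraMap_eq,
        IsScalarTower.algebraMap_apply ℂ Poly RatFun], by simp⟩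
    | add P Q hP hQ =>
      obtain ⟨N, P', h1, h2⟩ := hP
      obtain ⟨M, Q', h3, h4⟩ := hQ
      refine ⟨N + M, (1 - 432 * MvPolynomial.X 0) ^ M * P'
        + (1 - 432 * MvPolynomial.X 0) ^ N * Q', ?_, ?_⟩
      · rw [map_add, map_mul, map_mul, h1, h3, pow_add, map_mul, map_add]
        ring
      · intro a b hab
        simp only [map_add, map_mul, map_pow, h2 a b hab, h4 a b hab]
        simp
        ring
    | mul_X P i hP =>
      obtain ⟨N, P', h1, h2⟩ := hP
      fin_cases i
      · refine ⟨N, P' * (MvPolynomial.C (1 / 432) - MvPolynomial.X 0), ?_, ?_⟩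
        · have : algebraMap Poly RatFun (MvPolynomial.C (1 / 432)) = 1 / 432 := by
            rw [← MvPolynomial.algebraMap_eq, ← IsScalarTower.algebraMap_apply ℂ Poly RatFun,
              map_div₀, map_one]
            congr 1
            exact_mod_cast map_natCast (algebraMap ℂ RatFun) 432
          rw [map_mul, map_mul, map_sub, this, h1]
          simp [involutionPoint, z]
          ring
        · intro a b hab
          simp only [map_mul, h2 a b hab]
          simp
          ring
      · refine ⟨N + 3, P' * (-((432 * MvPolynomial.X 0) ^ 3 * MvPolynomial.X 1)), ?_, ?_⟩
        · have h0 : (1 - 432 * z 0 : RatFun) ≠ 0 := by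
            have := (map_ne_zero_iff _ (IsFractionRing.injective Poly RatFun)).mpr one_sub_ne_zero
            simpa [z, algebraMap_432] using this
          rw [map_mul, map_mul, h1]
          have e1 : MvPolynomial.aeval involutionPoint (MvPolynomial.X 1 : Poly)
            = -((432 * z 0) ^ 3 * z 1 / (1 - 432 * z 0) ^ 3) := by simp [involutionPoint]
          have e2 : algebraMap Poly RatFun (-((432 * MvPolynomial.X 0) ^ 3 * MvPolynomial.X 1))
            = -((432 * z 0) ^ 3 * z 1) := by simp [z, algebraMap_432]
          have e3 : ∀ k : ℕ, algebraMap Poly RatFun ((1 - 432 * MvPolynomial.X 0) ^ k)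
            = (1 - 432 * z 0) ^ k := by intro k; simp [z, algebraMap_432]
          have e4 : (1 - 432 * z 0) ^ 3
              * -((432 * z 0) ^ 3 * z 1 / (1 - 432 * z 0) ^ 3) = -((432 * z 0) ^ 3 * z 1) := by
            rw [mul_neg, mul_div_cancel₀ _ (pow_ne_zero 3 h0)]
          change _ * algebraMap Poly RatFun (-((432 * MvPolynomial.X 0) ^ 3 * MvPolynomial.X 1))
            = _ * (_ * MvPolynomial.aeval involutionPoint (MvPolynomial.X 1 : Poly))
          rw [e1, e2, e3, e3, pow_add, ← e4]
          ring
        · intro a b hab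
          simp only [map_mul, h2 a b hab]
          have e5 : (1 - 432 * a) ^ 3
              * -((432 * a) ^ 3 * b / (1 - 432 * a) ^ 3) = -((432 * a) ^ 3 * b) := by
            rw [mul_neg, mul_div_cancel₀ _ (pow_ne_zero 3 hab)]
          simp
          rw [pow_add]
          linear_combination (((1 - 432 * a) ^ N * MvPolynomial.eval
            ![432⁻¹ - a, -((432 * a) ^ 3 * b / (1 - 432 * a) ^ 3)] P)) * e5
  rw [injective_iff_map_eq_zero]
  intro P hP
  obtain ⟨N, Q, h1, h2⟩ := key P
  have hQ : Q = 0 := by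
    rw [hP, mul_zero] at h1
    exact (map_eq_zero_iff _ (IsFractionRing.injective Poly RatFun)).mp h1
  have hPs : P * s = 0 := by
    refine MvPolynomial.funext fun x => ?_
    by_cases hx : x 0 = 0 ∨ 1 - 432 * x 0 = 0
    · rcases hx with hx | hx <;> simp [s, hx]
    · push Not at hx
      have hx1 : 432 * x 0 ≠ 0 := mul_ne_zero (by norm_num) hx.1
      have h3 := h2 (1 / 432 - x 0) (-((432 * x 0) ^ 3 * x 1 / (1 - 432 * x 0) ^ 3))
        (by rw [show 1 - 432 * (1 / 432 - x 0) = 432 * x 0 by ring]; exact hx1)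
      rw [hQ, show 1 - 432 * (1 / 432 - x 0) = 432 * x 0 by ring,
        show 432 * (1 / 432 - x 0) = 1 - 432 * x 0 by ring,
        show 1 / 432 - (1 / 432 - x 0) = x 0 by ring] at h3
      have h4 : -((1 - 432 * x 0) ^ 3 * -((432 * x 0) ^ 3 * x 1 / (1 - 432 * x 0) ^ 3)
          / (432 * x 0) ^ 3) = x 1 := by
        have h6 := hx.2
        have h7 := hx.1
        rw [mul_neg, mul_div_cancel₀ _ (pow_ne_zero 3 h6), neg_div, neg_neg,
          mul_div_cancel_left₀ _ (pow_ne_zero 3 hx1)]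
      rw [h4, map_zero, eq_comm, mul_eq_zero] at h3
      have h5 : MvPolynomial.eval ![x 0, x 1] P = 0 :=
        h3.resolve_left (pow_ne_zero _ hx1)
      have h6 : ![x 0, x 1] = x := by ext i; fin_cases i <;> rfl
      rw [h6] at h5
      simp [h5]
  exact (mul_eq_zero.mp hPs).resolve_right hs

/-- The involution `f ↦ f̃` on rational functions, i.e. the substitution
`z₁ ↦ 1/432 - z₁`, `z₂ ↦ -(432 z₁)³ z₂ / (1 - 432 z₁)³`. -/
def involution : RatFun →ₐ[ℂ] RatFun := IsFractionRing.liftAlgHom involution_injective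

lemma involution_z0 : involution (z 0) = 1 / 432 - z 0 := by
  simp [involution, z, IsFractionRing.liftAlgHom_apply, involutionPoint]

lemma involution_z1 :
    involution (z 1) = -((432 * z 0) ^ 3 * z 1 / (1 - 432 * z 0) ^ 3) := by
  simp [involution, z, IsFractionRing.liftAlgHom_apply, involutionPoint]

/-- The linear map `p ↦ p(z₁) z₂^n / (Δ₁ Δ₂)^(2g-2)`. The truncated subtraction is correct for `g ≥ 1`. -/
def ambiguity (g n : ℕ) : Polynomial ℂ →ₗ[ℂ] RatFun :=
  LinearMap.mulRight ℂ (z 1 ^ n / algebraMap Poly RatFun (disc1 * disc2) ^ (2 * g - 2))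
    ∘ₗ (Polynomial.aeval (z 0)).toLinearMap

lemma ambiguity_apply (g n : ℕ) (p : Polynomial ℂ) : ambiguity g n p
    = Polynomial.aeval (z 0) p * z 1 ^ n
      / algebraMap Poly RatFun (disc1 * disc2) ^ (2 * g - 2) := by
  simp [ambiguity, mul_div_assoc]

/-- The `p(z₁) z₂^n / (Δ₁ Δ₂)^(2g-2)` with `p` a polynomial of degree at most `m`. -/
def V0 (g m n : ℕ) : Submodule ℂ RatFun := (Polynomial.degreeLE ℂ m).map (ambiguity g n)
/-- The `p(z₁) z₂^n / (Δ₁ Δ₂)^(2g-2)` with `p` an arbitrary polynomial. -/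
def V0Top (g n : ℕ) : Submodule ℂ RatFun := LinearMap.range (ambiguity g n)
/-- The `f` such that `f` and `f̃` both lie in `V0 g m n`. -/
def V1 (g m n : ℕ) : Submodule ℂ RatFun := V0 g m n ⊓ (V0 g m n).comap involution.toLinearMap
/-- The `f` in `V1 g m n` with `f̃ = (-1)^(g-1) f`. -/
def V2 (g m n : ℕ) : Submodule ℂ RatFun :=
  V1 g m n ⊓ LinearMap.eqLocus involution.toLinearMap ((-1 : ℂ) ^ (g - 1) • LinearMap.id)

lemma mem_V2 {g m n : ℕ} {f : RatFun} :
    f ∈ V2 g m n ↔ f ∈ V0 g m n ∧ involution f ∈ V0 g m n ∧ involution f = (-1) ^ (g - 1) * f := by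
  simp only [V2, V1, Submodule.mem_inf, Submodule.mem_comap, LinearMap.mem_eqLocus,
    AlgHom.toLinearMap_apply, LinearMap.smul_apply, LinearMap.id_apply, and_assoc]
  simp only [Algebra.smul_def, map_pow, map_neg, map_one]

/-- The Taylor expansion at `z₁ = z₂ = 0` of a rational function that is regular there.
See `taylor_div` for arbitrary numerators and denominators. -/
def taylor (f : RatFun) : Series :=
  (IsFractionRing.num Poly f : Series) * ((IsFractionRing.den Poly f : Poly) : Series)⁻¹

lemma taylor_div (P Q : Poly) (hQ : MvPolynomial.constantCoeff Q ≠ 0) :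
    taylor (algebraMap Poly RatFun P / algebraMap Poly RatFun Q)
      = (P : Series) * (Q : Series)⁻¹ := by
  set f := algebraMap Poly RatFun P / algebraMap Poly RatFun Q with hf
  have hQ0 : Q ≠ 0 := by rintro rfl; simp at hQ
  have hinj := IsFractionRing.injective Poly RatFun
  have hd0 : (IsFractionRing.den Poly f : Poly) ≠ 0 :=
    nonZeroDivisors.ne_zero (IsFractionRing.den Poly f).2
  have h := IsFractionRing.mk'_num_den' Poly f
  have hmul : IsFractionRing.num Poly f * Q = P * (IsFractionRing.den Poly f : Poly) := by
    apply hinj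
    rw [map_mul, map_mul]
    rw [← div_eq_div_iff ((map_ne_zero_iff _ hinj).mpr hd0) ((map_ne_zero_iff _ hinj).mpr hQ0), h]
  have hdvd : (IsFractionRing.den Poly f : Poly) ∣ Q :=
    (IsFractionRing.num_den_reduced Poly f).symm.dvd_of_dvd_mul_left
      (hmul ▸ Dvd.intro_left P rfl)
  have hdc : MvPolynomial.constantCoeff (IsFractionRing.den Poly f : Poly) ≠ 0 := by
    obtain ⟨R, hR⟩ := hdvd
    intro h0
    apply hQ
    rw [hR, map_mul, h0, zero_mul]
  have hc : ∀ R : Poly, MvPowerSeries.constantCoeff (R : Series)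
      = MvPolynomial.constantCoeff R := by
    intro R
    rw [← MvPowerSeries.coeff_zero_eq_constantCoeff_apply, MvPolynomial.coeff_coe,
      MvPolynomial.constantCoeff_eq]
  have hmul' : (IsFractionRing.num Poly f : Series) * (Q : Series)
      = (P : Series) * ((IsFractionRing.den Poly f : Poly) : Series) := by
    rw [← MvPolynomial.coe_mul, ← MvPolynomial.coe_mul, hmul]
  rw [taylor, MvPowerSeries.eq_mul_inv_iff_mul_eq (by rwa [hc]), mul_right_comm, hmul',
    mul_assoc, MvPowerSeries.mul_inv_cancel _ (by rwa [hc]), mul_one]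

lemma taylor_ambiguity (g n : ℕ) (p : Polynomial ℂ) : taylor (ambiguity g n p)
    = (Polynomial.aeval (MvPolynomial.X 0 : Poly) p * MvPolynomial.X 1 ^ n : Poly)
      * (((disc1 * disc2) ^ (2 * g - 2) : Poly) : Series)⁻¹ := by
  have h : algebraMap Poly RatFun
      (Polynomial.aeval (MvPolynomial.X 0 : Poly) p * MvPolynomial.X 1 ^ n)
      = Polynomial.aeval (z 0) p * z 1 ^ n := by
    rw [map_mul, map_pow, ← Polynomial.aeval_algebraMap_apply]
    rfl
  rw [ambiguity_apply, ← taylor_div _ _ (by simp [disc1, disc2]), h, map_pow]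

/-- The coefficient of `q_B^k`, a power series in `q_E`, of a power series `G` in `z₁, z₂`. -/
def baseCoeff (G : Series) (k : ℕ) : PowerSeries ℂ := PowerSeries.mk fun i =>
  MvPowerSeries.coeff (Finsupp.single 0 i + Finsupp.single 1 k) (flatExpansion G)

lemma baseCoeff_add (G H : Series) (k : ℕ) :
    baseCoeff (G + H) k = baseCoeff G k + baseCoeff H k := by
  ext i; simp [baseCoeff, flatExpansion_add]

lemma baseCoeff_smul (c : ℂ) (G : Series) (k : ℕ) :
    baseCoeff (c • G) k = c • baseCoeff G k := by
  ext i; simp [baseCoeff, flatExpansion_smul]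

open scoped PowerSeries.WithPiTopology in
/-- `∏_{m ≥ 1} (1 - q^m)`, so that `η^24 = q * eulerProduct ^ 24`. -/
def eulerProduct : PowerSeries ℂ := ∏' m : ℕ, (1 - PowerSeries.X ^ (m + 1))

/-- The coefficient `p_k(q_E)` in the base degree expansion
`X₀^(2g-2) f = ∑_k p_k(q_E) (q_E / η(q_E)^24)^(3k/2) q_B^k`. Here
`(q / η^24)^(3k/2) = ∏_{m ≥ 1} (1 - q^m)^(-36k)`. -/
def fibreCoeff (g : ℕ) (f : RatFun) (k : ℕ) : PowerSeries ℂ :=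
  baseCoeff (X0 ^ (2 * g - 2) * taylor f) k * eulerProduct ^ (36 * k)

lemma fibreCoeff_add (g n k : ℕ) {f h : RatFun} (hf : f ∈ V0Top g n) (hh : h ∈ V0Top g n) :
    fibreCoeff g (f + h) k = fibreCoeff g f k + fibreCoeff g h k := by
  obtain ⟨p, rfl⟩ := hf
  obtain ⟨q, rfl⟩ := hh
  rw [← map_add]
  simp only [fibreCoeff, taylor_ambiguity]
  simp only [map_add, add_mul, MvPolynomial.coe_add, mul_add, baseCoeff_add]

lemma fibreCoeff_smul (g n k : ℕ) (c : ℂ) {f : RatFun} (hf : f ∈ V0Top g n) :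
    fibreCoeff g (c • f) k = c • fibreCoeff g f k := by
  obtain ⟨p, rfl⟩ := hf
  rw [← map_smul]
  simp only [fibreCoeff, taylor_ambiguity]
  simp only [map_smul, smul_mul_assoc, MvPolynomial.coe_smul, mul_smul_comm, baseCoeff_smul]

/-- The power series `P(q)` is the `q`-expansion of a modular form of weight `w` for `SL(2, ℤ)`
(holomorphic on the upper half plane and at the cusp). -/
def IsLevelOneForm (w : ℤ) (P : PowerSeries ℂ) : Prop :=
  ∃ M : ModularForm 𝒮ℒ w, UpperHalfPlane.qExpansion 1 M = P

/-- The `f = p(z₁) z₂^n / (Δ₁ Δ₂)^(2g-2)` whose leading coefficient `p_n(q_E)` is a modular form of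
weight `18n + 2g - 2` for `SL(2, ℤ)`. -/
def W0 (g n : ℕ) : Submodule ℂ RatFun where
  carrier := {f | f ∈ V0Top g n ∧ IsLevelOneForm (18 * (n : ℤ) + 2 * (g : ℤ) - 2) (fibreCoeff g f n)}
  zero_mem' := by
    refine ⟨zero_mem _, 0, ?_⟩
    have h := fibreCoeff_smul g n n 0 (zero_mem (V0Top g n))
    rw [zero_smul, zero_smul] at h
    rw [h]
    exact UpperHalfPlane.qExpansion_zero 1
  add_mem' := by
    rintro f h ⟨hf, M, hM⟩ ⟨hh, N, hN⟩
    refine ⟨add_mem hf hh, M + N, ?_⟩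
    rw [fibreCoeff_add g n n hf hh, ← hM, ← hN]
    exact ModularForm.qExpansion_add one_pos one_mem_strictPeriods_SL M N
  smul_mem' := by
    rintro c f ⟨hf, M, hM⟩
    refine ⟨Submodule.smul_mem _ c hf, c • M, ?_⟩
    rw [fibreCoeff_smul g n n c hf, ← hM]
    exact ModularForm.qExpansion_smul one_pos one_mem_strictPeriods_SL c M

open scoped PowerSeries.WithPiTopology in
lemma constantCoeff_eulerProduct : PowerSeries.constantCoeff eulerProduct = 1 := by
  simp [eulerProduct, (PowerSeries.WithPiTopology.multipliable_one_sub_X_pow ℂ).map_tprod _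
    (PowerSeries.WithPiTopology.continuous_constantCoeff ℂ)]

/-- The expansion of `f` starts in base degree `n`. -/
lemma fibreCoeff_of_lt {g n k : ℕ} {f : RatFun} (hf : f ∈ V0Top g n) (hk : k < n) :
    fibreCoeff g f k = 0 := by
  obtain ⟨p, rfl⟩ := hf
  have hG : ∀ d : Fin 2 →₀ ℕ, d 1 < n →
      MvPowerSeries.coeff d (X0 ^ (2 * g - 2) * taylor (ambiguity g n p)) = 0 := by
    refine MvPowerSeries.X_pow_dvd_iff.mp ?_
    rw [taylor_ambiguity, MvPolynomial.coe_mul, MvPolynomial.coe_pow, MvPolynomial.coe_X]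
    exact ((Dvd.intro_left _ rfl).mul_right _).mul_left _
  have hF : ∀ d : Fin 2 →₀ ℕ, d 1 < n → MvPowerSeries.coeff d
      (flatExpansion (X0 ^ (2 * g - 2) * taylor (ambiguity g n p))) = 0 := by
    intro d
    induction d using WellFoundedLT.induction with
    | ind d ih =>
      intro hd
      have h := coeff_subst_flatCoord
        (flatExpansion (X0 ^ (2 * g - 2) * taylor (ambiguity g n p))) d
      rw [subst_flatExpansion, hG d hd, Finset.sum_eq_zero, add_zero] at h
      · exact h.symm
      · intro e he
        have he' := Finset.mem_Iio.mp he
        rw [ih e he' ((he'.le 1).trans_lt hd), zero_mul]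
  have hb : baseCoeff (X0 ^ (2 * g - 2) * taylor (ambiguity g n p)) k = 0 := by
    ext i
    simp [baseCoeff, hF (Finsupp.single 0 i + Finsupp.single 1 k) (by simpa using hk)]
  rw [fibreCoeff, hb, zero_mul]

/-- For `f ≠ 0` the coefficient in base degree `n` does not vanish. -/
lemma fibreCoeff_ne_zero {g n : ℕ} {f : RatFun} (hf : f ∈ V0Top g n) (hf0 : f ≠ 0) :
    fibreCoeff g f n ≠ 0 := by
  intro h0
  have hlt : ∀ k ≤ n, baseCoeff (X0 ^ (2 * g - 2) * taylor f) k = 0 := by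
    intro k hk
    have : fibreCoeff g f k = 0 := by
      rcases hk.lt_or_eq with hk | rfl
      · exact fibreCoeff_of_lt hf hk
      · exact h0
    refine (mul_eq_zero.mp this).resolve_right (pow_ne_zero _ ?_)
    intro h
    have := constantCoeff_eulerProduct
    simp [h] at this
  obtain ⟨p, rfl⟩ := hf
  have hF : ∀ d : Fin 2 →₀ ℕ, d 1 ≤ n → MvPowerSeries.coeff d
      (flatExpansion (X0 ^ (2 * g - 2) * taylor (ambiguity g n p))) = 0 := by
    intro d hd
    have h := congrArg (PowerSeries.coeff (d 0)) (hlt (d 1) hd)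
    have hd' : Finsupp.single 0 (d 0) + Finsupp.single 1 (d 1) = d := by
      ext i; fin_cases i <;> simp
    simpa [baseCoeff, hd'] using h
  have hG : (MvPowerSeries.X 1 : Series) ^ (n + 1)
      ∣ X0 ^ (2 * g - 2) * taylor (ambiguity g n p) := by
    rw [MvPowerSeries.X_pow_dvd_iff]
    intro d hd
    rw [← subst_flatExpansion (X0 ^ (2 * g - 2) * taylor (ambiguity g n p)),
      coeff_subst_flatCoord, hF d (by lia), Finset.sum_eq_zero, add_zero]
    intro e he
    rw [hF e (((Finset.mem_Iio.mp he).le 1).trans (by lia)), zero_mul]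
  have hX : (MvPowerSeries.X 1 : Series) ≠ 0 := by
    intro h
    have := congrArg (MvPowerSeries.coeff (Finsupp.single 1 1)) h
    simp [MvPowerSeries.coeff_X] at this
  have hdvd : (MvPowerSeries.X 1 : Series)
      ∣ ((Polynomial.aeval (MvPolynomial.X 0 : Poly) p : Poly) : Series) := by
    rw [taylor_ambiguity, MvPolynomial.coe_mul, MvPolynomial.coe_pow, MvPolynomial.coe_X,
      show ∀ a b c d : Series, a * (b * c * d) = c * (a * d * b) by intros; ring, pow_succ,
      mul_dvd_mul_iff_left (pow_ne_zero _ hX)] at hG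
    refine (IsUnit.dvd_mul_left ?_).mp hG
    have hc : ∀ R : Poly, MvPowerSeries.constantCoeff (R : Series)
        = MvPolynomial.constantCoeff R := by
      intro R
      rw [← MvPowerSeries.coeff_zero_eq_constantCoeff_apply, MvPolynomial.coeff_coe,
        MvPolynomial.constantCoeff_eq]
    rw [MvPowerSeries.isUnit_iff_constantCoeff, map_mul, map_pow,
      isLargeVolumeBasis_frobenius.const_zero, MvPowerSeries.constantCoeff_inv, hc]
    simp [disc1, disc2]
  apply hf0
  have hp : p = 0 := by
    ext i
    have h := MvPowerSeries.X_dvd_iff.mp hdvd (Finsupp.single 0 i) (by simp)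
    rw [MvPolynomial.coeff_coe, Polynomial.aeval_eq_sum_range, MvPolynomial.coeff_sum] at h
    simp only [MvPolynomial.coeff_smul, MvPolynomial.coeff_X_pow, smul_eq_mul] at h
    by_cases hi : i ≤ p.natDegree
    · rw [Finset.sum_eq_single i] at h
      · simpa using h
      · intro b _ hb
        have : Finsupp.single (0 : Fin 2) b ≠ Finsupp.single 0 i := by
          intro hh; exact hb (Finsupp.single_injective _ hh)
        simp [this]
      · intro hh; exact absurd (Finset.mem_range.mpr (by lia)) hh
    · rw [Polynomial.coeff_eq_zero_of_natDegree_lt (by lia)]; simp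
  rw [hp, map_zero]

end

end X18

/-! The coefficient of q_B^n only sees the restriction to z₂ = 0, and there the Picard-Fuchs system
becomes the hypergeometric equation of the elliptic fibre, which is solved by modular forms. Put a =
E₄^(1/4) (`rootE4`) and define t (`mirrorZ`) by E₆ = a⁶(1 - 864t). Then E₄³ - E₆² = 1728Δ reads Δ =
a¹² t(1 - 432t), and Ramanujan's differential equations show that a, as a function of t, solves the
fibre equation. Hence X₀ restricts to a at z₁ = t (`compMirror_period`). Wronskian identities then
give q_E = q and (q_B/z₂)(1 - 432t)³a¹⁸ = ∏(1 - q^m)³⁶ (`mirrorUnit_mul`,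
`compMirror_flatUnit_one`), so that p_n = a^(18n+2g-2) p(t) (1 - 432t)^(3n-3(2g-2))
(`fibreCoeff_ambiguity`).

On the other side, the level one forms of weight 2k are exactly the a^(2k) Q(t) with 3 deg Q ≤ k and
Q(1/432 - t) = (-1)^k Q(t) (`isLevelOneForm_iff`); the reflection changes the sign of 1 - 864t, that
is, of E₆. For k = 9n + g - 1 and Q = p (1 - 432t)^(3n-6(g-1)) the degree condition becomes deg p ≤
19(g-1)/3. The symmetry becomes f̃ = (-1)^(g-1) f, since the involution exchanges the two
discriminants up to explicit factors (`exists_modularPolynomial_iff`, `involution_disc`,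
`involution_ambiguity_iff`). This is the equality of the two spaces.

If n ≤ 2g-2, each Q comes from the polynomial p = Q (1 - 432t)^(6(g-1)-3n), so all forms of the
weight occur. If n > 2g-2, put K = 3(n-2g+2): exactly those Q occur that are divisible by (1 -
432t)^K. By symmetry they are divisible by t^K as well, so p_n is Δ^K times a form of weight 74(g-1)
- 18n, and that form is arbitrary. -/

namespace X18

noncomputable section

open Filter Topology Complex UpperHalfPlane

/-! ### Taylor coefficients at the cusp and the product formula for Δ. -/

/-- The Taylor series at `0` of a function of one complex variable. -/
def taylorAtZero (f : ℂ → ℂ) : PowerSeries ℂ :=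
  PowerSeries.mk fun m => (m.factorial : ℂ)⁻¹ * iteratedDeriv m f 0

lemma taylorAtZero_congr {f h : ℂ → ℂ} (hfh : f =ᶠ[𝓝 0] h) :
    taylorAtZero f = taylorAtZero h := by
  ext m
  simp [taylorAtZero, hfh.iteratedDeriv_eq m]

lemma taylorAtZero_mul {f h : ℂ → ℂ} (hf : AnalyticAt ℂ f 0) (hh : AnalyticAt ℂ h 0) :
    taylorAtZero (f * h) = taylorAtZero f * taylorAtZero h := by
  ext m
  simp only [taylorAtZero, PowerSeries.coeff_mk, PowerSeries.coeff_mul,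
    iteratedDeriv_mul hf.contDiffAt hh.contDiffAt, Finset.mul_sum,
    Finset.Nat.sum_antidiagonal_eq_sum_range_succ_mk]
  refine Finset.sum_congr rfl fun i hi => ?_
  have hi' : i ≤ m := by simpa [Nat.lt_succ_iff] using hi
  rw [Nat.cast_choose ℂ hi']
  have h1 : (m.factorial : ℂ) ≠ 0 := by exact_mod_cast m.factorial_ne_zero
  field_simp

lemma taylorAtZero_const (c : ℂ) : taylorAtZero (fun _ => c) = PowerSeries.C c := by
  ext m
  rcases m with _ | m <;> simp [taylorAtZero, iteratedDeriv_const, PowerSeries.coeff_C]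

lemma taylorAtZero_id : taylorAtZero (fun q => q) = PowerSeries.X := by
  ext m
  rcases m with _ | _ | m
  · simp [taylorAtZero]
  · simp [taylorAtZero, iteratedDeriv_one]
  · have h : deriv (fun q : ℂ => q) = fun _ => 1 := by ext; simp
    simp [taylorAtZero, PowerSeries.coeff_X, iteratedDeriv_succ', h, iteratedDeriv_const]

lemma taylorAtZero_pow {f : ℂ → ℂ} (hf : AnalyticAt ℂ f 0) (k : ℕ) :
    taylorAtZero (f ^ k) = taylorAtZero f ^ k := by
  induction k with
  | zero => simpa using! taylorAtZero_const 1
  | succ k ih => rw [pow_succ, taylorAtZero_mul (hf.pow k) hf, ih, pow_succ]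

lemma taylorAtZero_one_sub_pow (n : ℕ) :
    taylorAtZero (fun q => 1 - q ^ (n + 1)) = 1 - PowerSeries.X ^ (n + 1) := by
  have h1 : taylorAtZero (fun q : ℂ => q ^ (n + 1)) = PowerSeries.X ^ (n + 1) := by
    rw [← taylorAtZero_id]; exact taylorAtZero_pow analyticAt_id _
  have h2 : taylorAtZero (fun _ : ℂ => (1 : ℂ)) = 1 := by simpa using taylorAtZero_const 1
  rw [← h1, ← h2]
  ext m
  have a1 : AnalyticAt ℂ (fun _ : ℂ => (1 : ℂ)) 0 := analyticAt_const
  have a2 : AnalyticAt ℂ (fun q : ℂ => q ^ (n + 1)) 0 := analyticAt_id.pow _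
  simp only [taylorAtZero, PowerSeries.coeff_mk, map_sub]
  rw [← mul_sub]
  congr 1
  exact iteratedDeriv_sub a1.contDiffAt a2.contDiffAt

lemma taylorAtZero_prod {ι : Type*} (s : Finset ι) (f : ι → ℂ → ℂ)
    (hf : ∀ i ∈ s, AnalyticAt ℂ (f i) 0) :
    taylorAtZero (fun q => ∏ i ∈ s, f i q) = ∏ i ∈ s, taylorAtZero (f i) := by
  classical
  induction s using Finset.induction_on with
  | empty => simpa using taylorAtZero_const 1
  | insert i s hi ih =>
    have h : (fun q => ∏ j ∈ insert i s, f j q) = f i * fun q => ∏ j ∈ s, f j q := by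
      ext q; simp [Finset.prod_insert hi]
    have hs : ∀ j ∈ s, AnalyticAt ℂ (f j) 0 := fun j hj => hf j (Finset.mem_insert_of_mem hj)
    rw [h, taylorAtZero_mul (hf i (Finset.mem_insert_self _ _)) (Finset.analyticAt_fun_prod _ hs),
      ih hs, Finset.prod_insert hi]

/-- Locally uniform convergence of holomorphic functions on an open disc passes to the derivatives,
which carries the induction on m. -/
lemma tendsto_iteratedDeriv_zero {ι : Type*} {l : Filter ι} {F : ι → ℂ → ℂ} {f : ℂ → ℂ}
    (h : TendstoLocallyUniformlyOn F f l (Metric.ball 0 1))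
    (hF : ∀ i, DifferentiableOn ℂ (F i) (Metric.ball 0 1)) (m : ℕ) :
    Tendsto (fun i => iteratedDeriv m (F i) 0) l (𝓝 (iteratedDeriv m f 0)) := by
  induction m generalizing F f with
  | zero => simpa using h.tendsto_at (Metric.mem_ball_self one_pos)
  | succ m ih =>
    simp only [iteratedDeriv_succ']
    exact ih (h.deriv (Eventually.of_forall hF) Metric.isOpen_ball)
      fun i => (hF i).deriv Metric.isOpen_ball

-- The Taylor coefficients of the finite products converge to those of the formal product by
-- definition of its topology, and to those of the analytic product by locally uniform convergence.
-- Limits in ℂ are unique.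
open scoped PowerSeries.WithPiTopology in
lemma taylorAtZero_tprod :
    taylorAtZero (fun q => ∏' n : ℕ, (1 - q ^ (n + 1))) = eulerProduct := by
  have h1 := ModularForm.multipliableLocallyUniformlyOn_one_sub_pow.hasProdLocallyUniformlyOn
  have h2 : HasProd (fun m : ℕ => (1 - PowerSeries.X ^ (m + 1) : PowerSeries ℂ)) eulerProduct :=
    (PowerSeries.WithPiTopology.multipliable_one_sub_X_pow ℂ).hasProd
  rw [HasProd, PowerSeries.WithPiTopology.tendsto_iff_coeff_tendsto] at h2
  ext m
  have h3 := (tendsto_iteratedDeriv_zero h1 (fun s => by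
    exact DifferentiableOn.fun_finsetProd fun _ _ => by fun_prop) m).const_mul
      (m.factorial : ℂ)⁻¹
  have h4 := h2 m
  simp only [taylorAtZero, PowerSeries.coeff_mk]
  refine tendsto_nhds_unique h3 (h4.congr fun s => ?_)
  have h5 := congrArg (PowerSeries.coeff m)
    (taylorAtZero_prod s (fun (n : ℕ) (q : ℂ) => 1 - q ^ (n + 1)) fun i _ => by fun_prop)
  simp only [taylorAtZero_one_sub_pow] at h5
  rw [← h5]
  simp [taylorAtZero]

/-- The `q`-expansion of the discriminant is `q ∏ (1 - q^m)^24`. -/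
lemma qExpansion_discriminant :
    qExpansion 1 ModularForm.discriminant = PowerSeries.X * eulerProduct ^ 24 := by
  have h0 : qExpansion 1 ModularForm.discriminant
      = taylorAtZero (cuspFunction 1 ModularForm.discriminant) := rfl
  have ha : AnalyticAt ℂ (fun q : ℂ => ∏' n : ℕ, (1 - q ^ (n + 1))) 0 :=
    ModularForm.differentiableOn_tprod_one_sub_pow.analyticAt
      (Metric.ball_mem_nhds 0 one_pos)
  have h1 : cuspFunction 1 ModularForm.discriminant =ᶠ[𝓝 0]
      (fun q : ℂ => q) * (fun q : ℂ => ∏' n : ℕ, (1 - q ^ (n + 1))) ^ 24 := by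
    filter_upwards [Metric.ball_mem_nhds (0 : ℂ) one_pos] with q hq
    rw [ModularForm.discriminant_cuspFunction_eqOn hq]
    simp only [Pi.mul_apply, Pi.pow_apply]
    rw [(ModularForm.multipliable_one_sub_pow (by simpa using hq)).tprod_pow]
  rw [h0, taylorAtZero_congr h1, taylorAtZero_mul (show AnalyticAt ℂ (fun q : ℂ => q) 0 from analyticAt_id) (ha.pow 24), taylorAtZero_id,
    taylorAtZero_pow ha, taylorAtZero_tprod]

end

end X18

/-! ### Calculus of q-expansions and of level one forms. -/

namespace X18

noncomputable section

open Filter Topology UpperHalfPlane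
open scoped Manifold ModularForm

/-- The logarithmic derivative `q d/dq` on power series in one variable. -/
def logDer : Derivation ℂ (PowerSeries ℂ) (PowerSeries ℂ) :=
  (PowerSeries.X : PowerSeries ℂ) • PowerSeries.derivative ℂ

lemma logDer_apply (P : PowerSeries ℂ) :
    logDer P = PowerSeries.X * PowerSeries.derivative ℂ P := rfl

lemma coeff_logDer (P : PowerSeries ℂ) (m : ℕ) :
    PowerSeries.coeff m (logDer P) = m * PowerSeries.coeff m P := by
  rcases m with _ | m
  · simp [logDer_apply]
  · rw [logDer_apply, PowerSeries.coeff_succ_X_mul, PowerSeries.coeff_derivative]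
    push_cast
    ring

/-- `f` is holomorphic on the upper half plane and is given by the power series `P` in
`q = exp (2πiτ)`. -/
structure HasQExpansion (f : ℍ → ℂ) (P : PowerSeries ℂ) : Prop where
  holo : MDiff f
  hasSum : ∀ τ : ℍ, HasSum (fun m : ℕ => PowerSeries.coeff m P
    • Function.Periodic.qParam (1 : ℝ) τ ^ m) (f τ)

namespace HasQExpansion

variable {f h : ℍ → ℂ} {P Q : PowerSeries ℂ}

lemma bounded (hf : HasQExpansion f P) : IsBoundedAtImInfty f :=
  isBoundedAtImInfty_of_hasSum_qExpansion one_pos hf.hasSum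

lemma periodic (hf : HasQExpansion f P) : Function.Periodic (f ∘ ofComplex) (1 : ℝ) := by
  intro w
  by_cases! hw : 0 < w.im
  · have hw' : 0 < (w + (1 : ℝ)).im := by simpa using hw
    simp only [Function.comp_apply, ofComplex_apply_of_im_pos hw', ofComplex_apply_of_im_pos hw]
    have h1 := hf.hasSum ⟨w + (1 : ℝ), hw'⟩
    have h2 := hf.hasSum ⟨w, hw⟩
    have h3 : Function.Periodic.qParam (1 : ℝ) (w + (1 : ℝ)) = Function.Periodic.qParam (1 : ℝ) w := by
      simp [Function.Periodic.qParam, mul_add, Complex.exp_add]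
    simp only [h3] at h1
    exact h1.unique h2
  -- Off the upper half plane `ofComplex` takes a single default value.
  · have : (w + (1 : ℝ)).im ≤ 0 := by simpa using hw
    exact congrArg f (ofComplex_apply_eq_of_im_nonpos this hw)

lemma analyticAt (hf : HasQExpansion f P) : AnalyticAt ℂ (cuspFunction 1 f) 0 :=
  analyticAt_cuspFunction_zero one_pos hf.periodic hf.holo hf.bounded

/-- Uniqueness of the power series of the cusp function at q = 0. -/
lemma qExpansion_eq (hf : HasQExpansion f P) : qExpansion 1 f = P := by
  ext m
  have h1 := (hasFPowerSeriesOnBall_cuspFunction one_pos hf.analyticAt hf.hasSum).hasFPowerSeriesAt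
  have h2 := h1.eq_formalMultilinearSeries hf.analyticAt.hasFPowerSeriesAt
  have h3 := congrArg (FormalMultilinearSeries.coeff · m) h2
  simp only [FormalMultilinearSeries.coeff_ofScalars] at h3
  rw [qExpansion_coeff, h3, div_eq_inv_mul]

lemma of_bounded (h1 : Function.Periodic (f ∘ ofComplex) (1 : ℝ)) (h2 : MDiff f)
    (h3 : IsBoundedAtImInfty f) : HasQExpansion f (qExpansion 1 f) :=
  ⟨h2, hasSum_qExpansion one_pos h1 h2 h3⟩

lemma of_modularForm {k : ℤ} (M : ModularForm 𝒮ℒ k) : HasQExpansion M (qExpansion 1 M) :=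
  have : Fact (IsCusp OnePoint.infty 𝒮ℒ) :=
    ⟨Subgroup.isCusp_of_mem_strictPeriods one_pos one_mem_strictPeriods_SL⟩
  of_bounded (SlashInvariantFormClass.periodic_comp_ofComplex M one_mem_strictPeriods_SL)
    (ModularFormClass.holo M) (ModularFormClass.bdd_at_infty M)

lemma add (hf : HasQExpansion f P) (hh : HasQExpansion h Q) : HasQExpansion (f + h) (P + Q) :=
  ⟨hf.holo.add hh.holo, fun τ => by
    simpa [add_mul] using (hf.hasSum τ).add (hh.hasSum τ)⟩

lemma smul (c : ℂ) (hf : HasQExpansion f P) : HasQExpansion (c • f) (c • P) :=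
  ⟨hf.holo.const_smul c, fun τ => by
    simpa [mul_assoc] using (hf.hasSum τ).mul_left c⟩

/-- The product is periodic, holomorphic and bounded, so it has some expansion; multiplicativity of
`qExpansion` identifies it, with no Cauchy product of sums. -/
lemma mul (hf : HasQExpansion f P) (hh : HasQExpansion h Q) : HasQExpansion (f * h) (P * Q) := by
  have h1 := of_bounded (f := f * h) (hf.periodic.mul hh.periodic) (hf.holo.mul hh.holo)
    (hf.bounded.mul hh.bounded)
  rwa [qExpansion_mul hf.analyticAt hh.analyticAt, hf.qExpansion_eq, hh.qExpansion_eq] at h1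

/-- By the chain rule (2πi)⁻¹ d/dτ acts on f = F(q) as q F'(q), where F is the cusp function; the
expansion follows from the Taylor series of F' on the unit disc. -/
lemma normalizedDeriv (hf : HasQExpansion f P) :
    HasQExpansion (Derivative.normalizedDerivOfComplex f) (logDer P) := by
  refine ⟨Derivative.normalizedDerivOfComplex_mdifferentiable hf.holo, fun τ => ?_⟩
  set q := Function.Periodic.qParam (1 : ℝ) τ with hq
  have hq1 : q ∈ Metric.ball (0 : ℂ) 1 := by
    simpa using Function.Periodic.norm_qParam_lt_one (h := 1) one_pos τ.im_pos
  have hd := differentiableOn_cuspFunction_ball one_pos hf.periodic hf.holo hf.bounded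
  have hval : Derivative.normalizedDerivOfComplex f τ = q * deriv (cuspFunction 1 f) q := by
    have h1 : f ∘ ofComplex =ᶠ[𝓝 (τ : ℂ)]
        fun w => cuspFunction 1 f (Function.Periodic.qParam (1 : ℝ) w) := by
      filter_upwards [isOpen_upperHalfPlaneSet.mem_nhds τ.im_pos] with w hw
      have := eq_cuspFunction (f := f) ⟨w, hw⟩ one_ne_zero hf.periodic
      simp only [Function.comp_apply, ofComplex_apply_of_im_pos hw]
      exact this.symm
    have h2 : HasDerivAt (Function.Periodic.qParam (1 : ℝ)) (2 * Real.pi * Complex.I * q) τ := by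
      have h3 : HasDerivAt (fun w : ℂ => 2 * Real.pi * Complex.I * w / (1 : ℝ))
          (2 * Real.pi * Complex.I * 1 / (1 : ℝ)) τ :=
        ((hasDerivAt_id (τ : ℂ)).const_mul _).div_const _
      have h4 := h3.cexp
      convert! h4 using 1
      simp [hq, Function.Periodic.qParam]
      ring
    have h5 : HasDerivAt (cuspFunction 1 f) (deriv (cuspFunction 1 f) q)
        (Function.Periodic.qParam (1 : ℝ) τ) :=
      (hd.differentiableAt (Metric.isOpen_ball.mem_nhds hq1)).hasDerivAt
    rw [Derivative.normalizedDerivOfComplex, h1.deriv_eq]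
    have h6 := (h5.comp (τ : ℂ) h2).deriv
    rw [Function.comp_def] at h6
    rw [h6]
    have : (2 * Real.pi * Complex.I : ℂ) ≠ 0 := Complex.two_pi_I_ne_zero
    field_simp
  have hs := Complex.hasSum_taylorSeries_on_ball (hd.deriv Metric.isOpen_ball) hq1
  -- The term of index 0 vanishes, so the series is shifted by one to match q · F'(q).
  rw [hval, ← hasSum_nat_add_iff' 1]
  convert! hs.mul_left q using 1
  · ext m
    rw [coeff_logDer, ← hf.qExpansion_eq, qExpansion_coeff, iteratedDeriv_succ']
    have h1 : (m.factorial : ℂ) ≠ 0 := by exact_mod_cast m.factorial_ne_zero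
    have h2 : ((m : ℂ) + 1) ≠ 0 := by exact_mod_cast m.succ_ne_zero
    simp only [Nat.factorial_succ, sub_zero, smul_eq_mul]
    push_cast
    field_simp
    ring
  · simp [coeff_logDer]

/-- Every cusp is a translate of ∞ under SL(2, ℤ), so invariance turns boundedness at ∞ into
boundedness at all cusps. -/
lemma isLevelOneForm {k : ℤ} (hf : HasQExpansion f P) (hk : ∀ γ : SL(2, ℤ), f ∣[k] γ = f) :
    IsLevelOneForm k P :=
  ⟨{ toFun := f
     slash_action_eq' := fun _ ⟨γ, hγ⟩ => hγ ▸ hk γ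
     holo' := hf.holo
     bdd_at_cusps' := fun {c} hc => by
        rw [Subgroup.IsArithmetic.isCusp_iff_isCusp_SL2Z] at hc
        rw [OnePoint.isBoundedAt_iff_forall_SL2Z hc]
        intro γ _
        rw [hk γ]
        exact hf.bounded }, hf.qExpansion_eq⟩

end HasQExpansion

namespace IsLevelOneForm

variable {v w : ℤ} {P Q : PowerSeries ℂ}

lemma add (hP : IsLevelOneForm w P) (hQ : IsLevelOneForm w Q) : IsLevelOneForm w (P + Q) := by
  obtain ⟨M, rfl⟩ := hP
  obtain ⟨N, rfl⟩ := hQ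
  exact ⟨M + N, ModularForm.qExpansion_add one_pos one_mem_strictPeriods_SL M N⟩

lemma smul (c : ℂ) (hP : IsLevelOneForm w P) : IsLevelOneForm w (c • P) := by
  obtain ⟨M, rfl⟩ := hP
  exact ⟨c • M, ModularForm.qExpansion_smul one_pos one_mem_strictPeriods_SL c M⟩

lemma zero (w : ℤ) : IsLevelOneForm w 0 := ⟨0, qExpansion_zero 1⟩

lemma one : IsLevelOneForm 0 1 := ⟨1, ModularForm.qExpansion_one⟩

lemma mul (hP : IsLevelOneForm v P) (hQ : IsLevelOneForm w Q) :
    IsLevelOneForm (v + w) (P * Q) := by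
  obtain ⟨M, rfl⟩ := hP
  obtain ⟨N, rfl⟩ := hQ
  exact ⟨M.mul N, ModularForm.qExpansion_mul one_pos one_mem_strictPeriods_SL M N⟩

lemma pow (hP : IsLevelOneForm w P) (n : ℕ) : IsLevelOneForm (n * w) (P ^ n) := by
  induction n with
  | zero => simpa using one
  | succ n ih =>
    rw [pow_succ, show ((n + 1 : ℕ) : ℤ) * w = n * w + w by push_cast; ring]
    exact ih.mul hP

/-- Below weight `12` there are no cusp forms. -/
lemma eq_zero_of_lt_twelve (hP : IsLevelOneForm w P) (hw : w < 12)
    (h0 : PowerSeries.constantCoeff P = 0) : P = 0 := by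
  obtain ⟨M, rfl⟩ := hP
  have hM : M = 0 := by
    refine ModularForm.sturm_bound_levelOne ?_
    -- The Sturm bound is the integer part of w/12, here 0, so a zero constant term is enough.
    rw [Nat.div_eq_of_lt (by lia)]
    simpa [pos_iff_ne_zero, PowerSeries.order_ne_zero_iff_constCoeff_eq_zero] using h0
  rw [hM]
  exact qExpansion_zero 1

lemma eq_zero_of_neg (hP : IsLevelOneForm w P) (hw : w < 0) : P = 0 := by
  obtain ⟨M, rfl⟩ := hP
  rw [ModularFormClass.levelOne_neg_weight_eq_zero hw M]
  exact qExpansion_zero 1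

end IsLevelOneForm

end

end X18

/-! ### Eisenstein series and Ramanujan's differential equations. -/

namespace X18

noncomputable section

open Filter Topology UpperHalfPlane
open scoped Manifold ModularForm

/-- The `q`-expansion of the quasimodular Eisenstein series `E₂`. -/
def e2 : PowerSeries ℂ :=
  PowerSeries.mk fun m => if m = 0 then 1 else -24 * (ArithmeticFunction.sigma 1 m : ℂ)
/-- The `q`-expansion of the Eisenstein series `E₄`. -/
def e4 : PowerSeries ℂ := qExpansion 1 ModularForm.E₄
/-- The `q`-expansion of the Eisenstein series `E₆`. -/
def e6 : PowerSeries ℂ := qExpansion 1 ModularForm.E₆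
/-- The `q`-expansion `q ∏ (1 - q^m)^24` of the discriminant. -/
def discExp : PowerSeries ℂ := PowerSeries.X * eulerProduct ^ 24

lemma constantCoeff_e2 : PowerSeries.constantCoeff e2 = 1 := by
  rw [← PowerSeries.coeff_zero_eq_constantCoeff_apply]; simp [e2]

lemma constantCoeff_e4 : PowerSeries.constantCoeff e4 = 1 := by
  rw [← PowerSeries.coeff_zero_eq_constantCoeff_apply]
  exact EisensteinSeries.E_qExpansion_coeff_zero _ ⟨2, rfl⟩

lemma constantCoeff_e6 : PowerSeries.constantCoeff e6 = 1 := by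
  rw [← PowerSeries.coeff_zero_eq_constantCoeff_apply]
  exact EisensteinSeries.E_qExpansion_coeff_zero _ ⟨3, rfl⟩

lemma constantCoeff_logDer (P : PowerSeries ℂ) : PowerSeries.constantCoeff (logDer P) = 0 := by
  simp [logDer_apply]

lemma hasQExpansion_E2 : HasQExpansion EisensteinSeries.E2 e2 :=
  ⟨E2_mdifferentiable, fun τ => by
    simpa only [e2, PowerSeries.coeff_mk, Function.Periodic.qParam, Complex.ofReal_one, div_one]
      using EisensteinSeries.hasSum_qExpansion_E2 (z := τ)⟩

lemma isLevelOneForm_e4 : IsLevelOneForm 4 e4 := ⟨ModularForm.E₄, rfl⟩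

lemma isLevelOneForm_e6 : IsLevelOneForm 6 e6 := ⟨ModularForm.E₆, rfl⟩

lemma isLevelOneForm_discExp : IsLevelOneForm 12 discExp :=
  ⟨CuspForm.discriminant, qExpansion_discriminant⟩

lemma e4_pow_sub_e6_pow : e4 ^ 3 - e6 ^ 2 = 1728 * discExp := by
  have h : (⇑(ModularForm.E₄.pow 3) - ⇑(ModularForm.E₆.pow 2) : ℍ → ℂ)
      = (1728 : ℂ) • ⇑CuspForm.discriminant := by
    ext z
    have := ModularForm.discriminant_eq_E₄_cube_sub_E₆_sq z
    simp only [ModularForm.coe_pow, Pi.sub_apply, Pi.pow_apply, Pi.smul_apply,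
      CuspForm.coe_discriminant, smul_eq_mul, this]
    ring
  have h2 := congrArg (qExpansion 1) h
  rw [ModularForm.qExpansion_sub one_pos one_mem_strictPeriods_SL,
    ModularForm.qExpansion_smul one_pos one_mem_strictPeriods_SL,
    ModularForm.qExpansion_pow one_pos one_mem_strictPeriods_SL,
    ModularForm.qExpansion_pow one_pos one_mem_strictPeriods_SL,
    CuspForm.coe_discriminant, qExpansion_discriminant] at h2
  rw [e4, e6, h2, discExp, PowerSeries.smul_eq_C_mul]
  congr 1

/-- The Serre derivative of a modular form is a modular form. -/
lemma IsLevelOneForm.serreDerivative {k : ℤ} {P : PowerSeries ℂ} (hP : IsLevelOneForm k P) :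
    IsLevelOneForm (k + 2) (logDer P + (-((k : ℂ) / 12)) • (e2 * P)) := by
  obtain ⟨M, rfl⟩ := hP
  have hM := HasQExpansion.of_modularForm M
  have h := hM.normalizedDeriv.add ((hasQExpansion_E2.mul hM).smul (-((k : ℂ) / 12)))
  have he : Derivative.normalizedDerivOfComplex M + (-((k : ℂ) / 12)) • (EisensteinSeries.E2 * ⇑M)
      = Derivative.serreDerivative k M := by
    ext z
    simp
    ring
  rw [he] at h
  refine h.isLevelOneForm fun γ => Derivative.serreDerivative_slash_invariant hM.holo ?_
  exact M.slash_action_eq' _ ⟨γ, rfl⟩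

/-- `D E₂ - E₂² / 12` transforms like a modular form of weight `4`. -/
lemma E2_deriv_slash (γ : SL(2, ℤ)) :
    (Derivative.normalizedDerivOfComplex EisensteinSeries.E2
      + (-(1 / 12 : ℂ)) • (EisensteinSeries.E2 * EisensteinSeries.E2)) ∣[(4 : ℤ)] γ
      = Derivative.normalizedDerivOfComplex EisensteinSeries.E2
        + (-(1 / 12 : ℂ)) • (EisensteinSeries.E2 * EisensteinSeries.E2) := by
  have hI : (2 * Real.pi * Complex.I : ℂ) ≠ 0 := Complex.two_pi_I_ne_zero
  -- With μ = 1/(2πi) and c(w) = γ₁₀/(γ₁₀w + γ₁₁) one has E₂|γ = E₂ + 12μc and c' = -c². Under γ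
  -- both D E₂ and E₂²/12 acquire the same correction 2μcE₂ + 12μ²c², which cancels in the
  -- difference.
  set μ : ℂ := (2 * Real.pi * Complex.I)⁻¹ with hμ
  let g : GL (Fin 2) ℝ := (γ : GL (Fin 2) ℝ)
  let c : ℂ → ℂ := fun w => (γ 1 0 : ℂ) * denom g w ^ (-1 : ℤ)
  have hE : EisensteinSeries.E2 ∣[(2 : ℤ)] γ
      = fun z : ℍ => EisensteinSeries.E2 z + 12 * μ * c z := by
    ext z
    rw [EisensteinSeries.E2_slash_action]
    simp only [Pi.sub_apply, Pi.smul_apply, EisensteinSeries.D2, riemannZeta_two, smul_eq_mul, c]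
    have hpi : (Real.pi : ℂ) ≠ 0 := by exact_mod_cast Real.pi_ne_zero
    have hd : denom g z ≠ 0 := denom_ne_zero g z
    rw [hμ, sub_eq_add_neg]
    congr 1
    have hI2 := Complex.I_sq
    have hI0 := Complex.I_ne_zero
    rw [zpow_neg_one]
    change -(1 / (2 * ((Real.pi : ℂ) ^ 2 / 6)) * (2 * Real.pi * Complex.I * (γ 1 0) / denom g z)) = _
    field_simp
    linear_combination (-12 * (γ 1 0 : ℂ)) * hI2
  have hc : ∀ z : ℍ, HasDerivAt c (-(c z) ^ 2) z := by
    intro z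
    have h := (hasDerivAt_denom_zpow g (-1) z).const_mul (γ 1 0 : ℂ)
    convert! h using 1
    have hd : denom g z ≠ 0 := denom_ne_zero g z
    have hg : ((g 1 0 : ℝ) : ℂ) = γ 1 0 := by simp [g]
    rw [hg]
    simp only [c]
    rw [show (-1 - 1 : ℤ) = -1 + -1 by norm_num, zpow_add₀ hd]
    push_cast
    ring
  have hD : ∀ z : ℍ, Derivative.normalizedDerivOfComplex (EisensteinSeries.E2 ∣[(2 : ℤ)] γ) z
      = Derivative.normalizedDerivOfComplex EisensteinSeries.E2 z - 12 * μ ^ 2 * c z ^ 2 := by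
    intro z
    have h1 : (EisensteinSeries.E2 ∣[(2 : ℤ)] γ) ∘ ofComplex =ᶠ[𝓝 (z : ℂ)]
        fun w => (EisensteinSeries.E2 ∘ ofComplex) w + 12 * μ * c w := by
      filter_upwards [isOpen_upperHalfPlaneSet.mem_nhds z.im_pos] with w hw
      rw [hE]
      simp [ofComplex_apply_of_im_pos hw]
    have h2 := (mdifferentiableAt_iff.mp (E2_mdifferentiable z)).hasDerivAt
    rw [Derivative.normalizedDerivOfComplex, h1.deriv_eq, (h2.fun_add ((hc z).const_mul _)).deriv,
      Derivative.normalizedDerivOfComplex, ← hμ]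
    ring
  ext z
  have h1 := congrFun (Derivative.normalizedDerivOfComplex_SL_slash (k := 2) E2_mdifferentiable
    (γ := γ)) z
  rw [hD z] at h1
  have h2 := congrFun (ModularForm.mul_slash_SL2 2 2 γ EisensteinSeries.E2 EisensteinSeries.E2) z
  have h3 := congrFun hE z
  have h4 : (γ 1 0 : ℂ) / denom (γ : GL (Fin 2) ℝ) z = c z := by
    simp only [c, g, zpow_neg_one, div_eq_mul_inv]
  rw [SlashAction.add_slash, ModularForm.SL_smul_slash]
  simp only [Pi.add_apply, Pi.sub_apply, Pi.smul_apply, Pi.mul_apply, smul_eq_mul] at h1 h2 ⊢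
  rw [show ((2 : ℤ) + 2) = 4 by norm_num] at h1 h2
  rw [h2]
  rw [h3] at h1 ⊢
  change _ = _ - ((2 : ℤ) : ℂ) * (2 * Real.pi * Complex.I)⁻¹
    * ((γ 1 0 : ℂ) / denom (γ : GL (Fin 2) ℝ) z) * _ at h1
  rw [h4, ← hμ] at h1
  push_cast at h1
  linear_combination -h1

/-- Ramanujan's differential equation for `E₂`. -/
lemma logDer_e2 : 12 * logDer e2 = e2 ^ 2 - e4 := by
  have h1 : IsLevelOneForm 4 (logDer e2 + (-(1 / 12 : ℂ)) • (e2 * e2)) :=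
    (hasQExpansion_E2.normalizedDeriv.add
      ((hasQExpansion_E2.mul hasQExpansion_E2).smul _)).isLevelOneForm E2_deriv_slash
  -- The constant term -1/12 is cancelled by E₄/12, and weight 4 has no cusp forms.
  have h2 := (h1.add (isLevelOneForm_e4.smul (1 / 12))).eq_zero_of_lt_twelve (by norm_num) (by
    simp [constantCoeff_logDer, constantCoeff_e2, constantCoeff_e4])
  have h3 : (12 : ℂ) • (logDer e2 + (-(1 / 12 : ℂ)) • (e2 * e2) + (1 / 12 : ℂ) • e4) = 0 := by
    rw [h2, smul_zero]
  simp only [smul_add, smul_smul] at h3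
  norm_num at h3
  have h4 : (12 : ℂ) • logDer e2 = 12 * logDer e2 := by
    rw [PowerSeries.smul_eq_C_mul]; congr 1
  rw [h4] at h3
  linear_combination h3

/-- Ramanujan's differential equation for `E₄`. -/
lemma logDer_e4 : 3 * logDer e4 = e2 * e4 - e6 := by
  -- The Serre derivative of E₄ has weight 6 and constant term -4/12, cancelled by E₆/3.
  have h2 := (isLevelOneForm_e4.serreDerivative.add
    (isLevelOneForm_e6.smul (1 / 3))).eq_zero_of_lt_twelve (by norm_num) (by
    simp [constantCoeff_logDer, constantCoeff_e2, constantCoeff_e4, constantCoeff_e6]; norm_num)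
  have h3 := congrArg ((3 : ℂ) • ·) h2
  simp only [smul_add, smul_smul] at h3
  norm_num at h3
  have h4 : (3 : ℂ) • logDer e4 = 3 * logDer e4 := by
    rw [PowerSeries.smul_eq_C_mul]; congr 1
  rw [h4] at h3
  linear_combination h3

/-- Ramanujan's differential equation for `E₆`. -/
lemma logDer_e6 : 2 * logDer e6 = e2 * e6 - e4 ^ 2 := by
  -- The Serre derivative of E₆ has weight 8 and constant term -6/12, cancelled by E₄²/2.
  have h2 := (isLevelOneForm_e6.serreDerivative.add
    ((isLevelOneForm_e4.mul isLevelOneForm_e4).smul (1 / 2))).eq_zero_of_lt_twelve (by norm_num) (by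
    simp [constantCoeff_logDer, constantCoeff_e2, constantCoeff_e4, constantCoeff_e6]; norm_num)
  have h3 := congrArg ((2 : ℂ) • ·) h2
  simp only [smul_add, smul_smul] at h3
  norm_num at h3
  have h4 : (2 : ℂ) • logDer e6 = 2 * logDer e6 := by
    rw [PowerSeries.smul_eq_C_mul]; congr 1
  rw [h4] at h3
  linear_combination h3

end

end X18

/-! ### Differential equations for power series, and the modular parametrization (a, t) of the
fibre. -/

namespace X18

noncomputable section

lemma logDer_mul (P Q : PowerSeries ℂ) : logDer (P * Q) = P * logDer Q + Q * logDer P := by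
  simp [Derivation.leibniz]

lemma logDer_pow (P : PowerSeries ℂ) (n : ℕ) :
    logDer (P ^ (n + 1)) = (n + 1) * P ^ n * logDer P := by
  simp [Derivation.leibniz_pow, mul_assoc]

@[simp] lemma logDer_ofNat (n : ℕ) [n.AtLeastTwo] :
    logDer (OfNat.ofNat n : PowerSeries ℂ) = 0 := by
  have h := logDer.map_natCast (OfNat.ofNat n)
  rwa [Nat.cast_ofNat] at h

lemma powerSeries_ofNat_ne_zero (n : ℕ) [n.AtLeastTwo] :
    (OfNat.ofNat n : PowerSeries ℂ) ≠ 0 := by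
  intro h
  have := congrArg PowerSeries.constantCoeff h
  rw [map_ofNat, map_zero] at this
  exact OfNat.ofNat_ne_zero n this

lemma logDer_X : logDer (PowerSeries.X : PowerSeries ℂ) = PowerSeries.X := by
  simp [logDer_apply]

/-- For inductions in which the lower coefficients of s are already known to vanish: only the
constant term of the other factor then matters. -/
lemma coeff_mul_of_coeff_lt_eq_zero {s : PowerSeries ℂ} {n : ℕ}
    (hs : ∀ m < n, PowerSeries.coeff m s = 0) (u : PowerSeries ℂ) :
    PowerSeries.coeff n (u * s) = PowerSeries.constantCoeff u * PowerSeries.coeff n s := by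
  rw [PowerSeries.coeff_mul, Finset.sum_eq_single (0, n)]
  · simp
  · rintro ⟨i, j⟩ hij hne
    have hij' : i + j = n := by simpa using hij
    dsimp only
    rw [hs j, mul_zero]
    rcases Nat.eq_zero_or_pos i with rfl | hi
    · exact absurd (by simp [← hij']) hne
    · lia
  · simp

/-- A solution of a first order equation without singular part vanishes if its constant term
does. -/
lemma eq_zero_of_logDer_eq_mul {s w : PowerSeries ℂ} (h : logDer s = w * s)
    (hw : PowerSeries.constantCoeff w = 0) (hs : PowerSeries.constantCoeff s = 0) : s = 0 := by
  ext n
  induction n using Nat.strong_induction_on with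
  | _ n ih =>
    rcases Nat.eq_zero_or_pos n with rfl | hn
    · simpa using hs
    · have h1 := congrArg (PowerSeries.coeff n) h
      rw [coeff_logDer, coeff_mul_of_coeff_lt_eq_zero fun m hm => by simpa using ih m hm, hw,
        zero_mul] at h1
      simpa [hn.ne'] using h1

lemma eq_of_logDer_eq_mul {s r w : PowerSeries ℂ} (hs : logDer s = w * s) (hr : logDer r = w * r)
    (hw : PowerSeries.constantCoeff w = 0)
    (h0 : PowerSeries.constantCoeff s = PowerSeries.constantCoeff r) : s = r := by
  refine sub_eq_zero.mp (eq_zero_of_logDer_eq_mul (w := w) ?_ hw ?_)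
  · rw [map_sub, hs, hr]; ring
  · rw [map_sub, h0, sub_self]

lemma eq_one_of_logDer_eq_zero {s : PowerSeries ℂ} (hs : logDer s = 0)
    (h0 : PowerSeries.constantCoeff s = 1) : s = 1 :=
  eq_of_logDer_eq_mul (w := 0) (by simpa using hs) (by simp) (by simp) (by simpa using h0)

/-- Frobenius uniqueness at a double exponent 0: once the lower coefficients vanish, the coefficient
of q^n gives n² s_n = 0. -/
lemma eq_zero_of_logDer_logDer {s u r : PowerSeries ℂ} (h : logDer (u * logDer s) = r * s)
    (hu : PowerSeries.constantCoeff u = 1) (hr : PowerSeries.constantCoeff r = 0)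
    (hs : PowerSeries.constantCoeff s = 0) : s = 0 := by
  ext n
  induction n using Nat.strong_induction_on with
  | _ n ih =>
    rcases Nat.eq_zero_or_pos n with rfl | hn
    · simpa using hs
    · have h1 := congrArg (PowerSeries.coeff n) h
      rw [coeff_logDer, coeff_mul_of_coeff_lt_eq_zero fun m hm => by rw [coeff_logDer, ih m hm]; simp,
        coeff_mul_of_coeff_lt_eq_zero fun m hm => by simpa using ih m hm,
        hr, hu, zero_mul, coeff_logDer] at h1
      simpa [hn.ne'] using h1

/-- The binomial series (1 + X)^(1/4) is evaluated at X = P - 1. -/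
lemma exists_fourth_root {P : PowerSeries ℂ} (hP : PowerSeries.constantCoeff P = 1) :
    ∃ A : PowerSeries ℂ, A ^ 4 = P ∧ PowerSeries.constantCoeff A = 1 := by
  have hs : PowerSeries.HasSubst (P - 1) :=
    PowerSeries.HasSubst.of_constantCoeff_zero' (by simp [hP])
  let σ : PowerSeries ℂ →ₐ[ℂ] PowerSeries ℂ := PowerSeries.substAlgHom hs
  have h4 : (PowerSeries.binomialSeries ℂ (1 / 4 : ℚ)) ^ 4 = 1 + PowerSeries.X := by
    have := PowerSeries.binomialSeries_nat (R := ℚ) (A := ℂ) 1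
    rw [pow_one] at this
    rw [← this, show ((1 : ℕ) : ℚ) = 1 / 4 + 1 / 4 + 1 / 4 + 1 / 4 by norm_num]
    simp only [PowerSeries.binomialSeries_add]
    ring
  have hX : σ PowerSeries.X = P - 1 := PowerSeries.substAlgHom_X hs
  have hA4 : (σ (PowerSeries.binomialSeries ℂ (1 / 4 : ℚ))) ^ 4 = P := by
    rw [← map_pow, h4, map_add, map_one, hX]
    ring
  refine ⟨_, hA4, ?_⟩
  change PowerSeries.constantCoeff (PowerSeries.substAlgHom hs _ : PowerSeries ℂ) = 1
  have h1 : PowerSeries.constantCoeff (σ (PowerSeries.binomialSeries ℂ (1 / 4 : ℚ)) - 1) = 0 := by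
    rw [← map_one σ, ← map_sub]
    change PowerSeries.constantCoeff (PowerSeries.substAlgHom hs _ : PowerSeries ℂ) = 0
    rw [PowerSeries.coe_substAlgHom]
    exact PowerSeries.constantCoeff_subst_eq_zero (by simpa using! (by simp [hP] :
      PowerSeries.constantCoeff (P - 1) = 0)) _ (by simp)
  rw [map_sub, map_one, sub_eq_zero] at h1
  exact h1

/-- The fourth root of `E₄` with constant term `1`. -/
def rootE4 : PowerSeries ℂ := (exists_fourth_root constantCoeff_e4).choose

lemma rootE4_pow : rootE4 ^ 4 = e4 := (exists_fourth_root constantCoeff_e4).choose_spec.1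

lemma constantCoeff_rootE4 : PowerSeries.constantCoeff rootE4 = 1 :=
  (exists_fourth_root constantCoeff_e4).choose_spec.2

lemma rootE4_mul_inv : rootE4 * rootE4⁻¹ = 1 :=
  PowerSeries.mul_inv_cancel _ (by rw [constantCoeff_rootE4]; exact one_ne_zero)

lemma rootE4_ne_zero : rootE4 ≠ 0 := by
  intro h
  have := constantCoeff_rootE4
  simp [h] at this

/-- The restriction to `z₂ = 0` of the inverse mirror map: `z₁` as a power series in `q_E`. -/
def mirrorZ : PowerSeries ℂ := (1 / 864 : ℂ) • (1 - e6 * rootE4⁻¹ ^ 6)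

lemma mirrorZ_smul : 864 * mirrorZ = 1 - e6 * rootE4⁻¹ ^ 6 := by
  have : (864 : ℂ) • mirrorZ = 864 * mirrorZ := by
    rw [PowerSeries.smul_eq_C_mul]; congr 1
  rw [← this, mirrorZ, smul_smul]
  norm_num

lemma constantCoeff_mirrorZ : PowerSeries.constantCoeff mirrorZ = 0 := by
  simp [mirrorZ, constantCoeff_e6, constantCoeff_rootE4]

lemma e6_eq : e6 = rootE4 ^ 6 * (1 - 864 * mirrorZ) := by
  have h : rootE4 ^ 6 * rootE4⁻¹ ^ 6 = 1 := by rw [← mul_pow, rootE4_mul_inv, one_pow]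
  rw [mirrorZ_smul]
  linear_combination (-e6) * h

/-- This is 1 - (1 - 864t)² = 1728 t(1 - 432t), inserted in E₄³ - E₆² = 1728Δ. -/
lemma discExp_eq : discExp = rootE4 ^ 12 * (mirrorZ * (1 - 432 * mirrorZ)) := by
  have h := e4_pow_sub_e6_pow
  rw [e6_eq, ← rootE4_pow] at h
  have h0 := powerSeries_ofNat_ne_zero 1728
  refine mul_left_cancel₀ h0 ?_
  linear_combination -h

/-- Ramanujan's equation for E₄ = a⁴, divided by a³. -/
lemma logDer_rootE4 :
    12 * logDer rootE4 = rootE4 * (e2 - rootE4 ^ 2 * (1 - 864 * mirrorZ)) := by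
  have h := logDer_e4
  rw [← rootE4_pow, e6_eq, logDer_pow] at h
  refine mul_left_cancel₀ (pow_ne_zero 3 rootE4_ne_zero) ?_
  push_cast at h
  linear_combination h

/-- Ramanujan's equation for E₆ = a⁶(1 - 864t), with D a eliminated. E₂ drops out because t has
weight 0. -/
lemma logDer_mirrorZ :
    logDer mirrorZ = mirrorZ * ((1 - 432 * mirrorZ) * rootE4 ^ 2) := by
  have h := logDer_e6
  rw [e6_eq, logDer_mul, logDer_pow, map_sub, logDer_mul, Derivation.map_one_eq_zero,
    logDer_ofNat, ← rootE4_pow] at h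
  have h0 := powerSeries_ofNat_ne_zero 1728
  refine mul_left_cancel₀ (mul_ne_zero h0 (pow_ne_zero 6 rootE4_ne_zero)) ?_
  push_cast at h
  linear_combination -h + rootE4 ^ 5 * (1 - 864 * mirrorZ) * logDer_rootE4

lemma logDer_rootE4_inv : logDer rootE4⁻¹ = -(rootE4⁻¹ ^ 2 * logDer rootE4) := by
  have h := congrArg logDer rootE4_mul_inv
  rw [logDer_mul, Derivation.map_one_eq_zero] at h
  have h1 := rootE4_mul_inv
  linear_combination rootE4⁻¹ * h - logDer rootE4⁻¹ * h1

/-- `E₄^(1/4)` satisfies the Picard-Fuchs equation of the elliptic fibre. -/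
lemma logDer_logDer_rootE4 : logDer (rootE4⁻¹ ^ 2 * logDer rootE4)
    = 60 * mirrorZ * ((1 - 432 * mirrorZ) * rootE4 ^ 2) * rootE4 := by
  set a := rootE4
  set i := rootE4⁻¹
  set t := mirrorZ
  have hai : a * i = 1 := rootE4_mul_inv
  -- This expresses a⁻² D a through E₂. Differentiating it and inserting Ramanujan's equation for E₂
  -- leaves no E₂ behind.
  have hu : 12 * (i ^ 2 * logDer a) = i * e2 - a * (1 - 864 * t) := by
    have h := logDer_rootE4
    linear_combination i ^ 2 * h + (i * e2 - (a * i + 1) * a * (1 - 864 * t)) * hai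
  have h1 := congrArg logDer hu
  have h2 : logDer i = -(i ^ 2 * logDer a) := logDer_rootE4_inv
  have h3 := logDer_e2
  have h4 := logDer_mirrorZ
  have h5 := logDer_rootE4
  simp only [logDer_mul 12, logDer_mul i e2, logDer_mul a, logDer_mul 864, map_sub,
    Derivation.map_one_eq_zero, h2] at h1
  rw [← rootE4_pow] at h3
  have h0 := powerSeries_ofNat_ne_zero 144
  refine mul_left_cancel₀ h0 ?_
  change logDer t = t * ((1 - 432 * t) * a ^ 2) at h4
  change 12 * logDer a = a * (e2 - a ^ 2 * (1 - 864 * t)) at h5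
  change 12 * logDer e2 = e2 ^ 2 - a ^ 4 at h3
  linear_combination 12 * h1 + i * h3 + 10368 * a * h4 - (1 - 864 * t) * h5 - e2 * hu
    - a ^ 3 * hai - 12 * i ^ 2 * logDer a * logDer_ofNat 12 + 12 * a * t * logDer_ofNat 864
end

end X18

/-! ### Restriction to z₂ = 0 and the substitution z₁ = t(q). -/

namespace X18

noncomputable section

lemma logDer_one_sub_mirrorZ : logDer (1 - 432 * mirrorZ)
    = -(432 * mirrorZ * ((1 - 432 * mirrorZ) * rootE4 ^ 2)) := by
  rw [map_sub, Derivation.map_one_eq_zero, logDer_mul, logDer_ofNat, logDer_mirrorZ]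
  ring

lemma exists_mirrorUnit : ∃ U : PowerSeries ℂ, mirrorZ = PowerSeries.X * U :=
  PowerSeries.X_dvd_iff.mpr constantCoeff_mirrorZ

/-- The quotient `z₁ / q_E` on `z₂ = 0`. -/
def mirrorUnit : PowerSeries ℂ := exists_mirrorUnit.choose

lemma mirrorZ_eq : mirrorZ = PowerSeries.X * mirrorUnit := exists_mirrorUnit.choose_spec

/-- Two expressions for Δ, the product and a¹² t(1 - 432t), with one factor q cancelled. -/
lemma eulerProduct_pow : eulerProduct ^ 24
    = rootE4 ^ 12 * (mirrorUnit * (1 - 432 * mirrorZ)) := by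
  have h := discExp_eq
  refine mul_left_cancel₀ PowerSeries.X_ne_zero ?_
  rw [discExp] at h
  rw [h]
  nth_rw 1 [mirrorZ_eq]
  ring

lemma constantCoeff_mirrorUnit : PowerSeries.constantCoeff mirrorUnit = 1 := by
  have h := congrArg PowerSeries.constantCoeff eulerProduct_pow
  simpa [constantCoeff_eulerProduct, constantCoeff_rootE4, constantCoeff_mirrorZ] using h.symm

lemma logDer_mirrorUnit :
    logDer mirrorUnit = ((1 - 432 * mirrorZ) * rootE4 ^ 2 - 1) * mirrorUnit := by
  have h := logDer_mirrorZ
  refine mul_left_cancel₀ PowerSeries.X_ne_zero ?_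
  nth_rw 1 2 [mirrorZ_eq] at h
  rw [logDer_mul, logDer_X] at h
  linear_combination h

lemma hasSubst_mirrorZ : PowerSeries.HasSubst mirrorZ :=
  PowerSeries.HasSubst.of_constantCoeff_zero' constantCoeff_mirrorZ

/-- Substitution of `z₁(q_E)` for `z₁`. -/
def compMirror : PowerSeries ℂ →ₐ[ℂ] PowerSeries ℂ := PowerSeries.substAlgHom hasSubst_mirrorZ

lemma compMirror_apply (P : PowerSeries ℂ) : compMirror P = PowerSeries.subst mirrorZ P := by
  rw [compMirror, PowerSeries.coe_substAlgHom]

lemma compMirror_X : compMirror PowerSeries.X = mirrorZ :=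
  PowerSeries.substAlgHom_X hasSubst_mirrorZ

lemma constantCoeff_compMirror (P : PowerSeries ℂ) :
    PowerSeries.constantCoeff (compMirror P) = PowerSeries.constantCoeff P := by
  obtain ⟨Q, hQ⟩ := PowerSeries.X_dvd_iff.mpr
    (show PowerSeries.constantCoeff (P - PowerSeries.C (PowerSeries.constantCoeff P)) = 0 by simp)
  rw [sub_eq_iff_eq_add] at hQ
  have hC : ∀ c : ℂ, compMirror (PowerSeries.C c) = PowerSeries.C c := fun c =>
    compMirror.commutes c
  conv_lhs => rw [hQ]
  rw [map_add, map_mul, compMirror_X, hC]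
  simp [constantCoeff_mirrorZ]

/-- Chain rule: q d/dq equals z₁ d/dz₁ times the logarithmic derivative of t, which is (1 - 432t)a².
-/
lemma logDer_compMirror (P : PowerSeries ℂ) :
    logDer (compMirror P) = compMirror (logDer P) * ((1 - 432 * mirrorZ) * rootE4 ^ 2) := by
  have h := logDer_mirrorZ
  rw [logDer_apply] at h
  have h1 : compMirror (logDer P)
      = mirrorZ * compMirror (PowerSeries.derivative ℂ P) := by
    rw [logDer_apply, map_mul, compMirror_X]
  rw [h1, logDer_apply, compMirror_apply, compMirror_apply,
    PowerSeries.derivative_subst hasSubst_mirrorZ]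
  linear_combination PowerSeries.subst mirrorZ (PowerSeries.derivative ℂ P) * h

/-- Since t is q times a unit, hence nonzero, a series z₁^N · Q with Q(0) ≠ 0 goes to t^N times a
unit. -/
lemma compMirror_injective : Function.Injective compMirror := by
  rw [injective_iff_map_eq_zero]
  intro P hP
  by_contra hP0
  have hX : PowerSeries.X ^ P.order.toNat ∣ P := PowerSeries.X_pow_order_dvd
  obtain ⟨Q, hQ⟩ := hX
  have hQ0 : PowerSeries.constantCoeff Q ≠ 0 := by
    have h1 := PowerSeries.coeff_order hP0
    rwa [hQ, PowerSeries.coeff_X_pow_mul', if_pos (by rw [← hQ]), ← hQ, Nat.sub_self,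
      PowerSeries.coeff_zero_eq_constantCoeff_apply] at h1
  rw [hQ, map_mul, map_pow, compMirror_X, mul_eq_zero] at hP
  rcases hP with h | h
  · have h3 : mirrorZ = 0 := eq_zero_of_pow_eq_zero h
    rw [mirrorZ_eq, mul_eq_zero, or_iff_right PowerSeries.X_ne_zero] at h3
    have h4 := constantCoeff_mirrorUnit
    simp [h3] at h4
  · apply hQ0
    rw [← constantCoeff_compMirror, h, map_zero]

lemma hasSubst_restrictBase :
    MvPowerSeries.HasSubst (![PowerSeries.X, 0] : Fin 2 → PowerSeries ℂ) :=
  MvPowerSeries.hasSubst_of_constantCoeff_zero fun i => by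
    fin_cases i
    · exact PowerSeries.constantCoeff_X
    · exact map_zero _

/-- Restriction of a power series to the second coordinate being `0`. -/
def restrictBase : Series →ₐ[ℂ] PowerSeries ℂ := MvPowerSeries.substAlgHom hasSubst_restrictBase

lemma restrictBase_apply (G : Series) : restrictBase G
    = MvPowerSeries.subst (![PowerSeries.X, 0] : Fin 2 → PowerSeries ℂ) G := by
  rw [restrictBase, MvPowerSeries.coe_substAlgHom]

lemma restrictBase_X0 : restrictBase (MvPowerSeries.X 0) = PowerSeries.X :=
  MvPowerSeries.substAlgHom_X hasSubst_restrictBase 0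

lemma restrictBase_X1 : restrictBase (MvPowerSeries.X 1) = 0 :=
  MvPowerSeries.substAlgHom_X hasSubst_restrictBase 1

lemma coeff_restrictBase (G : Series) (a : ℕ) :
    PowerSeries.coeff a (restrictBase G) = MvPowerSeries.coeff (Finsupp.single 0 a) G := by
  rw [restrictBase_apply, PowerSeries.coeff, MvPowerSeries.coeff_subst hasSubst_restrictBase,
    finsum_eq_single _ (Finsupp.single 0 a)]
  · rw [Finsupp.prod_single_index (by simp)]
    have : MvPowerSeries.coeff (Finsupp.single () a) ((PowerSeries.X : PowerSeries ℂ) ^ a) = 1 :=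
      PowerSeries.coeff_X_pow_self a
    simp [this]
  · intro d hd
    rw [Finsupp.prod_fintype _ _ (by simp), Fin.prod_univ_two]
    simp only [Matrix.cons_val_zero, Matrix.cons_val_one]
    rcases Nat.eq_zero_or_pos (d 1) with h1 | h1
    · have h0 : d 0 ≠ a := by
        intro h0
        apply hd
        ext i
        fin_cases i
        · simpa using h0
        · simpa using h1
      have : MvPowerSeries.coeff (Finsupp.single () a) ((PowerSeries.X : PowerSeries ℂ) ^ d 0)
          = 0 := by
        have h := PowerSeries.coeff_X_pow (R := ℂ) a (d 0)
        rw [if_neg (Ne.symm h0)] at h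
        exact h
      simp [h1, this]
    · simp [h1.ne']

lemma constantCoeff_restrictBase (G : Series) :
    PowerSeries.constantCoeff (restrictBase G) = MvPowerSeries.constantCoeff G := by
  rw [← PowerSeries.coeff_zero_eq_constantCoeff_apply, coeff_restrictBase]
  simp

/-- The Picard-Fuchs equation of the elliptic fibre, on `z₂ = 0`. -/
lemma restrictBase_PF1 {A : Series} {B : Fin 2 → Series} (h : PF1 (A, B) = 0) :
    (1 - 432 * PowerSeries.X) * logDer (logDer (restrictBase A))
      = 432 * PowerSeries.X * logDer (restrictBase A) + 60 * PowerSeries.X * restrictBase A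
        + 864 * PowerSeries.X * logDer (restrictBase (B 0))
        + 432 * PowerSeries.X * restrictBase (B 0)
        - 2 * logDer (restrictBase (B 0)) + 3 * logDer (restrictBase (B 1)) := by
  have hc : ∀ (n : ℕ) [n.AtLeastTwo] (P : PowerSeries ℂ) (m : ℕ),
      PowerSeries.coeff m ((OfNat.ofNat n : PowerSeries ℂ) * P)
        = OfNat.ofNat n * PowerSeries.coeff m P := by
    intro n _ P m
    have : (OfNat.ofNat n : PowerSeries ℂ) = PowerSeries.C (OfNat.ofNat n) := by
      rw [map_ofNat]
    rw [this, PowerSeries.coeff_C_mul]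
  rw [sub_mul, one_mul]
  ext a
  -- At the exponent (a, 0) the operator only involves the coefficients at (a, 0) and (a - 1, 0), so
  -- the equation closes up on z₂ = 0. The terms in B come from differentiating the logarithms.
  have h1 := PF1_apply_fst A B (Finsupp.single 0 a)
  rw [h] at h1
  rcases a with _ | a
  · simp [mul_assoc, constantCoeff_logDer]
  · have h2 : (Finsupp.single (0 : Fin 2) (a + 1) - Finsupp.single 0 1 : Fin 2 →₀ ℕ)
        = Finsupp.single 0 a := by
      rw [← Finsupp.single_tsub]; simp
    simp only [map_add, map_sub, mul_assoc, hc, PowerSeries.coeff_succ_X_mul, coeff_logDer,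
      coeff_restrictBase]
    rw [h2] at h1
    simp [-Finsupp.single_add] at h1
    push_cast
    linear_combination -h1

end

end X18

/-! ### The period and the flat coordinates on z₂ = 0. -/

namespace X18

noncomputable section

lemma constantCoeff_restrictBase_X0 : PowerSeries.constantCoeff (restrictBase X0) = 1 := by
  rw [constantCoeff_restrictBase, isLargeVolumeBasis_frobenius.const_zero]

/-- The self-adjoint form of the fibre equation, the one that can be compared with
`logDer_logDer_rootE4` after z₁ = t(q). -/
lemma logDer_logDer_period : logDer ((1 - 432 * PowerSeries.X) * logDer (restrictBase X0))
    = 60 * PowerSeries.X * restrictBase X0 := by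
  have h := restrictBase_PF1 isLargeVolumeBasis_frobenius.pf_zero.1
  simp only [Pi.zero_apply, map_zero, mul_zero, add_zero, sub_zero] at h
  rw [logDer_mul, map_sub, Derivation.map_one_eq_zero, logDer_mul, logDer_X]
  linear_combination h - logDer (restrictBase X0) * PowerSeries.X * logDer_ofNat 432

lemma compMirror_one_sub :
    compMirror (1 - 432 * PowerSeries.X) = 1 - 432 * mirrorZ := by
  rw [map_sub, map_one, map_mul, map_ofNat, compMirror_X]

/-- On `z₂ = 0` the holomorphic period is the fourth root of the Eisenstein series `E₄`. -/
lemma compMirror_period : compMirror (restrictBase X0) = rootE4 := by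
  have hA := rootE4_mul_inv
  -- After z₁ = t(q) the operator (1 - 432z₁)θ₁ becomes a⁻² D, so both series solve D(a⁻² D s) = 60
  -- t(1 - 432t)a² s; both have constant term 1.
  refine sub_eq_zero.mp (eq_zero_of_logDer_logDer (u := rootE4⁻¹ ^ 2)
    (r := 60 * mirrorZ * ((1 - 432 * mirrorZ) * rootE4 ^ 2)) ?_ ?_ ?_ ?_)
  · have h1 : rootE4⁻¹ ^ 2 * logDer (compMirror (restrictBase X0))
        = compMirror ((1 - 432 * PowerSeries.X) * logDer (restrictBase X0)) := by
      rw [logDer_compMirror, map_mul, compMirror_one_sub]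
      linear_combination compMirror (logDer (restrictBase X0)) * (1 - 432 * mirrorZ)
        * (rootE4 * rootE4⁻¹ + 1) * hA
    have h2 := logDer_logDer_rootE4
    rw [map_sub, mul_sub, map_sub, h2, h1, logDer_compMirror, logDer_logDer_period, map_mul,
      map_mul, map_ofNat, compMirror_X]
    ring
  · simp [constantCoeff_rootE4]
  · simp [constantCoeff_mirrorZ]
  · rw [map_sub, constantCoeff_compMirror, constantCoeff_restrictBase_X0, constantCoeff_rootE4,
      sub_self]

/-- The exponents of the flat coordinates. -/
def flatExponent : Fin 2 → Series := ![S1 * X0⁻¹, S2 * X0⁻¹]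

lemma constantCoeff_flatExponent (i : Fin 2) :
    MvPowerSeries.constantCoeff (flatExponent i) = 0 := by
  have h := isLargeVolumeBasis_frobenius
  fin_cases i
  · simp [flatExponent, h.const_one]
  · simp [flatExponent, h.const_two]

lemma flatUnit_eq (i : Fin 2) : flatUnit i = expSeries (flatExponent i) := by
  fin_cases i <;> rfl

lemma X0_mul_inv : X0 * X0⁻¹ = 1 :=
  MvPowerSeries.mul_inv_cancel _ (by simp [isLargeVolumeBasis_frobenius.const_zero])

lemma restrictBase_S1 : restrictBase S1 = restrictBase X0 * restrictBase (flatExponent 0) := by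
  rw [← map_mul]
  congr 1
  change S1 = X0 * (S1 * X0⁻¹)
  linear_combination -S1 * X0_mul_inv

lemma restrictBase_S2 : restrictBase S2 = restrictBase X0 * restrictBase (flatExponent 1) := by
  rw [← map_mul]
  congr 1
  change S2 = X0 * (S2 * X0⁻¹)
  linear_combination -S2 * X0_mul_inv

/-- The Wronskian of X₀ and X₁ times 1 - 432z₁ is constant, because both solve the same second order
equation; the logarithms cancel in it. The outcome is θ₁ log q_E = 1/((1 - 432z₁)X₀²). -/
lemma wronskian_one : (1 - 432 * PowerSeries.X) * restrictBase X0 ^ 2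
    * (1 + logDer (restrictBase (flatExponent 0))) = 1 := by
  have h0 := restrictBase_PF1 isLargeVolumeBasis_frobenius.pf_zero.1
  have h1 := restrictBase_PF1 isLargeVolumeBasis_frobenius.pf_one.1
  simp only [Pi.zero_apply, map_zero, mul_zero, add_zero, sub_zero, Matrix.cons_val_zero,
    Matrix.cons_val_one] at h0 h1
  have hS : logDer (restrictBase S1) = restrictBase X0 * logDer (restrictBase (flatExponent 0))
      + restrictBase (flatExponent 0) * logDer (restrictBase X0) := by
    rw [restrictBase_S1, logDer_mul]
  have key : (1 - 432 * PowerSeries.X) * (restrictBase X0 * restrictBase X0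
      + restrictBase X0 * logDer (restrictBase S1)
      - restrictBase S1 * logDer (restrictBase X0)) = 1 := by
    apply eq_one_of_logDer_eq_zero
    · have h432 := logDer_ofNat 432
      rw [logDer_mul]
      simp only [map_sub, map_add, logDer_mul, Derivation.map_one_eq_zero, logDer_X]
      linear_combination restrictBase X0 * h1 - restrictBase S1 * h0
        - PowerSeries.X * (restrictBase X0 * restrictBase X0
          + restrictBase X0 * logDer (restrictBase S1)
          - restrictBase S1 * logDer (restrictBase X0)) * h432
    · simp [constantCoeff_restrictBase, isLargeVolumeBasis_frobenius.const_zero,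
        isLargeVolumeBasis_frobenius.const_one, constantCoeff_logDer]
  rw [hS, restrictBase_S1] at key
  linear_combination key

/-- For X₂ the term -3θ₁θ₂ meets log z₂ and contributes the source 3θ₁X₀. The Wronskian times 1 -
432z₁ is therefore not constant, but it differs from 3X₀²/2 by a constant. -/
lemma wronskian_two : 2 * ((1 - 432 * PowerSeries.X) * restrictBase X0 ^ 2
    * logDer (restrictBase (flatExponent 1))) = 3 * (restrictBase X0 ^ 2 - 1) := by
  have h0 := restrictBase_PF1 isLargeVolumeBasis_frobenius.pf_zero.1
  have h1 := restrictBase_PF1 isLargeVolumeBasis_frobenius.pf_two.1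
  simp only [Pi.zero_apply, map_zero, mul_zero, add_zero, sub_zero, Matrix.cons_val_zero,
    Matrix.cons_val_one] at h0 h1
  have hS : logDer (restrictBase S2) = restrictBase X0 * logDer (restrictBase (flatExponent 1))
      + restrictBase (flatExponent 1) * logDer (restrictBase X0) := by
    rw [restrictBase_S2, logDer_mul]
  -- The conserved quantity has constant term -3; adding 4 brings it to the value 1 that
  -- `eq_one_of_logDer_eq_zero` expects.
  have key : 2 * ((1 - 432 * PowerSeries.X) * (restrictBase X0 * logDer (restrictBase S2)
      - restrictBase S2 * logDer (restrictBase X0))) - 3 * (restrictBase X0 * restrictBase X0)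
      + 4 = 1 := by
    apply eq_one_of_logDer_eq_zero
    · have h432 := logDer_ofNat 432
      simp only [map_sub, map_add, logDer_mul, Derivation.map_one_eq_zero, logDer_X]
      linear_combination 2 * restrictBase X0 * h1 - 2 * restrictBase S2 * h0
        - 2 * PowerSeries.X * (restrictBase X0 * logDer (restrictBase S2)
          - restrictBase S2 * logDer (restrictBase X0)) * h432
        + ((1 - 432 * PowerSeries.X) * (restrictBase X0 * logDer (restrictBase S2)
          - restrictBase S2 * logDer (restrictBase X0))) * logDer_ofNat 2
        - restrictBase X0 * restrictBase X0 * logDer_ofNat 3 + logDer_ofNat 4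
    · simp [constantCoeff_restrictBase, isLargeVolumeBasis_frobenius.const_zero,
        isLargeVolumeBasis_frobenius.const_two, constantCoeff_logDer]
      rw [map_ofNat, map_ofNat]
      norm_num
  rw [hS, restrictBase_S2] at key
  linear_combination key

lemma restrictBase_expSeries {A : Series} (hA : MvPowerSeries.constantCoeff A = 0) :
    restrictBase (expSeries A) = PowerSeries.subst (restrictBase A) (PowerSeries.exp ℂ) := by
  rw [restrictBase_apply, restrictBase_apply, expSeries, PowerSeries.subst, PowerSeries.subst,
    MvPowerSeries.subst_comp_subst_apply
      (PowerSeries.HasSubst.of_constantCoeff_zero hA).const hasSubst_restrictBase]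

lemma logDer_restrictBase_flatUnit (i : Fin 2) : logDer (restrictBase (flatUnit i))
    = restrictBase (flatUnit i) * logDer (restrictBase (flatExponent i)) := by
  have h0 := constantCoeff_flatExponent i
  rw [flatUnit_eq, restrictBase_expSeries h0, logDer_apply, logDer_apply,
    PowerSeries.derivative_subst, PowerSeries.derivative_exp]
  · ring
  · exact PowerSeries.HasSubst.of_constantCoeff_zero'
      (by rw [constantCoeff_restrictBase, h0])

lemma constantCoeff_compMirror_flatUnit (i : Fin 2) :
    PowerSeries.constantCoeff (compMirror (restrictBase (flatUnit i))) = 1 := by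
  rw [constantCoeff_compMirror, constantCoeff_restrictBase, constantCoeff_flatUnit]

lemma logDer_compMirror_flatUnit_zero : logDer (compMirror (restrictBase (flatUnit 0)))
    = (1 - (1 - 432 * mirrorZ) * rootE4 ^ 2) * compMirror (restrictBase (flatUnit 0)) := by
  have h := congrArg compMirror wronskian_one
  rw [map_mul, map_mul, map_pow, compMirror_one_sub, compMirror_period, map_add, map_one] at h
  rw [logDer_compMirror, logDer_restrictBase_flatUnit, map_mul]
  linear_combination compMirror (restrictBase (flatUnit 0)) * h

lemma logDer_compMirror_flatUnit_one : 2 * logDer (compMirror (restrictBase (flatUnit 1)))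
    = 3 * (rootE4 ^ 2 - 1) * compMirror (restrictBase (flatUnit 1)) := by
  have h := congrArg compMirror wronskian_two
  simp only [map_mul, map_pow, compMirror_period, map_sub, map_one,
    map_ofNat, compMirror_X] at h
  rw [logDer_compMirror, logDer_restrictBase_flatUnit, map_mul]
  linear_combination compMirror (restrictBase (flatUnit 1)) * h

/-- The two factors have opposite logarithmic derivatives. This says that q_E becomes q under z₁ =
t(q), so t is indeed the inverse mirror map on z₂ = 0. -/
lemma mirrorUnit_mul : mirrorUnit * compMirror (restrictBase (flatUnit 0)) = 1 := by
  apply eq_one_of_logDer_eq_zero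
  · rw [logDer_mul, logDer_compMirror_flatUnit_zero, logDer_mirrorUnit]
    ring
  · rw [map_mul, constantCoeff_mirrorUnit, constantCoeff_compMirror_flatUnit, one_mul]

/-- The logarithmic derivative of q_B/z₂ is (3/2)(a² - 1); squaring removes the half, and then both
sides have the logarithmic derivative 3((1 - 432t)a² - 1). -/
lemma compMirror_flatUnit_one_sq :
    compMirror (restrictBase (flatUnit 1)) ^ 2 * (1 - 432 * mirrorZ) ^ 3 = mirrorUnit ^ 3 := by
  apply eq_of_logDer_eq_mul (w := 3 * ((1 - 432 * mirrorZ) * rootE4 ^ 2 - 1))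
  · have h := logDer_compMirror_flatUnit_one
    rw [logDer_mul, logDer_pow _ 1, logDer_pow _ 2, logDer_one_sub_mirrorZ]
    push_cast
    linear_combination (1 - 432 * mirrorZ) ^ 3 * compMirror (restrictBase (flatUnit 1)) * h
  · rw [logDer_pow _ 2, logDer_mirrorUnit]
    push_cast
    ring
  · simp [constantCoeff_mirrorZ, constantCoeff_rootE4]
  · simp [constantCoeff_mirrorZ, constantCoeff_mirrorUnit, constantCoeff_compMirror_flatUnit]

/-- The squares of the two sides agree by the cube of `eulerProduct_pow`, and the constant terms fix
the sign. The factor a¹⁸ is the source of the weight 18 per base degree. -/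
lemma compMirror_flatUnit_one : compMirror (restrictBase (flatUnit 1))
    * ((1 - 432 * mirrorZ) ^ 3 * rootE4 ^ 18) = eulerProduct ^ 36 := by
  have h1 := compMirror_flatUnit_one_sq
  have h2 := eulerProduct_pow
  have h3 : (compMirror (restrictBase (flatUnit 1))
      * ((1 - 432 * mirrorZ) ^ 3 * rootE4 ^ 18)) ^ 2 = (eulerProduct ^ 36) ^ 2 := by
    rw [← pow_mul, show 36 * 2 = 24 * 3 by norm_num, pow_mul, h2]
    linear_combination (1 - 432 * mirrorZ) ^ 3 * rootE4 ^ 36 * h1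
  rcases sq_eq_sq_iff_eq_or_eq_neg.mp h3 with h | h
  · exact h
  · have h4 := congrArg PowerSeries.constantCoeff h
    rw [map_mul, constantCoeff_compMirror_flatUnit] at h4
    simp [constantCoeff_mirrorZ, constantCoeff_rootE4, constantCoeff_eulerProduct] at h4
    norm_num at h4

end

end X18

/-! ### The leading coefficient p_n in terms of a and t. -/

namespace X18

noncomputable section

/-- The restriction to `z₂ = 0` as a power series in `q_E`. -/
def flatRestriction : Series →ₐ[ℂ] PowerSeries ℂ := compMirror.comp restrictBase

lemma flatRestriction_apply (G : Series) :
    flatRestriction G = compMirror (restrictBase G) := rfl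

lemma flatRestriction_flatCoord :
    (fun i => flatRestriction (flatCoord i)) = ![PowerSeries.X, 0] := by
  funext i
  fin_cases i
  · have h := mirrorUnit_mul
    change compMirror (restrictBase (flatCoord 0)) = PowerSeries.X
    rw [flatCoord_eq, map_mul, map_mul, restrictBase_X0, compMirror_X, mirrorZ_eq]
    linear_combination PowerSeries.X * h
  · change compMirror (restrictBase (flatCoord 1)) = 0
    rw [flatCoord_eq, map_mul, restrictBase_X1, zero_mul, map_zero]

/-- Along z₁ = t(q), z₂ = 0 the flat coordinates take the values (q, 0), so of a series in q_E, q_B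
only the part free of q_B survives. -/
lemma flatRestriction_subst (F : Series) :
    flatRestriction (MvPowerSeries.subst flatCoord F) = restrictBase F := by
  have h1 : MvPowerSeries.HasSubst fun i => restrictBase (flatCoord i) :=
    MvPowerSeries.hasSubst_of_constantCoeff_zero fun i => by
      change PowerSeries.constantCoeff _ = 0
      rw [constantCoeff_restrictBase, flatCoord_eq, map_mul, MvPowerSeries.constantCoeff_X,
        zero_mul]
  have h2 := flatRestriction_flatCoord
  simp only [flatRestriction_apply, compMirror_apply] at h2
  have h3 : restrictBase (MvPowerSeries.subst flatCoord F)
      = MvPowerSeries.subst (fun i => restrictBase (flatCoord i)) F := by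
    simp only [restrictBase_apply]
    rw [MvPowerSeries.subst_comp_subst_apply hasSubst_flatCoord hasSubst_restrictBase]
  rw [flatRestriction_apply, compMirror_apply, h3, PowerSeries.subst,
    MvPowerSeries.subst_comp_subst_apply h1 hasSubst_mirrorZ.const, restrictBase_apply, ← h2]
  rfl

lemma restrictBase_flatExpansion (G : Series) :
    restrictBase (flatExpansion G) = flatRestriction G := by
  rw [← flatRestriction_subst, subst_flatExpansion]

lemma flatExpansion_mul (G H : Series) :
    flatExpansion (G * H) = flatExpansion G * flatExpansion H := by
  refine (flatExpansion_unique ?_).symm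
  rw [MvPowerSeries.subst_mul hasSubst_flatCoord, subst_flatExpansion, subst_flatExpansion]

lemma flatExpansion_flatCoord_pow (i : Fin 2) (n : ℕ) :
    flatExpansion (flatCoord i ^ n) = MvPowerSeries.X i ^ n := by
  refine (flatExpansion_unique ?_).symm
  rw [MvPowerSeries.subst_pow hasSubst_flatCoord, MvPowerSeries.subst_X hasSubst_flatCoord]

/-- As q_B^n is a monomial in the flat coordinates, only the part of H at q_B = 0 reaches this
coefficient. -/
lemma baseCoeff_flatCoord_pow_mul (n : ℕ) (H : Series) :
    baseCoeff (flatCoord 1 ^ n * H) n = flatRestriction H := by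
  ext i
  rw [← restrictBase_flatExpansion, coeff_restrictBase, baseCoeff, PowerSeries.coeff_mk,
    flatExpansion_mul, flatExpansion_flatCoord_pow, MvPowerSeries.X_pow_eq,
    MvPowerSeries.coeff_monomial_mul]
  simp

lemma flatRestriction_X0 : flatRestriction X0 = rootE4 := compMirror_period

lemma flatRestriction_coe_X0 :
    flatRestriction ((MvPolynomial.X 0 : Poly) : Series) = mirrorZ := by
  rw [MvPolynomial.coe_X, flatRestriction_apply, restrictBase_X0, compMirror_X]

lemma flatRestriction_coe_X1 :
    flatRestriction ((MvPolynomial.X 1 : Poly) : Series) = 0 := by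
  rw [MvPolynomial.coe_X, flatRestriction_apply, restrictBase_X1, map_zero]

lemma flatRestriction_coe_aeval (p : Polynomial ℂ) :
    flatRestriction ((Polynomial.aeval (MvPolynomial.X 0 : Poly) p : Poly) : Series)
      = Polynomial.aeval mirrorZ p := by
  have h : ((Polynomial.aeval (MvPolynomial.X 0 : Poly) p : Poly) : Series)
      = MvPolynomial.coeToMvPowerSeries.algHom ℂ (Polynomial.aeval (MvPolynomial.X 0 : Poly) p) := by
    rw [MvPolynomial.coeToMvPowerSeries.algHom_apply]
    simp
  have h1 : ((MvPolynomial.X 0 : Poly) : Series)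
      = MvPolynomial.coeToMvPowerSeries.algHom ℂ (MvPolynomial.X 0 : Poly) := by
    rw [MvPolynomial.coeToMvPowerSeries.algHom_apply]
    simp
  rw [h, ← flatRestriction_coe_X0, h1, Polynomial.aeval_algHom_apply,
    Polynomial.aeval_algHom_apply]

lemma flatRestriction_coe_disc :
    flatRestriction ((disc1 * disc2 : Poly) : Series) = (1 - 432 * mirrorZ) ^ 3 := by
  have h : flatRestriction ((disc1 * disc2 : Poly) : Series)
      = flatRestriction.toRingHom.comp MvPolynomial.coeToMvPowerSeries.ringHom
        (disc1 * disc2) := rfl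
  have h0 : flatRestriction.toRingHom.comp MvPolynomial.coeToMvPowerSeries.ringHom
      (MvPolynomial.X 0 : Poly) = mirrorZ := flatRestriction_coe_X0
  have h1 : flatRestriction.toRingHom.comp MvPolynomial.coeToMvPowerSeries.ringHom
      (MvPolynomial.X 1 : Poly) = 0 := flatRestriction_coe_X1
  rw [h, disc1, disc2]
  simp only [map_mul, map_sub, map_add, map_pow, map_one, map_ofNat, h0, h1]
  ring

/-- The leading coefficient of `p(z₁) z₂^n / (Δ₁ Δ₂)^(2g-2)`. -/
lemma fibreCoeff_ambiguity (g n : ℕ) (p : Polynomial ℂ) :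
    fibreCoeff g (ambiguity g n p) n * (1 - 432 * mirrorZ) ^ (3 * (2 * g - 2))
      = rootE4 ^ (18 * n + (2 * g - 2))
        * (Polynomial.aeval mirrorZ p * (1 - 432 * mirrorZ) ^ (3 * n)) := by
  set d := 2 * g - 2
  set D : Series := (((disc1 * disc2) ^ d : Poly) : Series) with hD
  set P : Series := ((Polynomial.aeval (MvPolynomial.X 0 : Poly) p : Poly) : Series) with hP
  have hD0 : MvPowerSeries.constantCoeff D ≠ 0 := by
    rw [hD, ← MvPowerSeries.coeff_zero_eq_constantCoeff_apply, MvPolynomial.coeff_coe,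
      ← MvPolynomial.constantCoeff_eq]
    simp [disc1, disc2]
  have hDD : D * D⁻¹ = 1 := MvPowerSeries.mul_inv_cancel _ hD0
  have hU : flatUnit 1 * (flatUnit 1)⁻¹ = 1 :=
    MvPowerSeries.mul_inv_cancel _ (by simp [constantCoeff_flatUnit])
  -- z₂^n is traded for q_B^n at the cost of (q_B/z₂)^(-n).
  have hG : X0 ^ d * taylor (ambiguity g n p)
      = flatCoord 1 ^ n * ((flatUnit 1)⁻¹ ^ n * X0 ^ d * P * D⁻¹) := by
    rw [taylor_ambiguity, ← hD, MvPolynomial.coe_mul, MvPolynomial.coe_pow, MvPolynomial.coe_X,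
      flatCoord_eq, mul_pow]
    have hUn : flatUnit 1 ^ n * (flatUnit 1)⁻¹ ^ n = 1 := by rw [← mul_pow, hU, one_pow]
    linear_combination -(MvPowerSeries.X 1 ^ n * X0 ^ d * P * D⁻¹) * hUn
  have hDr : flatRestriction D = (1 - 432 * mirrorZ) ^ (3 * d) := by
    rw [hD, MvPolynomial.coe_pow, map_pow, flatRestriction_coe_disc, ← pow_mul]
  have hDD' := congrArg flatRestriction hDD
  have hU' := congrArg flatRestriction hU
  rw [map_mul, map_one, hDr] at hDD'
  rw [map_mul, map_one] at hU'
  -- The normalizing product cancels that cost and leaves (1 - 432t)^(3n) a^(18n).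
  have hE : eulerProduct ^ (36 * n)
      = flatRestriction (flatUnit 1) ^ n * ((1 - 432 * mirrorZ) ^ (3 * n) * rootE4 ^ (18 * n)) := by
    rw [pow_mul, ← compMirror_flatUnit_one, mul_pow, mul_pow, ← pow_mul, ← pow_mul]
    rfl
  have hUn : flatRestriction (flatUnit 1) ^ n * flatRestriction (flatUnit 1)⁻¹ ^ n = 1 := by
    rw [← mul_pow, hU', one_pow]
  rw [fibreCoeff, hG, baseCoeff_flatCoord_pow_mul, hE, map_mul, map_mul, map_mul, map_pow, map_pow,
    flatRestriction_X0, hP, flatRestriction_coe_aeval, pow_add]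
  linear_combination (rootE4 ^ d * Polynomial.aeval mirrorZ p * (1 - 432 * mirrorZ) ^ (3 * n)
    * rootE4 ^ (18 * n)) * (hUn + (flatRestriction (flatUnit 1) ^ n
      * flatRestriction (flatUnit 1)⁻¹ ^ n) * hDD')

end

end X18

/-! ### Level one forms as symmetric polynomials in t. -/

namespace X18

noncomputable section

/-- Δ has no zero on the upper half plane and a simple one at the cusp, so a form without constant
term can be divided by it. -/
lemma IsLevelOneForm.exists_eq_discExp_mul {w : ℤ} {P : PowerSeries ℂ} (hP : IsLevelOneForm w P)
    (h0 : PowerSeries.constantCoeff P = 0) :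
    ∃ P', IsLevelOneForm (w - 12) P' ∧ P = discExp * P' := by
  obtain ⟨M, rfl⟩ := hP
  have h := ModularForm.qExpansion_eq_qExpansion_discriminant_mul M
    (by rwa [PowerSeries.coeff_zero_eq_constantCoeff_apply])
  rw [qExpansion_discriminant] at h
  exact ⟨_, ⟨_, rfl⟩, h⟩

lemma IsLevelOneForm.eq_zero_of_weight_two {P : PowerSeries ℂ} (hP : IsLevelOneForm 2 P) :
    P = 0 := by
  obtain ⟨M, rfl⟩ := hP
  rw [rank_zero_iff_forall_zero.mp ModularForm.levelOne_weight_two_rank_zero M]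
  exact UpperHalfPlane.qExpansion_zero 1

/-- Polynomials that give modular forms of weight `2k`: those of degree at most `k/3` that take the
sign `(-1)^k` under `z₁ ↦ 1/432 - z₁`. -/
structure IsModularPolynomial (k : ℕ) (Q : Polynomial ℂ) : Prop where
  natDegree_le : 3 * Q.natDegree ≤ k
  comp_eq : Q.comp (Polynomial.C (1 / 432) - Polynomial.X) = (-1) ^ k * Q

namespace IsModularPolynomial

open Polynomial

variable {j k : ℕ} {P Q : ℂ[X]}

lemma add (hP : IsModularPolynomial k P) (hQ : IsModularPolynomial k Q) :
    IsModularPolynomial k (P + Q) := by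
  refine ⟨?_, ?_⟩
  · have := natDegree_add_le P Q
    have := hP.natDegree_le
    have := hQ.natDegree_le
    lia
  · rw [add_comp, hP.comp_eq, hQ.comp_eq, mul_add]

lemma mul (hP : IsModularPolynomial j P) (hQ : IsModularPolynomial k Q) :
    IsModularPolynomial (j + k) (P * Q) := by
  refine ⟨?_, ?_⟩
  · have := natDegree_mul_le (p := P) (q := Q)
    have := hP.natDegree_le
    have := hQ.natDegree_le
    lia
  · rw [mul_comp, hP.comp_eq, hQ.comp_eq, pow_add]
    ring

/-- The polynomial of a power of E₄, which is a pure power of `rootE4`. -/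
lemma one (a : ℕ) : IsModularPolynomial (2 * a) 1 := by
  refine ⟨by simp, by simp [pow_mul]⟩

lemma smul (c : ℂ) (hP : IsModularPolynomial k P) : IsModularPolynomial k (c • P) := by
  refine ⟨?_, ?_⟩
  · have := natDegree_smul_le c P
    have := hP.natDegree_le
    lia
  · rw [smul_comp, hP.comp_eq, mul_smul_comm]

lemma pow (hP : IsModularPolynomial k P) (n : ℕ) : IsModularPolynomial (n * k) (P ^ n) := by
  induction n with
  | zero => simpa using one 0
  | succ n ih =>
    rw [pow_succ, Nat.succ_mul]
    exact ih.mul hP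

lemma _root_.X18.natDegree_linear_le (c : ℂ) : (1 - C c * X : ℂ[X]).natDegree ≤ 1 := by
  compute_degree

/-- The polynomial of E₆. -/
lemma linear : IsModularPolynomial 3 (1 - C 864 * X) := by
  refine ⟨?_, ?_⟩
  · have := natDegree_linear_le 864
    lia
  · have : (C 864 * C (1 / 432) : ℂ[X]) = 2 := by
      rw [← C_mul, ← map_ofNat C]; norm_num
    simp only [sub_comp, one_comp, mul_comp, C_comp, X_comp, mul_sub, this]
    ring

/-- The polynomial of Δ. -/
lemma quadratic : IsModularPolynomial 6 (X * (1 - C 432 * X)) := by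
  refine ⟨?_, ?_⟩
  · have := natDegree_linear_le 432
    have := natDegree_mul_le (p := (X : ℂ[X])) (q := 1 - C 432 * X)
    have := natDegree_X (R := ℂ)
    lia
  · have : (C 432 * C (1 / 432) : ℂ[X]) = 1 := by
      rw [← C_mul]; norm_num
    simp only [sub_comp, one_comp, mul_comp, C_comp, X_comp]
    linear_combination (-(C (1 / 432)) + 2 * X) * this

/-- Supplies a product E₄^a E₆^b of weight 2k, with constant term 1; weight 2 is the only exception.
-/
lemma exists_monomial (hk : k ≠ 1) : ∃ a b : ℕ, k = 2 * a + 3 * b := by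
  rcases Nat.even_or_odd' k with ⟨a, rfl | rfl⟩
  · exact ⟨a, 0, by lia⟩
  · exact ⟨a - 1, 1, by lia⟩

lemma monomial (a b : ℕ) : IsModularPolynomial (2 * a + 3 * b) ((1 - C 864 * X) ^ b) := by
  have := (one a).mul (linear.pow b)
  rwa [one_mul, mul_comm b] at this

/-- The degree bound leaves a constant, and the symmetry makes it equal to its negative. -/
lemma eval_zero_of_weight_two (h : IsModularPolynomial 1 Q) : Q.eval 0 = 0 := by
  have h1 : Q.natDegree = 0 := by
    have := h.natDegree_le
    lia
  have h2 := h.comp_eq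
  rw [eq_C_of_natDegree_eq_zero h1] at h2 ⊢
  rw [C_comp, pow_one, neg_one_mul, ← C_neg, C_inj, CharZero.eq_neg_self_iff] at h2
  rw [eval_C, h2]

lemma eval_eq (h : IsModularPolynomial k Q) (x : ℂ) :
    Q.eval (1 / 432 - x) = (-1) ^ k * Q.eval x := by
  have := congrArg (eval x) h.comp_eq
  simpa [eval_comp] using this

/-- A modular polynomial that vanishes at `0` is divisible by `z₁ (1 - 432 z₁)`. -/
lemma exists_eq_quadratic_mul (h : IsModularPolynomial k Q) (h0 : Q.eval 0 = 0) (hQ : Q ≠ 0) :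
    6 ≤ k ∧ ∃ R, IsModularPolynomial (k - 6) R ∧ Q = X * (1 - C 432 * X) * R := by
  -- The reflection carries the root 0 to 1/432.
  have h1 : Q.eval (1 / 432) = 0 := by
    have := h.eval_eq 0
    rwa [sub_zero, h0, mul_zero] at this
  obtain ⟨Q₁, rfl⟩ := X_dvd_iff.mpr (by rwa [← coeff_zero_eq_eval_zero] at h0)
  have h2 : Q₁.IsRoot (1 / 432) := by simpa using h1
  obtain ⟨Q₂, rfl⟩ := dvd_iff_isRoot.mpr h2
  have h3 : X * ((X - C (1 / 432)) * Q₂) = X * (1 - C 432 * X) * (C (-1 / 432) * Q₂) := by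
    have e1 : (C 432 * C (-1 / 432) : ℂ[X]) = -1 := by
      rw [← C_mul]; norm_num
    have e2 : (C (-1 / 432) : ℂ[X]) = -C (1 / 432) := by
      rw [← C_neg]; norm_num
    linear_combination X * Q₂ * X * e1 - X * Q₂ * e2
  rw [h3] at h hQ ⊢
  set R := C (-1 / 432) * Q₂ with hR
  have hR0 : R ≠ 0 := right_ne_zero_of_mul hQ
  have hL0 : (1 - C 432 * X : ℂ[X]) ≠ 0 := right_ne_zero_of_mul (left_ne_zero_of_mul hQ)
  have hL1 : (1 - C 432 * X : ℂ[X]).natDegree = 1 := by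
    compute_degree!
  -- Three times the degree drops by 6, half the weight of Δ; as R ≠ 0 this also forces 6 ≤ k.
  have hd : (X * (1 - C 432 * X) * R).natDegree = 2 + R.natDegree := by
    rw [natDegree_mul (left_ne_zero_of_mul hQ) hR0, natDegree_mul X_ne_zero hL0, natDegree_X, hL1]
  have hle := h.natDegree_le
  rw [hd] at hle
  refine ⟨by lia, R, ⟨by lia, ?_⟩, rfl⟩
  have h4 := h.comp_eq
  have h5 := quadratic.comp_eq
  rw [mul_comp, h5] at h4
  obtain ⟨m, rfl⟩ : ∃ m, k = 6 + m := ⟨k - 6, by lia⟩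
  rw [Nat.add_sub_cancel_left]
  refine mul_left_cancel₀ (left_ne_zero_of_mul hQ) ?_
  rw [pow_add] at h4
  linear_combination h4

end IsModularPolynomial

lemma aeval_mirrorZ_linear (c : ℂ) :
    Polynomial.aeval mirrorZ (1 - Polynomial.C c * Polynomial.X : Polynomial ℂ)
      = 1 - PowerSeries.C c * mirrorZ := by
  simp only [map_sub, map_one, map_mul, Polynomial.aeval_C, Polynomial.aeval_X]
  rfl

lemma aeval_mirrorZ_one_sub :
    Polynomial.aeval mirrorZ (1 - Polynomial.C 432 * Polynomial.X : Polynomial ℂ) = 1 - 432 * mirrorZ := by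
  rw [aeval_mirrorZ_linear, map_ofNat]

lemma e4_pow_mul_e6_pow (a b : ℕ) : e4 ^ a * e6 ^ b = rootE4 ^ (2 * (2 * a + 3 * b))
    * Polynomial.aeval mirrorZ ((1 - Polynomial.C 864 * Polynomial.X : Polynomial ℂ) ^ b) := by
  rw [map_pow, aeval_mirrorZ_linear, map_ofNat, ← rootE4_pow, e6_eq, mul_pow, ← pow_mul, ← pow_mul]
  ring

lemma discExp_mul (k : ℕ) (Q : Polynomial ℂ) :
    discExp * (rootE4 ^ (2 * k) * Polynomial.aeval mirrorZ Q) = rootE4 ^ (2 * (6 + k))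
      * Polynomial.aeval mirrorZ
        (Polynomial.X * (1 - Polynomial.C 432 * Polynomial.X) * Q) := by
  rw [map_mul, map_mul, aeval_mirrorZ_one_sub, Polynomial.aeval_X, discExp_eq]
  ring

lemma isLevelOneForm_e4_pow_mul_e6_pow (a b : ℕ) :
    IsLevelOneForm (2 * (2 * a + 3 * b : ℕ)) (e4 ^ a * e6 ^ b) := by
  have := (isLevelOneForm_e4.pow a).mul (isLevelOneForm_e6.pow b)
  convert this using 1
  push_cast
  ring

/-- Induction on the weight: a multiple of E₄^a E₆^b removes the constant term, and what is left is
divided by Δ. -/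
lemma IsLevelOneForm.exists_modularPolynomial {k : ℕ} {P : PowerSeries ℂ}
    (hP : IsLevelOneForm (2 * k) P) : ∃ Q, IsModularPolynomial k Q ∧
      P = rootE4 ^ (2 * k) * Polynomial.aeval mirrorZ Q := by
  induction k using Nat.strong_induction_on generalizing P with
  | _ k ih =>
  have key : ∀ P : PowerSeries ℂ, IsLevelOneForm (2 * k) P → PowerSeries.constantCoeff P = 0 →
      ∃ Q, IsModularPolynomial k Q ∧ P = rootE4 ^ (2 * k) * Polynomial.aeval mirrorZ Q := by
    intro P hP h0
    rcases lt_or_ge k 6 with hk | hk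
    · refine ⟨0, ⟨by simp, by simp⟩, ?_⟩
      rw [hP.eq_zero_of_lt_twelve (by lia) h0]
      simp
    · obtain ⟨m, rfl⟩ : ∃ m, k = 6 + m := ⟨k - 6, by lia⟩
      obtain ⟨P', hP', rfl⟩ := hP.exists_eq_discExp_mul h0
      obtain ⟨Q, hQ, rfl⟩ := ih m (by lia) (P := P') (by convert hP' using 1; push_cast; ring)
      exact ⟨_, IsModularPolynomial.quadratic.mul hQ, discExp_mul m Q⟩
  rcases eq_or_ne k 1 with rfl | hk
  · exact key P hP (by
      rw [IsLevelOneForm.eq_zero_of_weight_two (P := P) (by simpa using hP), map_zero])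
  · obtain ⟨a, b, rfl⟩ := IsModularPolynomial.exists_monomial hk
    set c := PowerSeries.constantCoeff P with hc
    obtain ⟨Q, hQ, h⟩ := key (P + (-c) • (e4 ^ a * e6 ^ b))
      (hP.add ((isLevelOneForm_e4_pow_mul_e6_pow a b).smul _))
      (by simp [constantCoeff_e4, constantCoeff_e6, ← hc])
    refine ⟨Q + c • (1 - Polynomial.C 864 * Polynomial.X) ^ b,
      hQ.add ((IsModularPolynomial.monomial a b).smul c), ?_⟩
    rw [map_add, mul_add, ← h, map_smul, mul_smul_comm, ← e4_pow_mul_e6_pow]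
    rw [neg_smul]
    abel

/-- The same induction on the polynomial side: Q(0) plays the part of the constant term and X(1 -
432X) that of Δ. -/
lemma IsModularPolynomial.isLevelOneForm {k : ℕ} {Q : Polynomial ℂ}
    (hQ : IsModularPolynomial k Q) :
    IsLevelOneForm (2 * k) (rootE4 ^ (2 * k) * Polynomial.aeval mirrorZ Q) := by
  induction k using Nat.strong_induction_on generalizing Q with
  | _ k ih =>
  have key : ∀ Q : Polynomial ℂ, IsModularPolynomial k Q → Q.eval 0 = 0 →
      IsLevelOneForm (2 * k) (rootE4 ^ (2 * k) * Polynomial.aeval mirrorZ Q) := by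
    intro Q hQ h0
    by_cases hQ0 : Q = 0
    · rw [hQ0, map_zero, mul_zero]
      exact IsLevelOneForm.zero _
    · obtain ⟨hk, R, hR, rfl⟩ := hQ.exists_eq_quadratic_mul h0 hQ0
      obtain ⟨m, rfl⟩ : ∃ m, k = 6 + m := ⟨k - 6, by lia⟩
      rw [Nat.add_sub_cancel_left] at hR
      rw [← discExp_mul]
      have := isLevelOneForm_discExp.mul (ih m (by lia) hR)
      convert this using 1
      push_cast
      ring
  rcases eq_or_ne k 1 with rfl | hk
  · exact key Q hQ hQ.eval_zero_of_weight_two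
  · obtain ⟨a, b, rfl⟩ := IsModularPolynomial.exists_monomial hk
    have h := key (Q + (-Q.eval 0) • (1 - Polynomial.C 864 * Polynomial.X) ^ b)
      (hQ.add ((IsModularPolynomial.monomial a b).smul _)) (by simp)
    have h' := h.add ((isLevelOneForm_e4_pow_mul_e6_pow a b).smul (Q.eval 0))
    convert h' using 1
    have h1 := e4_pow_mul_e6_pow a b
    rw [h1, map_add, map_smul, PowerSeries.smul_eq_C_mul, PowerSeries.smul_eq_C_mul, map_neg]
    ring

end

end X18

/-! ### The numerator p: degree bound, symmetry and the involution. -/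

namespace X18

noncomputable section

open Polynomial

lemma linear_ne_zero (c : ℂ) : (1 - C c * X : ℂ[X]) ≠ 0 := by
  intro h
  have := congrArg (eval 0) h
  simp at this

lemma natDegree_linear {c : ℂ} (hc : c ≠ 0) : (1 - C c * X : ℂ[X]).natDegree = 1 := by
  compute_degree!

lemma linear_comp_reflection : (1 - C 432 * X : ℂ[X]).comp (C (1 / 432) - X) = C 432 * X := by
  have : (C 432 * C (1 / 432) : ℂ[X]) = 1 := by
    rw [← C_mul]; norm_num
  simp only [sub_comp, one_comp, mul_comp, C_comp, X_comp]
  linear_combination -this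

lemma scaled_X_ne_zero : (C 432 * X : ℂ[X]) ≠ 0 :=
  mul_ne_zero (C_ne_zero.mpr (by norm_num)) X_ne_zero

lemma isCoprime_X_linear : IsCoprime (X : ℂ[X]) (1 - C 432 * X) := ⟨C 432, 1, by ring⟩

lemma isCoprime_scaled_X_linear : IsCoprime (C 432 * X : ℂ[X]) (1 - C 432 * X) := ⟨1, 1, by ring⟩

/-- By the symmetry each factor 1 - 432X of Q is accompanied by a factor X. The alternative R = 0
covers Q = 0, where k puts no bound on K. -/
lemma IsModularPolynomial.exists_eq_quadratic_pow_mul {k : ℕ} {Q : ℂ[X]}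
    (hQ : IsModularPolynomial k Q) (K : ℕ) (hd : (1 - C 432 * X) ^ K ∣ Q) :
    ∃ R, Q = (X * (1 - C 432 * X)) ^ K * R
      ∧ (R = 0 ∨ 6 * K ≤ k ∧ IsModularPolynomial (k - 6 * K) R) := by
  induction K generalizing k Q with
  | zero => exact ⟨Q, by simp, Or.inr ⟨by simp, by simpa using hQ⟩⟩
  | succ K ih =>
    by_cases hQ0 : Q = 0
    · exact ⟨0, by simp [hQ0], Or.inl rfl⟩
    have h1 : Q.eval (1 / 432) = 0 := by
      obtain ⟨T, rfl⟩ := hd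
      simp
    have h0 : Q.eval 0 = 0 := by
      have := hQ.eval_eq (1 / 432)
      rwa [h1, mul_zero, sub_self] at this
    obtain ⟨hk, R, hR, rfl⟩ := hQ.exists_eq_quadratic_mul h0 hQ0
    rw [pow_succ', show X * (1 - C 432 * X) * R = (1 - C 432 * X) * (X * R) by ring,
      mul_dvd_mul_iff_left (linear_ne_zero 432)] at hd
    -- X is coprime to 1 - 432X, so the remaining power divides the cofactor R itself.
    obtain ⟨S, rfl, hS⟩ := ih hR (isCoprime_X_linear.symm.pow_left.dvd_of_dvd_mul_left hd)
    refine ⟨S, by ring, hS.imp id fun h => ⟨by lia, ?_⟩⟩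
    rw [show k - 6 * (K + 1) = k - 6 - 6 * K by lia]
    exact h.2

/-- A polynomial numerator corresponds to a modular polynomial if and only if it satisfies the
degree bound and the symmetry under the involution. -/
lemma exists_modularPolynomial_iff {g : ℕ} (hg : 1 ≤ g) (n : ℕ) (p : ℂ[X]) :
    (∃ Q, IsModularPolynomial (9 * n + g - 1) Q
      ∧ Q * (1 - C 432 * X) ^ (3 * (2 * g - 2)) = p * (1 - C 432 * X) ^ (3 * n))
    ↔ p.natDegree ≤ 19 * (g - 1) / 3
      ∧ (-1) ^ n * p.comp (C (1 / 432) - X) * (C 432 * X) ^ (3 * n)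
          * (1 - C 432 * X) ^ (3 * (2 * g - 2))
        = (-1) ^ (g - 1) * p * (C 432 * X) ^ (3 * (2 * g - 2)) * (1 - C 432 * X) ^ (3 * n) := by
  obtain ⟨h, rfl⟩ : ∃ h, g = h + 1 := ⟨g - 1, by lia⟩
  rw [show 2 * (h + 1) - 2 = 2 * h by lia, Nat.add_sub_cancel,
    show 9 * n + (h + 1) - 1 = 9 * n + h by lia]
  have hy : (1 - C 432 * X : ℂ[X]) ≠ 0 := linear_ne_zero 432
  have hx := scaled_X_ne_zero
  have hdeg : ∀ Q : ℂ[X], Q * (1 - C 432 * X) ^ (3 * (2 * h)) = p * (1 - C 432 * X) ^ (3 * n) →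
      (p = 0 ∧ Q = 0) ∨ Q.natDegree + 3 * (2 * h) = p.natDegree + 3 * n := by
    intro Q hQ
    by_cases hp : p = 0
    · refine Or.inl ⟨hp, ?_⟩
      rw [hp, zero_mul] at hQ
      exact (mul_eq_zero.mp hQ).resolve_right (pow_ne_zero _ hy)
    · right
      have hQ0 : Q ≠ 0 := by
        rintro rfl
        rw [zero_mul, eq_comm] at hQ
        exact hp ((mul_eq_zero.mp hQ).resolve_right (pow_ne_zero _ hy))
      have := congrArg natDegree hQ
      rwa [natDegree_mul hQ0 (pow_ne_zero _ hy), natDegree_mul hp (pow_ne_zero _ hy),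
        natDegree_pow, natDegree_pow, natDegree_linear (by norm_num), mul_one, mul_one] at this
  have hcomp : ∀ Q : ℂ[X], Q * (1 - C 432 * X) ^ (3 * (2 * h)) = p * (1 - C 432 * X) ^ (3 * n) →
      Q.comp (C (1 / 432) - X) * (C 432 * X) ^ (3 * (2 * h))
        = p.comp (C (1 / 432) - X) * (C 432 * X) ^ (3 * n) := by
    intro Q hQ
    have := congrArg (fun P : ℂ[X] => P.comp (C (1 / 432) - X)) hQ
    simpa only [mul_comp, pow_comp, linear_comp_reflection] using this
  have hsign : ((-1) ^ (9 * n + h) : ℂ[X]) = (-1) ^ n * (-1) ^ h := by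
    rw [pow_add, pow_mul]
    norm_num
  have hsq : ((-1) ^ n * (-1) ^ n : ℂ[X]) = 1 := by
    rw [← mul_pow]
    norm_num
  constructor
  · rintro ⟨Q, hQ, hpQ⟩
    refine ⟨?_, ?_⟩
    -- 3 deg Q ≤ 9n + h and deg Q + 6h = deg p + 3n combine to 3 deg p ≤ 19h.
    · have h1 := hQ.natDegree_le
      rcases hdeg Q hpQ with ⟨rfl, -⟩ | h2
      · simp
      · lia
    · have h1 := hcomp Q hpQ
      rw [hQ.comp_eq, hsign] at h1
      linear_combination -(-1) ^ n * (1 - C 432 * X) ^ (3 * (2 * h)) * h1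
        + (-1) ^ h * (C 432 * X) ^ (3 * (2 * h)) * hpQ
        + (-1) ^ h * Q * (C 432 * X) ^ (3 * (2 * h)) * (1 - C 432 * X) ^ (3 * (2 * h)) * hsq
  · rintro ⟨hd, hp⟩
    obtain ⟨Q, hpQ⟩ : ∃ Q : ℂ[X],
        Q * (1 - C 432 * X) ^ (3 * (2 * h)) = p * (1 - C 432 * X) ^ (3 * n) := by
      rcases le_total n (2 * h) with hn | hn
      · obtain ⟨m, hm⟩ : ∃ m, 3 * (2 * h) = m + 3 * n := ⟨3 * (2 * h) - 3 * n, by lia⟩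
        rw [hm] at hp ⊢
        -- For n ≤ 2h the numerator must absorb (1 - 432X)^m. The symmetry puts this power into p
        -- (432X)^m, and coprimality moves it to p.
        have h1 : (1 - C 432 * X) ^ m ∣ p * (C 432 * X) ^ m := by
          refine ⟨(-1) ^ h * (-1) ^ n * p.comp (C (1 / 432) - X), ?_⟩
          have hs : ((-1) ^ h * (-1) ^ h : ℂ[X]) = 1 := by
            rw [← mul_pow]
            norm_num
          refine mul_right_cancel₀ (mul_ne_zero (pow_ne_zero (3 * n) hx)
            (pow_ne_zero (3 * n) hy)) ?_
          rw [pow_add, pow_add] at hp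
          linear_combination -(-1) ^ h * hp - p * (C 432 * X) ^ m * (C 432 * X) ^ (3 * n)
            * (1 - C 432 * X) ^ (3 * n) * hs
        obtain ⟨Q, rfl⟩ := isCoprime_scaled_X_linear.symm.pow.dvd_of_dvd_mul_right h1
        exact ⟨Q, by ring⟩
      · obtain ⟨m, hm⟩ : ∃ m, 3 * n = m + 3 * (2 * h) := ⟨3 * n - 3 * (2 * h), by lia⟩
        exact ⟨p * (1 - C 432 * X) ^ m, by rw [hm]; ring⟩
    refine ⟨Q, ⟨?_, ?_⟩, hpQ⟩
    · rcases hdeg Q hpQ with ⟨-, rfl⟩ | h2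
      · simp
      · lia
    · have h1 := hcomp Q hpQ
      rw [hsign]
      refine mul_right_cancel₀ (mul_ne_zero (pow_ne_zero (3 * (2 * h)) hx)
        (pow_ne_zero (3 * (2 * h)) hy)) ?_
      linear_combination (1 - C 432 * X) ^ (3 * (2 * h)) * h1 + (-1) ^ n * hp
        - (-1) ^ n * (-1) ^ h * (C 432 * X) ^ (3 * (2 * h)) * hpQ
        - (1 - C 432 * X) ^ (3 * (2 * h)) * (p.comp (C (1 / 432) - X) * (C 432 * X) ^ (3 * n))
          * hsq

lemma aeval_z_injective : Function.Injective (aeval (z 0) : ℂ[X] →ₐ[ℂ] RatFun) := by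
  have h : (aeval (z 0) : ℂ[X] →ₐ[ℂ] RatFun)
      = (IsScalarTower.toAlgHom ℂ Poly RatFun).comp (aeval (MvPolynomial.X 0 : Poly)) := by
    ext
    simp [z]
  rw [h, AlgHom.coe_comp]
  refine (IsFractionRing.injective Poly RatFun).comp ?_
  exact transcendental_iff_injective.mp (MvPolynomial.transcendental_X ℂ 0)

lemma z_one_ne_zero : z 1 ≠ 0 :=
  (map_ne_zero_iff _ (IsFractionRing.injective Poly RatFun)).mpr (MvPolynomial.X_ne_zero _)

lemma disc_ne_zero : algebraMap Poly RatFun (disc1 * disc2) ≠ 0 := by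
  refine (map_ne_zero_iff _ (IsFractionRing.injective Poly RatFun)).mpr fun h => ?_
  have := congrArg MvPolynomial.constantCoeff h
  simp [disc1, disc2] at this

lemma aeval_z_scaled_X : aeval (z 0) (C 432 * X : ℂ[X]) = 432 * z 0 := by
  rw [map_ofNat, map_mul, map_ofNat, aeval_X]

lemma aeval_z_linear : aeval (z 0) (1 - C 432 * X : ℂ[X]) = 1 - 432 * z 0 := by
  rw [map_sub, map_one, aeval_z_scaled_X]

lemma scaled_z_ne_zero : 432 * z 0 ≠ 0 := by
  rw [← aeval_z_scaled_X, map_ne_zero_iff _ aeval_z_injective]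
  exact scaled_X_ne_zero

lemma one_sub_z_ne_zero : 1 - 432 * z 0 ≠ 0 := by
  rw [← aeval_z_linear, map_ne_zero_iff _ aeval_z_injective]
  exact linear_ne_zero 432

lemma disc_eq : algebraMap Poly RatFun (disc1 * disc2)
    = ((1 - 432 * z 0) ^ 3 - 27 * z 1 * (432 * z 0) ^ 3) * (1 + 27 * z 1) := by
  simp only [disc1, disc2, map_mul, map_sub, map_add, map_pow, map_one, map_ofNat]
  rfl

/-- The substitution sends Δ₁ to (432z₁)³Δ₂ and Δ₂ to Δ₁/(1 - 432z₁)³. -/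
lemma involution_disc : involution (algebraMap Poly RatFun (disc1 * disc2)) * (1 - 432 * z 0) ^ 3
    = algebraMap Poly RatFun (disc1 * disc2) * (432 * z 0) ^ 3 := by
  have h := one_sub_z_ne_zero
  have h2 : 432 * (1 / 432 - z 0) = 1 - 432 * z 0 := by ring
  rw [disc_eq]
  simp only [map_mul, map_sub, map_add, map_pow, map_one, map_ofNat, involution_z0, involution_z1,
    h2]
  field_simp
  ring

lemma involution_aeval (p : ℂ[X]) :
    involution (aeval (z 0) p) = aeval (z 0) (p.comp (C (1 / 432) - X)) := by
  rw [← aeval_algHom_apply, involution_z0, aeval_comp, map_sub, aeval_X, aeval_C, map_div₀,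
    map_one, map_ofNat]

/-- Both sides share the nonzero factor z₂^n over a product of powers of Δ₁Δ₂, 432z₁ and 1 - 432z₁.
What remains is an identity in ℂ[z₁], with denominators cleared so that it does not depend on the
sign of n - (2g-2). -/
lemma involution_ambiguity_iff (g n : ℕ) (p : ℂ[X]) :
    involution (ambiguity g n p) = (-1) ^ (g - 1) * ambiguity g n p
    ↔ (-1) ^ n * p.comp (C (1 / 432) - X) * (C 432 * X) ^ (3 * n)
          * (1 - C 432 * X) ^ (3 * (2 * g - 2))
        = (-1) ^ (g - 1) * p * (C 432 * X) ^ (3 * (2 * g - 2)) * (1 - C 432 * X) ^ (3 * n) := by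
  set e := 2 * g - 2
  have hy := one_sub_z_ne_zero
  have hx := scaled_z_ne_zero
  have hz := z_one_ne_zero
  have hD := disc_ne_zero
  have hD' : involution (algebraMap Poly RatFun (disc1 * disc2))
      = algebraMap Poly RatFun (disc1 * disc2) * (432 * z 0) ^ 3 / (1 - 432 * z 0) ^ 3 := by
    rw [eq_div_iff (pow_ne_zero 3 hy), involution_disc]
  have hneg : aeval (z 0) (-1 : ℂ[X]) = -1 := by rw [map_neg, map_one]
  rw [← aeval_z_injective.eq_iff]
  simp only [map_mul (aeval (z 0)), map_pow (aeval (z 0)), hneg, ← involution_aeval, aeval_z_linear]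
  simp only [← map_mul (aeval (z 0)), aeval_z_scaled_X]
  rw [ambiguity_apply, map_div₀, map_mul, map_pow, map_pow, hD', involution_z1]
  set D := algebraMap Poly RatFun (disc1 * disc2)
  set a := aeval (z 0) p
  set b := involution a
  generalize 1 - 432 * z 0 = y at hy ⊢
  generalize 432 * z 0 = x at hx ⊢
  have hl : b * (-(x ^ 3 * z 1 / y ^ 3)) ^ n / (D * x ^ 3 / y ^ 3) ^ e
      = ((-1) ^ n * b * x ^ (3 * n) * y ^ (3 * e))
        * (z 1 ^ n / (D ^ e * x ^ (3 * e) * y ^ (3 * n))) := by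
    rw [neg_pow, div_pow, div_pow, mul_pow, mul_pow, pow_mul, pow_mul, pow_mul, pow_mul]
    field_simp
  have hr : (-1) ^ (g - 1) * (a * z 1 ^ n / D ^ e)
      = ((-1) ^ (g - 1) * a * x ^ (3 * e) * y ^ (3 * n))
        * (z 1 ^ n / (D ^ e * x ^ (3 * e) * y ^ (3 * n))) := by
    field_simp
  rw [hl, hr, mul_left_inj' (div_ne_zero (pow_ne_zero _ hz) (mul_ne_zero (mul_ne_zero
    (pow_ne_zero _ hD) (pow_ne_zero _ hx)) (pow_ne_zero _ hy)))]

end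

end X18

/-! ### The equality of spaces and the two isomorphisms. -/

namespace X18

noncomputable section

open Polynomial

lemma aeval_mirrorZ_injective : Function.Injective (aeval mirrorZ : ℂ[X] →ₐ[ℂ] PowerSeries ℂ) := by
  have h : (aeval mirrorZ : ℂ[X] →ₐ[ℂ] PowerSeries ℂ)
      = compMirror.comp (Polynomial.coeToPowerSeries.algHom ℂ) := by
    ext1
    simp [Polynomial.coeToPowerSeries.algHom_apply, compMirror_X]
  rw [h, AlgHom.coe_comp]
  refine compMirror_injective.comp fun P Q hPQ => ?_
  simpa [Polynomial.coeToPowerSeries.algHom_apply] using hPQ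

lemma one_sub_mirrorZ_ne_zero : (1 - 432 * mirrorZ) ≠ 0 := by
  rw [← aeval_mirrorZ_one_sub, map_ne_zero_iff _ aeval_mirrorZ_injective]
  exact linear_ne_zero 432

/-- Turns a statement on p_n into one on numerators: in `fibreCoeff_ambiguity` the powers of a and
of 1 - 432t are nonzero, and t satisfies no polynomial relation. -/
lemma fibreCoeff_eq_iff {g : ℕ} (hg : 1 ≤ g) (n : ℕ) (p Q : ℂ[X]) :
    fibreCoeff g (ambiguity g n p) n = rootE4 ^ (2 * (9 * n + g - 1)) * aeval mirrorZ Q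
    ↔ Q * (1 - C 432 * X) ^ (3 * (2 * g - 2)) = p * (1 - C 432 * X) ^ (3 * n) := by
  have h := fibreCoeff_ambiguity g n p
  rw [show 18 * n + (2 * g - 2) = 2 * (9 * n + g - 1) by lia] at h
  rw [← mul_left_inj' (pow_ne_zero (3 * (2 * g - 2)) one_sub_mirrorZ_ne_zero), h,
    ← aeval_mirrorZ_injective.eq_iff, map_mul, map_mul, map_pow, map_pow, aeval_mirrorZ_one_sub,
    mul_assoc, mul_right_inj' (pow_ne_zero _ rootE4_ne_zero)]
  exact eq_comm

lemma isLevelOneForm_iff {k : ℕ} {P : PowerSeries ℂ} : IsLevelOneForm (2 * k) P ↔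
    ∃ Q, IsModularPolynomial k Q ∧ P = rootE4 ^ (2 * k) * aeval mirrorZ Q := by
  refine ⟨IsLevelOneForm.exists_modularPolynomial, ?_⟩
  rintro ⟨Q, hQ, rfl⟩
  exact hQ.isLevelOneForm

lemma ambiguity_mem_W0_iff {g : ℕ} (hg : 1 ≤ g) (n : ℕ) (p : ℂ[X]) :
    ambiguity g n p ∈ W0 g n ↔ ∃ Q, IsModularPolynomial (9 * n + g - 1) Q
      ∧ Q * (1 - C 432 * X) ^ (3 * (2 * g - 2)) = p * (1 - C 432 * X) ^ (3 * n) := by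
  have h : ambiguity g n p ∈ W0 g n ↔ IsLevelOneForm (18 * (n : ℤ) + 2 * (g : ℤ) - 2)
      (fibreCoeff g (ambiguity g n p) n) := and_iff_right ⟨p, rfl⟩
  rw [h, show (18 * (n : ℤ) + 2 * (g : ℤ) - 2) = 2 * ((9 * n + g - 1 : ℕ) : ℤ) by lia,
    isLevelOneForm_iff]
  simp only [fibreCoeff_eq_iff hg]

theorem W0_eq_V2 {g : ℕ} (hg : 1 ≤ g) (n : ℕ) : W0 g n = V2 g (19 * (g - 1) / 3) n := by
  ext f
  rw [mem_V2]
  constructor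
  · intro hf
    obtain ⟨p, rfl⟩ := hf.1
    rw [ambiguity_mem_W0_iff hg, exists_modularPolynomial_iff hg, ← involution_ambiguity_iff] at hf
    have hp : ambiguity g n p ∈ V0 g (19 * (g - 1) / 3) n :=
      ⟨p, mem_degreeLE.mpr (natDegree_le_iff_degree_le.mp hf.1), rfl⟩
    refine ⟨hp, ?_, hf.2⟩
    -- Membership of f̃ is automatic, as f̃ is ±f and the space is linear.
    rw [hf.2, show (-1 : RatFun) ^ (g - 1) * ambiguity g n p
      = (-1 : ℂ) ^ (g - 1) • ambiguity g n p by
        rw [Algebra.smul_def, map_pow, map_neg, map_one]]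
    exact Submodule.smul_mem _ _ hp
  · rintro ⟨⟨p, hp, rfl⟩, -, hf⟩
    rw [ambiguity_mem_W0_iff hg, exists_modularPolynomial_iff hg, ← involution_ambiguity_iff]
    exact ⟨natDegree_le_iff_degree_le.mpr (mem_degreeLE.mp hp), hf⟩

lemma qExpansion_injective (w : ℤ) :
    Function.Injective fun M : ModularForm 𝒮ℒ w => UpperHalfPlane.qExpansion 1 M := by
  intro M N h
  have h1 : UpperHalfPlane.qExpansion 1 (M + (-1 : ℂ) • N : ModularForm 𝒮ℒ w) = 0 := by
    have e1 := ModularForm.qExpansion_add one_pos one_mem_strictPeriods_SL M ((-1 : ℂ) • N)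
    have e2 := ModularForm.qExpansion_smul one_pos one_mem_strictPeriods_SL (-1 : ℂ) N
    have e3 : UpperHalfPlane.qExpansion 1 M = UpperHalfPlane.qExpansion 1 N := h
    refine e1.trans ?_
    refine (congrArg₂ _ e3 e2).trans ?_
    simp
  rw [ModularForm.qExpansion_eq_zero_iff one_pos one_mem_strictPeriods_SL] at h1
  simpa [sub_eq_add_neg, add_neg_eq_zero] using h1

/-- Serves both ranges of n, with c = 1 or c a power of Δ. Cancelling c and the injectivity of
q-expansions determine M from f, so the choice is linear; it is injective because the leading
coefficient of a nonzero f does not vanish. -/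
lemma exists_linearEquiv_of_fibreCoeff {g n : ℕ} {w : ℤ} {c : PowerSeries ℂ} (hc : c ≠ 0)
    (h₁ : ∀ f ∈ W0 g n, ∃ M : ModularForm 𝒮ℒ w,
      c * UpperHalfPlane.qExpansion 1 M = fibreCoeff g f n)
    (h₂ : ∀ M : ModularForm 𝒮ℒ w, ∃ f ∈ W0 g n,
      c * UpperHalfPlane.qExpansion 1 M = fibreCoeff g f n) :
    ∃ Φ : W0 g n ≃ₗ[ℂ] ModularForm 𝒮ℒ w, ∀ f : W0 g n,
      c * UpperHalfPlane.qExpansion 1 (Φ f) = fibreCoeff g (f : RatFun) n := by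
  choose φ hφ using fun f : W0 g n => h₁ f f.2
  have hinj : ∀ M N : ModularForm 𝒮ℒ w, c * UpperHalfPlane.qExpansion 1 M
      = c * UpperHalfPlane.qExpansion 1 N → M = N := fun M N h =>
    qExpansion_injective w (mul_left_cancel₀ hc h)
  let Φ : W0 g n →ₗ[ℂ] ModularForm 𝒮ℒ w :=
    { toFun := φ
      map_add' := fun f h => by
        apply hinj
        have e := ModularForm.qExpansion_add one_pos one_mem_strictPeriods_SL (φ f) (φ h)
        refine Eq.trans ?_ (congrArg (c * ·) e).symm
        rw [mul_add, hφ, hφ, hφ, Submodule.coe_add, fibreCoeff_add g n n f.2.1 h.2.1]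
      map_smul' := fun a f => by
        apply hinj
        have e := ModularForm.qExpansion_smul one_pos one_mem_strictPeriods_SL a (φ f)
        refine Eq.trans ?_ (congrArg (c * ·) e).symm
        rw [mul_smul_comm, hφ, hφ, Submodule.coe_smul, fibreCoeff_smul g n n a f.2.1] }
  have hΦ : Function.Bijective Φ := by
    constructor
    · rw [injective_iff_map_eq_zero]
      intro f hf
      by_contra hne
      refine fibreCoeff_ne_zero f.2.1 (fun h => hne (Subtype.ext h)) ?_
      rw [← hφ f, show φ f = 0 from hf]
      exact (congrArg (c * ·) (UpperHalfPlane.qExpansion_zero 1)).trans (mul_zero c)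
    · intro M
      obtain ⟨f, hf, h⟩ := h₂ M
      exact ⟨⟨f, hf⟩, hinj _ _ ((hφ ⟨f, hf⟩).trans h.symm)⟩
  exact ⟨LinearEquiv.ofBijective Φ hΦ, hφ⟩

lemma discExp_ne_zero : discExp ≠ 0 := by
  rw [discExp]
  refine mul_ne_zero PowerSeries.X_ne_zero (pow_ne_zero _ fun h => ?_)
  have := constantCoeff_eulerProduct
  simp [h] at this

lemma discExp_pow_mul (K k : ℕ) (Q : ℂ[X]) :
    discExp ^ K * (rootE4 ^ (2 * k) * aeval mirrorZ Q) = rootE4 ^ (2 * (6 * K + k))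
      * aeval mirrorZ ((X * (1 - C 432 * X)) ^ K * Q) := by
  rw [map_mul, map_pow, map_mul, aeval_mirrorZ_one_sub, aeval_X, discExp_eq, mul_pow, ← pow_mul]
  ring

/-- Here p = Q (1 - 432X)^(3(2g-2)-3n) is a polynomial for every Q, so every form occurs. -/
theorem exists_linearEquiv_of_le {g n : ℕ} (hg : 1 ≤ g) (hn : n ≤ 2 * g - 2) :
    ∃ Φ : W0 g n ≃ₗ[ℂ] ModularForm 𝒮ℒ (18 * (n : ℤ) + 2 * (g : ℤ) - 2),
      ∀ f : W0 g n, UpperHalfPlane.qExpansion 1 (Φ f) = fibreCoeff g (f : RatFun) n := by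
  obtain ⟨Φ, hΦ⟩ := exists_linearEquiv_of_fibreCoeff (g := g) (n := n)
    (w := 18 * (n : ℤ) + 2 * (g : ℤ) - 2) (c := 1) one_ne_zero
    (fun f hf => by
      obtain ⟨M, hM⟩ := hf.2
      exact ⟨M, by rw [one_mul, hM]⟩)
    (fun M => by
      have hM : IsLevelOneForm (2 * ((9 * n + g - 1 : ℕ) : ℤ)) (UpperHalfPlane.qExpansion 1 M) := by
        rw [show 2 * ((9 * n + g - 1 : ℕ) : ℤ) = 18 * (n : ℤ) + 2 * (g : ℤ) - 2 by lia]
        exact ⟨M, rfl⟩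
      obtain ⟨Q, hQ, h⟩ := hM.exists_modularPolynomial
      obtain ⟨m, hm⟩ : ∃ m, 3 * (2 * g - 2) = m + 3 * n := ⟨3 * (2 * g - 2) - 3 * n, by lia⟩
      have hp : Q * (1 - C 432 * X) ^ (3 * (2 * g - 2))
          = Q * (1 - C 432 * X) ^ m * (1 - C 432 * X) ^ (3 * n) := by
        rw [hm, pow_add, mul_assoc]
      refine ⟨ambiguity g n (Q * (1 - C 432 * X) ^ m),
        (ambiguity_mem_W0_iff hg n _).mpr ⟨Q, hQ, hp⟩, ?_⟩
      rw [one_mul, h, (fibreCoeff_eq_iff hg n _ Q).mpr hp])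
  exact ⟨Φ, fun f => by rw [← hΦ f, one_mul]⟩

/-- Here Q is a multiple of (1 - 432X)^K with K = 3(n-2g+2), hence by symmetry of the polynomial of
Δ^K. Dividing by Δ^K lowers the weight by 12K, to 74(g-1) - 18n. -/
theorem exists_linearEquiv_of_lt {g n : ℕ} (hg : 1 ≤ g) (hn : 2 * g - 2 < n) :
    ∃ Φ : W0 g n ≃ₗ[ℂ] ModularForm 𝒮ℒ (74 * ((g : ℤ) - 1) - 18 * (n : ℤ)),
      ∀ f : W0 g n, discExp ^ (3 * (n - (2 * g - 2))) * UpperHalfPlane.qExpansion 1 (Φ f)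
        = fibreCoeff g (f : RatFun) n := by
  obtain ⟨K, hK⟩ : ∃ K, 3 * n = K + 3 * (2 * g - 2) := ⟨3 * (n - (2 * g - 2)), by lia⟩
  rw [show 3 * (n - (2 * g - 2)) = K by lia]
  refine exists_linearEquiv_of_fibreCoeff (pow_ne_zero _ discExp_ne_zero) ?_ ?_
  · intro f hf
    obtain ⟨p, rfl⟩ := hf.1
    obtain ⟨Q, hQ, hp⟩ := (ambiguity_mem_W0_iff hg n p).mp hf
    have hfQ := (fibreCoeff_eq_iff hg n p Q).mpr hp
    have hd : (1 - C 432 * X) ^ K ∣ Q := by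
      refine ⟨p, mul_right_cancel₀ (pow_ne_zero (3 * (2 * g - 2)) (linear_ne_zero 432)) ?_⟩
      rw [hp, hK, pow_add]
      ring
    obtain ⟨R, rfl, rfl | ⟨hk, hR⟩⟩ := hQ.exists_eq_quadratic_pow_mul K hd
    · refine ⟨0, ?_⟩
      rw [hfQ, mul_zero, map_zero, mul_zero]
      exact (congrArg _ (UpperHalfPlane.qExpansion_zero 1)).trans (mul_zero _)
    · obtain ⟨m, hm⟩ : ∃ m, 9 * n + g - 1 = 6 * K + m := ⟨9 * n + g - 1 - 6 * K, by lia⟩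
      rw [hm, Nat.add_sub_cancel_left] at hR
      obtain ⟨M, hM⟩ : IsLevelOneForm (74 * ((g : ℤ) - 1) - 18 * (n : ℤ)) _ := by
        rw [show 74 * ((g : ℤ) - 1) - 18 * (n : ℤ) = 2 * (m : ℤ) by lia]
        exact hR.isLevelOneForm
      exact ⟨M, by rw [hM, hfQ, hm, discExp_pow_mul]⟩
  · intro M
    rcases lt_or_ge (74 * ((g : ℤ) - 1) - 18 * (n : ℤ)) 0 with hw | hw
    -- In negative weight M = 0, and f = 0 is its preimage.
    · refine ⟨0, zero_mem _, ?_⟩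
      have h0 := fibreCoeff_smul g n n 0 (zero_mem (V0Top g n))
      rw [zero_smul, zero_smul] at h0
      rw [h0, IsLevelOneForm.eq_zero_of_neg ⟨M, rfl⟩ hw, mul_zero]
    · obtain ⟨m, hm⟩ : ∃ m, 9 * n + g - 1 = 6 * K + m := ⟨9 * n + g - 1 - 6 * K, by lia⟩
      have hM : IsLevelOneForm (2 * (m : ℤ)) (UpperHalfPlane.qExpansion 1 M) := by
        rw [show 2 * (m : ℤ) = 74 * ((g : ℤ) - 1) - 18 * (n : ℤ) by lia]
        exact ⟨M, rfl⟩
      obtain ⟨R, hR, h⟩ := hM.exists_modularPolynomial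
      have hQ : IsModularPolynomial (9 * n + g - 1) ((X * (1 - C 432 * X)) ^ K * R) := by
        rw [hm, mul_comm 6 K]
        exact (IsModularPolynomial.quadratic.pow K).mul hR
      -- Removing the factor (1 - 432X)^K from Q leaves the numerator X^K R.
      have hp : (X * (1 - C 432 * X)) ^ K * R * (1 - C 432 * X) ^ (3 * (2 * g - 2))
          = X ^ K * R * (1 - C 432 * X) ^ (3 * n) := by
        rw [hK, pow_add, mul_pow]
        ring
      refine ⟨ambiguity g n (X ^ K * R), (ambiguity_mem_W0_iff hg n _).mpr ⟨_, hQ, hp⟩, ?_⟩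
      rw [h, (fibreCoeff_eq_iff hg n _ _).mpr hp, hm, discExp_pow_mul]

end

end X18

theorem mainTheorem1 (g n : ℕ) (hg : 1 ≤ g) :
    X18.W0 g n = X18.V2 g (19 * (g - 1) / 3) n ∧
    (n ≤ 2 * g - 2 →
      ∃ Φ : X18.W0 g n ≃ₗ[ℂ] ModularForm 𝒮ℒ (18 * (n : ℤ) + 2 * (g : ℤ) - 2),
        ∀ f : X18.W0 g n,
          UpperHalfPlane.qExpansion 1 (Φ f) = X18.fibreCoeff g (f : X18.RatFun) n) ∧
    (2 * g - 2 < n →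
      ∃ Φ : X18.W0 g n ≃ₗ[ℂ] ModularForm 𝒮ℒ (74 * ((g : ℤ) - 1) - 18 * (n : ℤ)),
        ∀ f : X18.W0 g n,
          (PowerSeries.X * X18.eulerProduct ^ 24) ^ (3 * (n - (2 * g - 2)))
            * UpperHalfPlane.qExpansion 1 (Φ f) = X18.fibreCoeff g (f : X18.RatFun) n) :=
  ⟨X18.W0_eq_V2 hg n, X18.exists_linearEquiv_of_le hg, X18.exists_linearEquiv_of_lt hg⟩
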